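/- **Conventions.** $\lambda$ is the security parameter; $q=2^{\ell}$ with $\ell=\log_2 q\ge 1$; elements of $\mathbb Z_q$ are represented in $(-q/2,q/2]$ and $|x|$ is the absolute value of the representative. $D_{\mathbb Z_q,\beta}$ is the truncated discrete Gaussian: probability proportional to $e^{-\pi|x|^2/\beta^2}$ on $\{|x|\le\beta\}$. Attackers are families of polynomial-size quantum circuits, and efficient honest algorithms are families of polynomial-size Boolean circuits, supplied with uniform coins and sampling the stated output distribution up to negligible total variation distance if they are randomized. The assumption $\mathrm{LWE}_{n,q,\chi}$ says that for every $m'$ at most polynomial in $n\log q$, the distributions $(A,sA+e)$ and $(A,u)$ are computationally indistinguishable, where $A\in\mathbb Z_q^{n\times m'}$, $s\in\mathbb Z_q^n$, $u\in\mathbb Z_q^{m'}$ are uniform and $e\leftarrow\chi^{m'}$. **The scheme DualHE.** Let $N=(m+1)\log_2 q$. Let $G\in\mathbb Z_q^{(m+1)\times N}$ be the matrix with $G(a)_i=\sum_{j<\ell}2^j a_{i,j}$ for $a=(a_{i,j})\in\mathbb Z_q^N$, and let $G^{-1}$ be (columnwise) binary decomposition. * *KeyGen:* choose $e_{sk}\in\{0,1\}^m$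 uniformly and sample $A\in\mathbb Z_q^{m\times n}$ with the Micciancio–Peikert trapdoor sampler: the first $m-n\ell$ rows of $A$ form a uniform matrix $\bar A$, the other $n\ell$ rows are $\hat G-R\bar A$, where $\hat G$ has the rows $2^b e_a$ ($a<n$, $b<\ell$) and the trapdoor $R$ has independent entries equal to $0$ with probability $1/2$ and to $\pm1$ with probability $1/4$ each. The public key $A'\in\mathbb Z_q^{(m+1)\times n}$ consists of $A$ and the last row $A^{T}e_{sk}$; the secret key is $sk=(-e_{sk},1)$. * *Enc$(\mu)$:* output $A'S+E+\mu G$ with $S\in\mathbb Z_q^{n\times N}$ uniform and the entries of $E$ independent from $D_{\mathbb Z_q,\beta_{init}}$. * *NAND:* $(C_0,C_1)\mapsto G-C_0\,G^{-1}(C_1)$. * *Dec$(C)$:* for the last column $c$ of $C$ let $b'=sk^Tc$; output $0$ if $|b'|<|b'-q/2|$, and $1$ otherwise. *Leveled scheme.* Given Boolean (NAND) circuits that compute Dec from the bits of $e_{sk}$ and of the last column $c$ of the ciphertext, the leveled scheme obtained by bootstrapping is: KeyGen$(1^\lambda,1^L)$ generates $L+1$ independent key pairs $(pk_i,sk_i)_{0\le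 i\le L}$; the public key is $pk_0$, the evaluation key consists of $pk_{i+1}$ and of encryptions under $pk_{i+1}$ of the bits of $e_{sk_i}$ ($0\le i<L$), the secret key is $(sk_0,sk_L)$. Fresh encryptions are made under $pk_0$. Eval applies the homomorphic NAND gates; to pass from key $i$ to key $i+1$ after each gate level, it evaluates the decryption circuit homomorphically under $pk_{i+1}$ on the encrypted bits of $e_{sk_i}$ (the bits $b$ of $c$ entering as $bG$). Its output is decrypted with $sk_L$. **Theorem.** There is an absolute constant $C$ such that for every polynomial $p$ there is a function $\eta_c:\mathbb N\to\mathbb N$ with $\eta_c(\lambda)=\Theta(\log\lambda)$ such that the following holds. Let $n,m,\ell\ge1$ be functions of $\lambda$ with $n,m\le p(\lambda)$ for all $\lambda$, $m\ge C\,n\log_2 q$ for all sufficiently large $\lambda$, and $m$ at most a polynomial in $n\log_2 q$, where $q=2^\ell$. Then there are Boolean circuits $D_\lambda$ that compute decryption, of depth less than $\eta_c(\lambda)$ for all sufficiently large $\lambda$, such that for every integer-valued function $\beta_{init}$ of $\lambda$ with $2\sqrt n\le\beta_{init}$ and $$\beta_{init}(N+1)^{\eta_c}<\frac{q}{4(m+1)}\qquad\text{for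 all sufficiently large }\lambda,$$ the assumption $\mathrm{LWE}_{n,q,D_{\mathbb Z_q,\beta_{init}}}$ implies: 1. DualHE is IND-CPA secure: $(pk,\mathrm{Enc}_{pk}(0))$ and $(pk,\mathrm{Enc}_{pk}(1))$ are computationally indistinguishable. 2. For every polynomially bounded $L=L(\lambda)$, the leveled scheme obtained from DualHE by bootstrapping with $D_\lambda$ is IND-CPA secure, the evaluation key being given to the attacker. 3. This scheme is leveled fully homomorphic: the bit length of the output of Eval is bounded by a polynomial in $\lambda$ alone, whatever the depth bound, the evaluated circuit and the number of inputs; and for every polynomially bounded $L=L(\lambda)$, KeyGen, Enc, Dec and Eval are efficient (Eval in $\lambda$ and the size of the evaluated circuit, which is part of its input), encryptions decrypt correctly, and for every Boolean circuit $f$ of depth at most $L$ and all encryptions $c_1,\dots,c_l$ of bits, $\mathrm{Dec}(\mathrm{Eval}(f,c_1,\dots,c_l))=f(\mathrm{Dec}(c_1),\dots,\mathrm{Dec}(c_l))$, both with all but negligible probability. -/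

import Mathlib

open Filter Asymptotics Topology

/-! ### Asymptotics in the security parameter -/

/-- Polynomially bounded functions of the security parameter. -/
def PolyBounded (f : ℕ → ℕ) : Prop :=
  ∃ p : Polynomial ℕ, ∀ lam, f lam ≤ p.eval lam

/-- Negligible functions: `lam ^ c * f lam → 0` for every `c`. -/
def Negligible (f : ℕ → ℝ) : Prop :=
  SuperpolynomialDecay atTop (fun lam : ℕ => (lam : ℝ)) f

/-! ### Bit strings -/

/-- An injective encoding of `α` by bit strings of one fixed length. -/
class BitCode (α : Type) where
  len : ℕ
  encode : α → List Bool
  length_encode : ∀ a, (encode a).length = len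
  encode_injective : Function.Injective encode

open BitCode (encode)

instance : BitCode Unit where
  len := 0
  encode _ := []
  length_encode _ := rfl
  encode_injective _ _ _ := rfl

instance : BitCode Bool where
  len := 1
  encode b := [b]
  length_encode _ := rfl
  encode_injective a b h := by simpa using h

instance {α β : Type} [BitCode α] [BitCode β] : BitCode (α × β) where
  len := BitCode.len α + BitCode.len β
  encode x := encode x.1 ++ encode x.2
  length_encode x := by simp [BitCode.length_encode]
  encode_injective x y h := by
    obtain ⟨h1, h2⟩ := List.append_inj h (by simp [BitCode.length_encode])
    exact Prod.ext (BitCode.encode_injective h1) (BitCode.encode_injective h2)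

theorem flatten_ofFn_encode_length {α : Type} [BitCode α] (k : ℕ) (f : Fin k → α) :
    (List.ofFn fun i => encode (f i)).flatten.length = k * BitCode.len α := by
  induction k with
  | zero => simp
  | succ k ih =>
    rw [List.ofFn_succ, List.flatten_cons, List.length_append, ih, BitCode.length_encode]
    ring

theorem flatten_ofFn_encode_injective {α : Type} [BitCode α] (k : ℕ) :
    Function.Injective fun f : Fin k → α => (List.ofFn fun i => encode (f i)).flatten := by
  induction k with
  | zero => intro f g _; exact Subsingleton.elim f g
  | succ k ih =>
    intro f g h
    simp only [List.ofFn_succ, List.flatten_cons] at h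
    obtain ⟨h1, h2⟩ := List.append_inj h (by simp [BitCode.length_encode])
    have h3 := ih (a₁ := fun i => f i.succ) (a₂ := fun i => g i.succ) h2
    funext i
    refine Fin.cases ?_ (fun j => ?_) i
    · exact BitCode.encode_injective h1
    · exact congrFun h3 j

/-- Tuples are encoded by concatenation. -/
instance {α : Type} [BitCode α] {k : ℕ} : BitCode (Fin k → α) where
  len := k * BitCode.len α
  encode f := (List.ofFn fun i => encode (f i)).flatten
  length_encode f := flatten_ofFn_encode_length k f
  encode_injective := flatten_ofFn_encode_injective k

instance {α : Type} [BitCode α] {k l : ℕ} : BitCode (Fin k × Fin l → α) where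
  len := BitCode.len (Fin k → Fin l → α)
  encode f := encode fun (i : Fin k) (j : Fin l) => f (i, j)
  length_encode _ := BitCode.length_encode _
  encode_injective f g h := by
    funext ⟨i, j⟩
    exact congrFun (congrFun (BitCode.encode_injective h) i) j

instance {k : ℕ} {ι α : Type} [BitCode (ι → α)] : BitCode (Matrix (Fin k) ι α) :=
  inferInstanceAs (BitCode (Fin k → ι → α))

/-- The ring `ℤ_q` of integers modulo `q = 2 ^ ℓ`. -/
abbrev Zq (ℓ : ℕ) : Type := ZMod (2 ^ ℓ)

/-- Elements of `ℤ_q` are encoded in binary, least significant bit first. -/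
instance (ℓ : ℕ) : BitCode (Zq ℓ) where
  len := ℓ
  encode x := List.ofFn fun b : Fin ℓ => x.val.testBit b
  length_encode _ := by simp
  encode_injective x y h := by
    have h' := List.ofFn_injective h
    apply ZMod.val_injective
    apply Nat.eq_of_testBit_eq
    intro i
    by_cases hi : i < ℓ
    · exact congrFun h' ⟨i, hi⟩
    · rw [Nat.testBit_lt_two_pow, Nat.testBit_lt_two_pow]
      · exact lt_of_lt_of_le (ZMod.val_lt y) (Nat.pow_le_pow_right (by norm_num) (by omega))
      · exact lt_of_lt_of_le (ZMod.val_lt x) (Nat.pow_le_pow_right (by norm_num) (by omega))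

/-! ### Boolean circuits -/

/-- `Net k w`: NAND circuits with `k` input wires and `w` wires in total; each gate appends one
wire, the NAND of two earlier ones. -/
inductive Net (k : ℕ) : ℕ → Type
  | inputs : Net k k
  | gate {w : ℕ} (c : Net k w) (a b : Fin w) : Net k (w + 1)

namespace Net

/-- The values of all wires, for an arbitrary interpretation `nand` of the gate. -/
def eval {k : ℕ} {α : Type} (nand : α → α → α) (x : Fin k → α) : {w : ℕ} → Net k w → Fin w → α
  | _, .inputs => x
  | _, .gate c a b => Fin.snoc (α := fun _ => α) (c.eval nand x)
      (nand (c.eval nand x a) (c.eval nand x b))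

/-- The gate list as a bit string; a wire among `w` wires is given by its indicator vector. -/
def encode {k : ℕ} : {w : ℕ} → Net k w → List Bool
  | _, .inputs => []
  | _, .gate c a b => c.encode ++ List.ofFn (fun i => decide (i = a)) ++
      List.ofFn (fun i => decide (i = b))

end Net

/-- A Boolean NAND circuit with `k` inputs and `o` outputs. -/
structure Circuit (k o : ℕ) where
  width : ℕ
  net : Net k width
  out : Fin o → Fin width

namespace Circuit

variable {k o : ℕ}

def eval {α : Type} (C : Circuit k o) (nand : α → α → α) (x : Fin k → α) (j : Fin o) : α :=
  C.net.eval nand x (C.out j)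

/-- The Boolean function computed by the circuit. -/
def evalBool (C : Circuit k o) (x : Fin k → Bool) : Fin o → Bool :=
  C.eval (fun a b => !(a && b)) x

/-- Depth: the largest number of gates on a path from an input to an output. -/
def depth (C : Circuit k o) : ℕ :=
  Finset.univ.sup (C.eval (fun a b => max a b + 1) (fun _ => (0 : ℕ)))

def size (C : Circuit k o) : ℕ := C.width + o

def encode (C : Circuit k o) : List Bool :=
  C.net.encode ++ (List.ofFn fun j => List.ofFn fun i => decide (i = C.out j)).flatten

/-- Run the circuit on a bit string (inputs beyond the end of the string are `false`). -/
def run (C : Circuit k o) (x : List Bool) : List Bool :=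
  List.ofFn (C.evalBool fun i => x.getD i false)

end Circuit

/-! ### Distributions and probabilistic polynomial time -/

/-- The product distribution: independent samples `x i ← p i`. -/
noncomputable def piPMF {ι α : Type} [Fintype ι] [DecidableEq ι] [Fintype α]
    (p : ι → PMF α) : PMF (ι → α) :=
  PMF.ofFintype (fun x => ∏ i, p i (x i)) (by
    have h := Finset.prod_univ_sum (fun _ : ι => (Finset.univ : Finset α)) (fun i a => p i a)
    rw [Fintype.piFinset_univ] at h
    rw [← h]
    refine Finset.prod_eq_one fun i _ => ?_
    have h1 := (p i).tsum_coe
    rwa [tsum_fintype] at h1)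

/-- Total variation distance. -/
noncomputable def tvDist {α : Type} (p q : PMF α) : ℝ :=
  (1 / 2) * ∑' x, |(p x).toReal - (q x).toReal|

/-- The probability that a random bit is `true`. -/
noncomputable def PMF.prTrue (p : PMF Bool) : ℝ := (p true).toReal

/-- A randomized procedure is PPT if Boolean circuits of polynomial size, fed with the input and
with uniform coins, sample its output up to negligible total variation distance. -/
def IsPPT {α β : ℕ → Type} [∀ lam, BitCode (α lam)] [∀ lam, BitCode (β lam)]
    (f : ∀ lam, α lam → PMF (β lam)) : Prop :=
  ∃ (k o r : ℕ → ℕ) (C : ∀ lam, Circuit (k lam) (o lam)) (ε : ℕ → ℝ),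
    PolyBounded (fun lam => (C lam).size) ∧ Negligible ε ∧
    ∀ lam a, tvDist
      ((PMF.uniformOfFintype (Fin (r lam) → Bool)).map fun coins =>
        (C lam).run (encode a ++ List.ofFn coins))
      ((f lam a).map encode) ≤ ε lam

/-- A deterministic procedure is polynomial time if Boolean circuits of polynomial size compute
it. -/
def IsPolyTime {α β : ℕ → Type} [∀ lam, BitCode (α lam)] [∀ lam, BitCode (β lam)]
    (f : ∀ lam, α lam → β lam) : Prop :=
  ∃ (k o : ℕ → ℕ) (C : ∀ lam, Circuit (k lam) (o lam)),
    PolyBounded (fun lam => (C lam).size) ∧ ∀ lam a, (C lam).run (encode a) = encode (f lam a)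

/-! ### Quantum polynomial-time attackers -/

/-- Gates on `w` qubits: Clifford generators and the Toffoli gate. -/
inductive QGate (w : ℕ)
  | X (i : Fin w)
  | H (i : Fin w)
  | S (i : Fin w)
  | CNOT (i j : Fin w) (hij : i ≠ j)
  | Toffoli (i j k : Fin w) (hij : i ≠ j) (hik : i ≠ k) (hjk : j ≠ k)

/-- A pure state of `w` qubits, by its amplitudes in the standard basis. -/
abbrev QState (w : ℕ) : Type := (Fin w → Bool) → ℂ

/-- The action of a gate on amplitudes (the last index of `CNOT` and `Toffoli` is the target). -/
noncomputable def QGate.apply {w : ℕ} : QGate w → QState w → QState w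
  | .X i, ψ => fun x => ψ (Function.update x i (!x i))
  | .H i, ψ => fun x => ((1 / √2 : ℝ) : ℂ) *
      (ψ (Function.update x i false) + (if x i then -1 else 1) * ψ (Function.update x i true))
  | .S i, ψ => fun x => (if x i then Complex.I else 1) * ψ x
  | .CNOT i j _, ψ => fun x => ψ (Function.update x j (xor (x j) (x i)))
  | .Toffoli i j k _ _ _, ψ => fun x => ψ (Function.update x k (xor (x k) (x i && x j)))

/-- A quantum circuit; at the end qubit `out` is measured. -/
structure QCircuit where
  width : ℕ
  gates : List (QGate width)
  out : Fin width

namespace QCircuit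

def size (Q : QCircuit) : ℕ := Q.width + Q.gates.length

/-- Start in the basis state given by the input string followed by zeros; apply all gates. -/
noncomputable def finalState (Q : QCircuit) (x : List Bool) : QState Q.width :=
  Q.gates.foldl (fun ψ g => g.apply ψ)
    (fun y => if y = (fun i : Fin Q.width => x.getD i false) then 1 else 0)

/-- The probability that the measurement of the output qubit gives `1`. -/
noncomputable def acceptProb (Q : QCircuit) (x : List Bool) : ℝ :=
  ∑ y : Fin Q.width → Bool, if y Q.out then ‖Q.finalState x y‖ ^ 2 else 0

end QCircuit

/-- Quantum polynomial-time attackers: families of quantum circuits of polynomial size. -/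
def IsQPT (Q : ℕ → QCircuit) : Prop := PolyBounded fun lam => (Q lam).size

/-- The probability that the attacker outputs `1` on a sample from `D`. -/
noncomputable def QCircuit.acceptOn (Q : QCircuit) {α : Type} [BitCode α] (D : PMF α) : ℝ :=
  ∑' x, (D x).toReal * Q.acceptProb (encode x)

/-- Computational indistinguishability. -/
def CompIndist {X : ℕ → Type} [∀ lam, BitCode (X lam)] (D₀ D₁ : ∀ lam, PMF (X lam)) : Prop :=
  ∀ Q : ℕ → QCircuit, IsQPT Q →
    Negligible fun lam => |(Q lam).acceptOn (D₀ lam) - (Q lam).acceptOn (D₁ lam)|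

/-! ### Learning with errors -/

/-- `|x|` for `x ∈ ℤ_q`: the absolute value of the representative in `(-q/2, q/2]`. -/
def Zq.abs {ℓ : ℕ} (x : Zq ℓ) : ℤ := |x.valMinAbs|

/-- The weight of `x` under the truncated discrete Gaussian with parameter `B`. -/
noncomputable def gaussianWeight (ℓ B : ℕ) (x : Zq ℓ) : ENNReal :=
  if x.abs ≤ B then ENNReal.ofReal (Real.exp (-Real.pi * (x.abs : ℝ) ^ 2 / (B : ℝ) ^ 2)) else 0

/-- The truncated discrete Gaussian distribution on `ℤ_q` with parameter `B`. -/
noncomputable def gaussian (ℓ B : ℕ) : PMF (Zq ℓ) :=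
  PMF.normalize (gaussianWeight ℓ B)
    (by
      intro h
      have h0 := ENNReal.tsum_eq_zero.mp h 0
      simp [gaussianWeight, Zq.abs] at h0)
    (by
      rw [tsum_fintype]
      refine ENNReal.sum_ne_top.mpr fun x _ => ?_
      unfold gaussianWeight
      split_ifs <;> simp)

/-- `(A, s A + e)` with `A ∈ ℤ_q^{n × m}` and `s` uniform and `e ← χ^m`. -/
noncomputable def lweSample (n m ℓ : ℕ) (χ : PMF (Zq ℓ)) :
    PMF (Matrix (Fin n) (Fin m) (Zq ℓ) × (Fin m → Zq ℓ)) := do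
  let A ← PMF.uniformOfFintype (Matrix (Fin n) (Fin m) (Zq ℓ))
  let s ← PMF.uniformOfFintype (Fin n → Zq ℓ)
  let e ← piPMF fun _ : Fin m => χ
  pure (A, Matrix.vecMul s A + e)

/-- `(A, u)` uniform. -/
noncomputable def lweUniform (n m ℓ : ℕ) :
    PMF (Matrix (Fin n) (Fin m) (Zq ℓ) × (Fin m → Zq ℓ)) :=
  PMF.uniformOfFintype _

/-- The `LWE_{n,q,χ}` assumption, `q = 2 ^ ℓ`: hardness of `LWE_{n,m,q,χ}` for every `m` that is
at most a polynomial in `n log q`. -/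
def LWEHard (n ℓ : ℕ → ℕ) (χ : ∀ lam, PMF (Zq (ℓ lam))) : Prop :=
  ∀ m : ℕ → ℕ, (∃ p : Polynomial ℕ, ∀ lam, m lam ≤ p.eval (n lam * ℓ lam)) →
    CompIndist (fun lam => lweSample (n lam) (m lam) (ℓ lam) (χ lam))
      (fun lam => lweUniform (n lam) (m lam) (ℓ lam))

/-! ### Encryption schemes -/

/-- IND-CPA security, for a key generation that outputs the public data `P` (public key together
with the evaluation key, if there is one) and an encryption algorithm using that data. -/
def IsINDCPA {P C : ℕ → Type} [∀ lam, BitCode (P lam)] [∀ lam, BitCode (C lam)]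
    (key : ∀ lam, PMF (P lam)) (enc : ∀ lam, P lam → Bool → PMF (C lam)) : Prop :=
  CompIndist
    (fun lam => (key lam).bind fun pub => (enc lam pub false).map fun c => (pub, c))
    (fun lam => (key lam).bind fun pub => (enc lam pub true).map fun c => (pub, c))

/-- The syntax of a homomorphic encryption scheme whose key generation takes the security
parameter `lam` and a depth bound `L`. -/
structure LeveledHE where
  PK : ℕ → ℕ → Type
  EVK : ℕ → ℕ → Type
  SK : ℕ → ℕ → Type
  CT : ℕ → ℕ → Type
  [codePK : ∀ lam L, BitCode (PK lam L)]
  [codeEVK : ∀ lam L, BitCode (EVK lam L)]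
  [codeSK : ∀ lam L, BitCode (SK lam L)]
  [codeCT : ∀ lam L, BitCode (CT lam L)]
  [fintypeCT : ∀ lam L, Fintype (CT lam L)]
  keyGen : ∀ lam L, PMF (PK lam L × EVK lam L × SK lam L)
  enc : ∀ lam L, PK lam L → Bool → PMF (CT lam L)
  dec : ∀ lam L, SK lam L → CT lam L → Bool
  eval : ∀ lam L {l : ℕ}, EVK lam L → Circuit l 1 → (Fin l → CT lam L) → CT lam L

namespace LeveledHE

attribute [instance] codePK codeEVK codeSK codeCT fintypeCT

variable (S : LeveledHE)

/-- IND-CPA security for every polynomially bounded depth; the attacker sees the public key, the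
evaluation key and a ciphertext. -/
def IndCPA : Prop :=
  ∀ L : ℕ → ℕ, PolyBounded L →
    IsINDCPA (P := fun lam => S.PK lam (L lam) × S.EVK lam (L lam))
      (C := fun lam => S.CT lam (L lam))
      (fun lam => (S.keyGen lam (L lam)).map fun K => (K.1, K.2.1))
      (fun lam pub b => S.enc lam (L lam) pub.1 b)

/-- Compactness: the bit length of the output of `eval` is bounded by a polynomial in the security
parameter, regardless of the depth bound, the evaluated circuit and the number of inputs. -/
def Compact : Prop :=
  ∃ s : Polynomial ℕ, ∀ (lam L l : ℕ) (evk : S.EVK lam L) (f : Circuit l 1)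
    (c : Fin l → S.CT lam L), (encode (S.eval lam L evk f c)).length ≤ s.eval lam

/-- `eval` runs in polynomial time in the security parameter and the size of the evaluated
circuit, which is part of the input. -/
def EvalPolyTime (L : ℕ → ℕ) : Prop :=
  ∃ p : Polynomial ℕ, ∀ lam l w : ℕ, ∃ (k o : ℕ) (U : Circuit k o),
    U.size ≤ p.eval (lam + w) ∧
    ∀ (evk : S.EVK lam (L lam)) (f : Circuit l 1) (c : Fin l → S.CT lam (L lam)),
      f.width = w → f.depth ≤ L lam →
      U.run (encode evk ++ f.encode ++ encode c) = encode (S.eval lam (L lam) evk f c)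

/-- Up to negligible probability, encryptions decrypt correctly, and homomorphic evaluation of any
circuit `f` of depth at most `L` on encryptions of bits commutes with decryption. -/
def Correct (L : ℕ → ℕ) : Prop :=
  ∃ ε : ℕ → ℝ, Negligible ε ∧ ∀ lam,
    (∀ b : Bool, 1 - ε lam ≤ PMF.prTrue (do
      let K ← S.keyGen lam (L lam)
      let c ← S.enc lam (L lam) K.1 b
      pure (S.dec lam (L lam) K.2.2 c == b))) ∧
    ∀ (l : ℕ) (f : Circuit l 1) (b : Fin l → Bool), f.depth ≤ L lam →
      1 - ε lam ≤ PMF.prTrue (do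
        let K ← S.keyGen lam (L lam)
        let c ← piPMF fun i => S.enc lam (L lam) K.1 (b i)
        pure (S.dec lam (L lam) K.2.2 (S.eval lam (L lam) K.2.1 f c) ==
          f.evalBool (fun i => S.dec lam (L lam) K.2.2 (c i)) 0))

/-- Leveled fully homomorphic encryption: a compact quadruple of efficient algorithms which, for
every polynomially bounded depth `L`, correctly evaluates all Boolean circuits of depth `L`. -/
def IsLeveledFHE : Prop :=
  S.Compact ∧ ∀ L : ℕ → ℕ, PolyBounded L →
    IsPPT (α := fun _ => Unit)
      (β := fun lam => S.PK lam (L lam) × S.EVK lam (L lam) × S.SK lam (L lam))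
      (fun lam _ => S.keyGen lam (L lam)) ∧
    IsPPT (α := fun lam => S.PK lam (L lam) × Bool) (β := fun lam => S.CT lam (L lam))
      (fun lam a => S.enc lam (L lam) a.1 a.2) ∧
    IsPolyTime (α := fun lam => S.SK lam (L lam) × S.CT lam (L lam)) (β := fun _ => Bool)
      (fun lam a => S.dec lam (L lam) a.1 a.2) ∧
    S.EvalPolyTime L ∧ S.Correct L

end LeveledHE

/-! ### The scheme Dual -/

namespace Dual

/-- Public keys `A' ∈ ℤ_q^{(m+1) × n}`. -/
abbrev PK (n m ℓ : ℕ) : Type := Matrix (Fin (m + 1)) (Fin n) (Zq ℓ)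

/-- The secret vector `e_sk ∈ {0,1}^m`. -/
abbrev SK (m : ℕ) : Type := Fin m → Bool

/-- Trapdoors: matrices with entries in `{-1, 0, 1}`. -/
abbrev Trapdoor (n m ℓ : ℕ) : Type := Matrix (Fin (n * ℓ)) (Fin (m - n * ℓ)) SignType

/-- A trapdoor entry: `0` with probability `1/2` and `±1` with probability `1/4` each. -/
noncomputable def trapdoorEntry : PMF SignType :=
  (PMF.uniformOfFintype (Bool × Bool)).map fun b =>
    if b.1 then (if b.2 then 1 else -1) else 0

/-- The matrix with trapdoor `R`: the first `m - n ℓ` rows are `Abar`, and the remaining `n ℓ`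
rows are `G - R Abar` for the gadget matrix `G` with the rows `2 ^ b • e_a`
(`a < n`, `b < ℓ`). -/
def trapdoorMatrix {n m ℓ : ℕ} (Abar : Matrix (Fin (m - n * ℓ)) (Fin n) (Zq ℓ))
    (R : Trapdoor n m ℓ) : Matrix (Fin m) (Fin n) (Zq ℓ) :=
  Matrix.of fun i a =>
    if h : (i : ℕ) < m - n * ℓ then Abar ⟨i, h⟩ a
    else
      let r : Fin (n * ℓ) := ⟨i - (m - n * ℓ), by omega⟩
      (if (finProdFinEquiv.symm r).1 = a then 2 ^ ((finProdFinEquiv.symm r).2 : ℕ) else 0) -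
        ∑ j, (R r j : Zq ℓ) * Abar j a

/-- The trapdoor sampler (Micciancio and Peikert): a matrix together with its trapdoor. -/
noncomputable def genTrap (n m ℓ : ℕ) :
    PMF (Matrix (Fin m) (Fin n) (Zq ℓ) × Trapdoor n m ℓ) := do
  let Abar ← PMF.uniformOfFintype (Matrix (Fin (m - n * ℓ)) (Fin n) (Zq ℓ))
  let R ← piPMF fun _ : Fin (n * ℓ) => piPMF fun _ : Fin (m - n * ℓ) => trapdoorEntry
  pure (trapdoorMatrix Abar R, R)

/-- `e_sk` as a vector over `ℤ_q`. -/
def skBits {m : ℕ} (ℓ : ℕ) (e : SK m) : Fin m → Zq ℓ := fun i => if e i then 1 else 0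

/-- The decryption vector `sk = (-e_sk, 1)`. -/
def skVec {m : ℕ} (ℓ : ℕ) (e : SK m) : Fin (m + 1) → Zq ℓ :=
  Fin.snoc (α := fun _ => Zq ℓ) (-skBits ℓ e) 1

/-- `A'`: the rows of `A`, and the last row `Aᵀ e_sk`. -/
def publicKey {n m ℓ : ℕ} (A : Matrix (Fin m) (Fin n) (Zq ℓ)) (e : SK m) : PK n m ℓ :=
  Matrix.of (Fin.snoc (α := fun _ => Fin n → Zq ℓ) (fun i => A i)
    (Matrix.mulVec A.transpose (skBits ℓ e)))

/-- Key generation: public key, secret key and trapdoor. -/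
noncomputable def keyGen (n m ℓ : ℕ) : PMF (PK n m ℓ × SK m × Trapdoor n m ℓ) := do
  let e ← PMF.uniformOfFintype (SK m)
  let At ← genTrap n m ℓ
  pure (publicKey At.1 e, e, At.2)

/-- Decryption: `0` if `b' = skᵀ c` is closer to `0` than to `q/2` modulo `q`, otherwise `1`. -/
def dec {m ℓ : ℕ} (e : SK m) (c : Fin (m + 1) → Zq ℓ) : Bool :=
  let b' : Zq ℓ := ∑ i, skVec ℓ e i * c i
  if b'.abs < (b' - 2 ^ (ℓ - 1) : Zq ℓ).abs then false else true

/-- The bits of a ciphertext. -/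
def ctBits {m ℓ : ℕ} (c : Fin (m + 1) → Zq ℓ) : Fin ((m + 1) * ℓ) → Bool :=
  fun j => (c (finProdFinEquiv.symm j).1).val.testBit (finProdFinEquiv.symm j).2

/-- `D` is a Boolean circuit which computes decryption, from the bits of `e_sk` followed by the
bits of the ciphertext. -/
def IsDecCircuit {m ℓ : ℕ} (D : Circuit (m + (m + 1) * ℓ) 1) : Prop :=
  ∀ (e : SK m) (c : Fin (m + 1) → Zq ℓ), D.evalBool (Fin.append e (ctBits c)) 0 = dec e c

end Dual

/-! ### The scheme DualHE -/

namespace DualHE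

/-- Ciphertexts in `ℤ_q^{(m+1) × N}`, `N = (m+1) log q`; column `(i, b)` stands for bit `b` of
coordinate `i`. -/
abbrev CT (m ℓ : ℕ) : Type := Matrix (Fin (m + 1)) (Fin (m + 1) × Fin ℓ) (Zq ℓ)

/-- The gadget matrix `G`. -/
def G (m ℓ : ℕ) : CT m ℓ :=
  Matrix.of fun i j => if i = j.1 then 2 ^ (j.2 : ℕ) else 0

/-- The binary decomposition `G⁻¹`, column by column. -/
def Ginv {m ℓ : ℕ} (C : CT m ℓ) :
    Matrix (Fin (m + 1) × Fin ℓ) (Fin (m + 1) × Fin ℓ) (Zq ℓ) :=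
  Matrix.of fun i j => if (C i.1 j).val.testBit i.2 then 1 else 0

/-- Encryption: `A' S + E + μ G`. -/
noncomputable def enc {n m ℓ : ℕ} (β : ℕ) (pk : Dual.PK n m ℓ) (μ : Bool) : PMF (CT m ℓ) := do
  let S ← PMF.uniformOfFintype (Matrix (Fin n) (Fin (m + 1) × Fin ℓ) (Zq ℓ))
  let E ← piPMF fun _ : Fin (m + 1) => piPMF fun _ : Fin (m + 1) × Fin ℓ => gaussian ℓ β
  pure (pk * S + Matrix.of E + (if μ then G m ℓ else 0))

/-- Homomorphic NAND. -/
def nand {m ℓ : ℕ} (C₀ C₁ : CT m ℓ) : CT m ℓ := G m ℓ - C₀ * Ginv C₁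

/-- Conversion to a ciphertext of Dual: the last column. -/
def convert {m ℓ : ℕ} (C : CT m ℓ) : Fin (m + 1) → Zq ℓ :=
  fun i => if h : 0 < ℓ then C i (Fin.last m, ⟨ℓ - 1, by omega⟩) else 0

def dec {m ℓ : ℕ} (e : Dual.SK m) (C : CT m ℓ) : Bool := Dual.dec e (convert C)

/-- Bootstrapping: evaluate the decryption circuit `D` homomorphically on encryptions (under a new
key) of the bits of the old secret key; the bits `b` of the old ciphertext enter as `b G`. -/
def refresh {m ℓ : ℕ} (D : Circuit (m + (m + 1) * ℓ) 1) (encSK : Fin m → CT m ℓ) (C : CT m ℓ) :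
    CT m ℓ :=
  D.eval nand
    (Fin.append encSK fun j => if Dual.ctBits (convert C) j then G m ℓ else 0) 0

/-- The evaluation key of the leveled scheme with keys `0, …, L`: for each `i < L` the public key
`i + 1`, and encryptions under it of the bits of the secret key `i`. -/
abbrev EVK (n m ℓ L : ℕ) : Type := Fin L → Dual.PK n m ℓ × (Fin m → CT m ℓ)

/-- From a ciphertext under key `d` to a ciphertext under key `d + 1`. -/
def step {n m ℓ L : ℕ} (D : Circuit (m + (m + 1) * ℓ) 1) (evk : EVK n m ℓ L) (d : ℕ)
    (C : CT m ℓ) : CT m ℓ :=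
  if h : d < L then refresh D (evk ⟨d, h⟩).2 C else 0

/-- Leveled evaluation. A wire of the circuit carries a ciphertext `u d` under key `d` for each `d`
from the depth of the wire on (`u d` is irrelevant for smaller `d`). An input is passed on from key
to key; a gate applies the homomorphic NAND under key `d` and passes the result on to key `d + 1`.
The output is the ciphertext under key `L`. -/
def leveledEval {n m ℓ L l : ℕ} (D : Circuit (m + (m + 1) * ℓ) 1) (evk : EVK n m ℓ L)
    (f : Circuit l 1) (c : Fin l → CT m ℓ) : CT m ℓ :=
  f.eval (α := ℕ → CT m ℓ)
    (fun u v d => match d with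
      | 0 => 0
      | d + 1 => step D evk d (nand (u d) (v d)))
    (fun i d => Nat.rec (c i) (fun d' C => step D evk d' C) d) 0 L

/-- Key generation of the leveled scheme: `L + 1` independent keys of DualHE, and encryptions of
the bits of each secret key under the next public key. The public key is that of key `0`; the
secret key consists of the secret keys `0` and `L`. -/
noncomputable def leveledKeyGen (n m ℓ β L : ℕ) :
    PMF (Dual.PK n m ℓ × EVK n m ℓ L × (Dual.SK m × Dual.SK m)) := do
  let K ← piPMF fun _ : Fin (L + 1) => Dual.keyGen n m ℓ
  let c ← piPMF fun i : Fin L => piPMF fun j : Fin m =>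
    enc β (K i.succ).1 ((K i.castSucc).2.1 j)
  pure ((K 0).1, fun i => ((K i.succ).1, c i), ((K 0).2.1, (K (Fin.last L)).2.1))

/-- The leveled homomorphic scheme obtained from DualHE by bootstrapping with the decryption
circuits `D`. A ciphertext carries a bit that tells outputs of the evaluation (to be decrypted
with secret key `L`) from fresh encryptions (to be decrypted with secret key `0`). -/
noncomputable def leveled (n m ℓ β : ℕ → ℕ)
    (D : ∀ lam, Circuit (m lam + (m lam + 1) * ℓ lam) 1) : LeveledHE where
  PK lam _ := Dual.PK (n lam) (m lam) (ℓ lam)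
  EVK lam L := EVK (n lam) (m lam) (ℓ lam) L
  SK lam _ := Dual.SK (m lam) × Dual.SK (m lam)
  CT lam _ := Bool × CT (m lam) (ℓ lam)
  keyGen lam L := leveledKeyGen (n lam) (m lam) (ℓ lam) (β lam) L
  enc lam _ pk μ := (enc (β lam) pk μ).map fun C => (false, C)
  dec _ _ sk c := dec (if c.1 then sk.2 else sk.1) c.2
  eval lam _ _ evk f c := (true, leveledEval (D lam) evk f fun i => (c i).2)

end DualHE

/-!
The constant is `C = 4`. The noise condition gives `2 ^ ℓ > (N + 1) ^ η` with `η` of order `log λ`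
at least, so that `ℓ > η`, hence `N + 1` exceeds every constant, and `2 ^ ℓ` is superpolynomial
(`Negligible.half_pow_of_pow_lt`). This makes the statistical errors of the security proof
negligible.

*Security.* By the leftover hash lemma (`leftover_hash`), applied to the rows of the trapdoor and to
the secret vector, the public key `A'` is statistically close to uniform when `m ≥ 4 n ℓ`
(`Dual.tvDist_pkDist_le`). For uniform `A'`, the columns of `A' S + E` are LWE samples with a common
matrix and separate secrets, so a hybrid over the columns makes the public key together with
polynomially many encryptions look uniform (`DualHE.compIndist_encBlock`). In the leveled scheme the
secret key `i` is used only in encryptions under key `i + 1`. Replacing the keys by uniform data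
from the last one down (`DualHE.compIndist_chain`) removes all dependence on the challenge bit. Each
step is a reduction to which `CompIndist.bind_map` applies: a classical circuit can be put in front
of a quantum one (`QCircuit.exists_precompose`), and since attackers are nonuniform, the best value
of the remaining randomness is hardwired.

*Correctness.* A NAND gate multiplies the noise bound by at most `N + 1` (`DualHE.Encrypts.nand`),
and decryption is correct while the noise is below `q / 4` (`DualHE.Encrypts.dec_eq`). Refreshing
turns any decryptable ciphertext into one with the noise of the homomorphically evaluated decryption
circuit, `(m + 1) β (N + 1) ^ depth`, and the noise condition leaves room for this and one more gate
(`DualHE.GoodKeys.dec_leveledEval`). This needs decryption in depth `O(log λ)`: the inner product of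
`m + 1` numbers is reduced to a sum of two by a tree of carry-save adders, these are added by carry
lookahead, and the comparison only asks whether `b' + q / 4` is zero or has its top bit set
(`Dual.exists_decCircuit`).

*Efficiency.* `Computes B s T` says that `s` NAND gates compute the Boolean functions in `T` from
those in `B`. Its closure properties give circuits for the arithmetic of `ℤ_q` and for all
algorithms of the scheme, without handling explicit gate lists. For the evaluation, the circuit to
be evaluated is part of the input, and its wires are selected by their indicator vectors
(`Computes.net_eval_of_encode`). For key generation and encryption only the Gaussian is not
immediate: since `v ^ 2 = ∑ v_i v_j 2 ^ (i + j)` for the binary digits of `v`, its weight is a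
product of biases of independent coins, and rejection sampling with those coins produces it up to a
negligible error (`GaussianSampler.samplable_gaussian`).
-/

/-! ### Polynomial bounds and negligible functions -/

/-- `f` is bounded by a polynomial in the size `μ` of its argument. -/
def PolyBd {ι : Type*} (μ f : ι → ℕ) : Prop :=
  ∃ p : Polynomial ℕ, ∀ i, f i ≤ p.eval (μ i)

theorem Polynomial.eval_mono_nat (p : Polynomial ℕ) {a b : ℕ} (h : a ≤ b) :
    p.eval a ≤ p.eval b := by
  rw [Polynomial.eval_eq_sum, Polynomial.eval_eq_sum]
  exact Finset.sum_le_sum fun i _ => Nat.mul_le_mul_left _ (Nat.pow_le_pow_left h i)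

namespace PolyBd

variable {ι : Type*} {μ f g : ι → ℕ}

theorem mono (hg : PolyBd μ g) (h : ∀ i, f i ≤ g i) : PolyBd μ f := by
  obtain ⟨p, hp⟩ := hg
  exact ⟨p, fun i => (h i).trans (hp i)⟩

theorem const (c : ℕ) : PolyBd μ (fun _ => c) := ⟨Polynomial.C c, fun i => by simp⟩

theorem self : PolyBd μ μ := ⟨Polynomial.X, fun i => by simp⟩

theorem add (hf : PolyBd μ f) (hg : PolyBd μ g) : PolyBd μ (fun i => f i + g i) := by
  obtain ⟨p, hp⟩ := hf
  obtain ⟨q, hq⟩ := hg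
  exact ⟨p + q, fun i => by simpa using Nat.add_le_add (hp i) (hq i)⟩

theorem mul (hf : PolyBd μ f) (hg : PolyBd μ g) : PolyBd μ (fun i => f i * g i) := by
  obtain ⟨p, hp⟩ := hf
  obtain ⟨q, hq⟩ := hg
  exact ⟨p * q, fun i => by simpa using Nat.mul_le_mul (hp i) (hq i)⟩

theorem comp_poly (hf : PolyBd μ f) (q : Polynomial ℕ) : PolyBd μ (fun i => q.eval (f i)) := by
  obtain ⟨p, hp⟩ := hf
  exact ⟨q.comp p, fun i => by simpa using q.eval_mono_nat (hp i)⟩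

theorem sub (hf : PolyBd μ f) : PolyBd μ (fun i => f i - g i) :=
  hf.mono fun _ => Nat.sub_le _ _

/-- Only large values of the security parameter matter. -/
theorem of_eventually {f g : ℕ → ℕ} (hg : PolyBd id g) (h : ∀ᶠ lam in atTop, f lam ≤ g lam) :
    PolyBd id f := by
  obtain ⟨N, hN⟩ := eventually_atTop.mp h
  refine (hg.add (const (∑ i ∈ Finset.range N, f i))).mono fun i => ?_
  by_cases hi : i < N
  · exact (Finset.single_le_sum (f := f) (fun _ _ => Nat.zero_le _)
      (Finset.mem_range.mpr hi)).trans (Nat.le_add_left _ _)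
  · exact (hN i (not_lt.mp hi)).trans (Nat.le_add_right _ _)

/-- A bound in the security parameter is also a bound in any larger size. -/
theorem lift {f : ℕ → ℕ} (hf : PolyBd id f) (φ : ι → ℕ) (h : ∀ i, φ i ≤ μ i) :
    PolyBd μ (fun i => f (φ i)) := by
  obtain ⟨p, hp⟩ := hf
  exact ⟨p, fun i => (hp _).trans (p.eval_mono_nat (h i))⟩

end PolyBd

/-- A polynomial over `ℕ` is eventually below a power of the variable. -/
theorem Polynomial.eventually_eval_le_pow (p : Polynomial ℕ) :
    ∃ a : ℕ, ∀ x : ℕ, 2 ≤ x → p.eval x ≤ x ^ a := by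
  induction p using Polynomial.induction_on' with
  | add p q hp hq =>
    obtain ⟨a, ha⟩ := hp
    obtain ⟨b, hb⟩ := hq
    refine ⟨a + b + 1, fun x hx => ?_⟩
    have h1 : x ^ a ≤ x ^ (a + b) := Nat.pow_le_pow_right (by omega) (by omega)
    have h2 : x ^ b ≤ x ^ (a + b) := Nat.pow_le_pow_right (by omega) (by omega)
    have h3 : x ^ (a + b) * 2 ≤ x ^ (a + b) * x := Nat.mul_le_mul_left _ hx
    have := ha x hx
    have := hb x hx
    rw [Polynomial.eval_add, pow_succ]
    omega
  | monomial n c =>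
    refine ⟨n + c, fun x hx => ?_⟩
    rw [Polynomial.eval_monomial, pow_add, mul_comm]
    refine Nat.mul_le_mul_left _ ?_
    exact (Nat.lt_two_pow_self).le.trans (Nat.pow_le_pow_left hx c)

namespace Negligible

variable {f g : ℕ → ℝ}

theorem mono (hg : Negligible g) (h : ∀ᶠ lam in atTop, |f lam| ≤ g lam) : Negligible f :=
  SuperpolynomialDecay.trans_eventually_abs_le hg
    (h.mono fun _ hx => hx.trans (le_abs_self _))

theorem add (hf : Negligible f) (hg : Negligible g) : Negligible fun lam => f lam + g lam :=
  SuperpolynomialDecay.add hf hg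

theorem zero : Negligible fun _ => 0 := superpolynomialDecay_zero _ _

theorem mul_nat {t : ℕ → ℕ} (hf : Negligible f) (ht : PolyBd id t) :
    Negligible fun lam => (t lam : ℝ) * f lam := by
  obtain ⟨p, hp⟩ := ht
  have h := SuperpolynomialDecay.polynomial_mul hf (p.map (Nat.castRingHom ℝ))
  refine SuperpolynomialDecay.trans_eventually_abs_le h (Eventually.of_forall fun lam => ?_)
  simp only [Function.comp, abs_mul]
  refine mul_le_mul_of_nonneg_right ?_ (abs_nonneg _)
  have h1 : ((p.map (Nat.castRingHom ℝ)).eval (lam : ℝ)) = ((p.eval lam : ℕ) : ℝ) := by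
    simp
  rw [h1, Nat.abs_cast, Nat.abs_cast]
  exact_mod_cast hp lam

theorem const_mul (hf : Negligible f) (c : ℝ) : Negligible fun lam => c * f lam :=
  SuperpolynomialDecay.const_mul hf c

/-- Functions that are eventually below every inverse power are negligible. -/
theorem of_forall_pow (h0 : ∀ lam, 0 ≤ f lam)
    (h : ∀ c : ℕ, ∀ᶠ lam : ℕ in atTop, (lam : ℝ) ^ c * f lam ≤ 1) : Negligible f := by
  intro c
  have hz : Tendsto (fun lam : ℕ => ((lam : ℝ))⁻¹) atTop (𝓝 0) :=
    tendsto_inv_atTop_zero.comp tendsto_natCast_atTop_atTop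
  refine squeeze_zero' (Eventually.of_forall fun lam => ?_) ?_ hz
  · exact mul_nonneg (by positivity) (h0 lam)
  · filter_upwards [h (c + 1), eventually_gt_atTop 0] with lam h1 h2
    have h3 : (0 : ℝ) < lam := by exact_mod_cast h2
    rw [pow_succ] at h1
    rw [← one_div, le_div_iff₀ h3]
    linarith

theorem geometric {r : ℝ} (h0 : 0 ≤ r) (h1 : r < 1) : Negligible fun lam => r ^ lam := by
  intro c
  exact tendsto_pow_const_mul_const_pow_of_lt_one c h0 h1

end Negligible

/-! ### Straight-line computations -/

/-- `Derives op B s T`: starting from the elements of `B`, `s` applications of `op` produce the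
set `T` of all available elements. -/
inductive Derives {M : Type} (op : M → M → M) (B : Set M) : ℕ → Set M → Prop
  | base : Derives op B 0 B
  | gate {s : ℕ} {T : Set M} {a b : M} (h : Derives op B s T) (ha : a ∈ T) (hb : b ∈ T) :
      Derives op B (s + 1) (insert (op a b) T)

namespace Derives

variable {M : Type} {op : M → M → M} {B B' T T' : Set M} {s s' : ℕ}

theorem subset (h : Derives op B s T) : B ⊆ T := by
  induction h with
  | base => exact subset_rfl
  | gate h _ _ ih => exact ih.trans (Set.subset_insert _ _)

theorem trans (h : Derives op B s T) (h' : Derives op T s' T') : Derives op B (s + s') T' := by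
  induction h' with
  | base => exact h
  | gate h' ha hb ih => exact ih.gate ha hb

theorem union_right (h : Derives op B s T) (A : Set M) : Derives op (B ∪ A) s (T ∪ A) := by
  induction h with
  | base => exact .base
  | gate h ha hb ih =>
    rw [Set.insert_union]
    exact ih.gate (Or.inl ha) (Or.inl hb)

theorem image {N : Type} {op' : N → N → N} (φ : M → N) (hφ : ∀ a b, φ (op a b) = op' (φ a) (φ b))
    (h : Derives op B s T) : Derives op' (φ '' B) s (φ '' T) := by
  induction h with
  | base => exact .base
  | gate h ha hb ih =>
    rw [Set.image_insert_eq, hφ]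
    exact ih.gate (Set.mem_image_of_mem _ ha) (Set.mem_image_of_mem _ hb)

/-- A straight-line computation from the range of `x` is a net with input values `x`. -/
theorem exists_net {k : ℕ} (x : Fin k → M) (h : Derives op (Set.range x) s T) :
    ∃ c : Net k (k + s), Set.range (c.eval op x) = T := by
  induction h with
  | base => exact ⟨.inputs, rfl⟩
  | gate h ha hb ih =>
    obtain ⟨c, rfl⟩ := ih
    obtain ⟨i, rfl⟩ := ha
    obtain ⟨j, rfl⟩ := hb
    refine ⟨.gate c i j, ?_⟩
    simp only [Net.eval]
    rw [Fin.range_snoc]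

end Derives

theorem Net.eval_map {k w : ℕ} {M N : Type} {op : M → M → M} {op' : N → N → N} (φ : M → N)
    (hφ : ∀ a b, φ (op a b) = op' (φ a) (φ b)) (x : Fin k → M) (c : Net k w) (j : Fin w) :
    φ (c.eval op x j) = c.eval op' (fun i => φ (x i)) j := by
  induction c with
  | inputs => rfl
  | gate c a b ih =>
    simp only [Net.eval]
    refine Fin.lastCases ?_ (fun j => ?_) j
    · simp [hφ, ih]
    · simp [ih]

theorem Net.derives {k w : ℕ} {M : Type} (op : M → M → M) (x : Fin k → M) (c : Net k w) :
    Derives op (Set.range x) (w - k) (Set.range (c.eval op x)) ∧ k ≤ w := by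
  induction c with
  | inputs => simpa [Net.eval] using Derives.base
  | gate c a b ih =>
    refine ⟨?_, by omega⟩
    rw [Nat.sub_add_comm ih.2]
    simp only [Net.eval]
    rw [Fin.range_snoc]
    exact ih.1.gate ⟨a, rfl⟩ ⟨b, rfl⟩

section Computes

variable {X : Type}

/-- The pointwise NAND of two Boolean functions. -/
def nandFn (f g : X → Bool) : X → Bool := fun x => !(f x && g x)

/-- The constant Boolean functions. -/
def constFns (X : Type) : Set (X → Bool) := {fun _ => false, fun _ => true}

/-- `Computes B s T`: at most `s` NAND gates compute all the Boolean functions in `T` from those in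
`B`; constants are free. -/
def Computes (B : Set (X → Bool)) (s : ℕ) (T : Set (X → Bool)) : Prop :=
  ∃ s' ≤ s, ∃ T', T ⊆ T' ∧ Derives nandFn (B ∪ constFns X) s' T'

variable {B B' T T' T'' : Set (X → Bool)} {s s' : ℕ}

namespace Computes

theorem of_subset_union (h : T ⊆ B ∪ constFns X) : Computes B s T :=
  ⟨0, Nat.zero_le _, _, h, .base⟩

theorem of_subset (h : T ⊆ B) : Computes B s T :=
  of_subset_union (h.trans Set.subset_union_left)

theorem empty : Computes B s ∅ := of_subset (Set.empty_subset _)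

theorem mono_right (h : Computes B s T) (hT : T' ⊆ T) : Computes B s T' := by
  obtain ⟨r, hr, U, hU, h⟩ := h
  exact ⟨r, hr, U, hT.trans hU, h⟩

theorem mono_size (h : Computes B s T) (hs : s ≤ s') : Computes B s' T := by
  obtain ⟨r, hr, U, hU, h⟩ := h
  exact ⟨r, hr.trans hs, U, hU, h⟩

theorem mono_left (h : Computes B s T) (hB : B ⊆ B') : Computes B' s T := by
  obtain ⟨r, hr, U, hU, h⟩ := h
  refine ⟨r, hr, _, hU.trans Set.subset_union_left, (?_ : Derives _ _ _ (U ∪ B'))⟩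
  have := h.union_right B'
  rwa [show B ∪ constFns X ∪ B' = B' ∪ constFns X by
    ext; simp only [Set.mem_union]; have := @hB; tauto] at this

/-- Composition, keeping the intermediate results available. -/
theorem cut_union (h : Computes B s T) (h' : Computes (B ∪ T) s' T') :
    Computes B (s + s') (T ∪ T') := by
  obtain ⟨r, hr, U, hU, h⟩ := h
  have hB := h.subset
  have h'' := h'.mono_left (B' := U)
    (Set.union_subset (Set.subset_union_left.trans hB) hU)
  obtain ⟨r', hr', U', hU', h'⟩ := h''
  rw [Set.union_eq_self_of_subset_right (Set.subset_union_right.trans hB)] at h'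
  exact ⟨r + r', by omega, U', Set.union_subset (hU.trans h'.subset) hU', h.trans h'⟩

theorem cut (h : Computes B s T) (h' : Computes (B ∪ T) s' T') : Computes B (s + s') T' :=
  (h.cut_union h').mono_right Set.subset_union_right

theorem trans (h : Computes B s T) (h' : Computes T s' T') : Computes B (s + s') T' :=
  h.cut (h'.mono_left Set.subset_union_right)

theorem union (h : Computes B s T) (h' : Computes B s' T') : Computes B (s + s') (T ∪ T') :=
  h.cut_union (h'.mono_left Set.subset_union_left)

theorem biUnion_finset {ι : Type*} (I : Finset ι) {t : ι → Set (X → Bool)}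
    (h : ∀ i ∈ I, Computes B s (t i)) : Computes B (I.card * s) (⋃ i ∈ I, t i) := by
  classical
  induction I using Finset.induction_on with
  | empty => simpa using empty
  | insert a I ha ih =>
    rw [Finset.card_insert_of_notMem ha, Finset.set_biUnion_insert]
    refine ((h a (Finset.mem_insert_self _ _)).union
      (ih fun i hi => h i (Finset.mem_insert_of_mem hi))).mono_size (le_of_eq (by ring))

theorem iUnion {ι : Type*} [Fintype ι] {t : ι → Set (X → Bool)} (h : ∀ i, Computes B s (t i)) :
    Computes B (Fintype.card ι * s) (⋃ i, t i) := by
  simpa using biUnion_finset Finset.univ (t := t) fun i _ => h i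

theorem nand {f g : X → Bool} (hf : f ∈ B) (hg : g ∈ B) :
    Computes B 1 {fun x => !(f x && g x)} :=
  ⟨1, le_rfl, _, by rw [Set.singleton_subset_iff]; exact Set.mem_insert _ _,
    Derives.base.gate (Or.inl hf) (Or.inl hg)⟩

variable {f g h : X → Bool} {a b c : ℕ}

theorem nand' (hf : Computes B a {f}) (hg : Computes B b {g}) :
    Computes B (a + b + 1) {fun x => !(f x && g x)} :=
  (hf.union hg).trans (nand (Or.inl rfl) (Or.inr rfl))

theorem of_mem (hf : f ∈ B) : Computes B 0 {f} := of_subset (Set.singleton_subset_iff.mpr hf)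

theorem const (v : Bool) : Computes B 0 {fun _ => v} :=
  of_subset_union (Set.singleton_subset_iff.mpr (Or.inr (by cases v <;> simp [constFns])))

theorem not (hf : Computes B a {f}) : Computes B (a + 1) {fun x => !f x} := by
  have := (hf.trans (nand (B := {f}) (f := f) (g := f) rfl rfl))
  simpa using this

theorem and (hf : Computes B a {f}) (hg : Computes B b {g}) :
    Computes B (a + b + 2) {fun x => f x && g x} := by
  have := (nand' hf hg).not
  simpa [add_assoc] using this

theorem or (hf : Computes B a {f}) (hg : Computes B b {g}) :
    Computes B (a + b + 3) {fun x => f x || g x} := by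
  have := (nand' hf.not hg.not)
  simp only [Bool.not_and, Bool.not_not] at this
  exact this.mono_size (by omega)

theorem xor (hf : Computes B a {f}) (hg : Computes B b {g}) :
    Computes B (a + b + 8) {fun x => Bool.xor (f x) (g x)} := by
  have key : Computes {f, g} 8 {fun x => Bool.xor (f x) (g x)} := by
    have hf : Computes {f, g} 0 {f} := of_mem (by simp)
    have hg : Computes {f, g} 0 {g} := of_mem (by simp)
    have := (hf.or hg).and (nand' hf hg)
    refine (this.mono_size (by omega)).mono_right ?_
    rw [Set.singleton_subset_iff, Set.mem_singleton_iff]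
    funext x
    cases f x <;> cases g x <;> rfl
  have := (hf.union hg).trans (s' := 8) (T' := {fun x => Bool.xor (f x) (g x)})
    (by rwa [Set.singleton_union])
  exact this

theorem ite (hf : Computes B a {f}) (hg : Computes B b {g}) (hh : Computes B c {h}) :
    Computes B (a + b + c + 8) {fun x => if f x then g x else h x} := by
  have key : Computes {f, g, h} 8 {fun x => if f x then g x else h x} := by
    have hf : Computes {f, g, h} 0 {f} := of_mem (by simp)
    have hg : Computes {f, g, h} 0 {g} := of_mem (by simp)
    have hh : Computes {f, g, h} 0 {h} := of_mem (by simp)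
    have := (hf.and hg).or (hf.not.and hh)
    refine (this.mono_size (by omega)).mono_right ?_
    rw [Set.singleton_subset_iff, Set.mem_singleton_iff]
    funext x
    cases f x <;> cases g x <;> rfl
  have := (hf.union (hg.union hh)).trans (s' := 8)
    (T' := {fun x => if f x then g x else h x})
    (by rwa [Set.singleton_union, Set.singleton_union])
  exact this.mono_size (by omega)

/-- The majority of three bits. -/
theorem atLeastTwo (hf : Computes B a {f}) (hg : Computes B b {g}) (hh : Computes B c {h}) :
    Computes B (a + b + c + 16) {fun x => Bool.atLeastTwo (f x) (g x) (h x)} := by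
  have key : Computes {f, g, h} 16 {fun x => Bool.atLeastTwo (f x) (g x) (h x)} := by
    have hf : Computes {f, g, h} 0 {f} := of_mem (by simp)
    have hg : Computes {f, g, h} 0 {g} := of_mem (by simp)
    have hh : Computes {f, g, h} 0 {h} := of_mem (by simp)
    have := (hf.and hg).or ((hf.and hh).or (hg.and hh))
    refine (this.mono_size (by omega)).mono_right ?_
    rw [Set.singleton_subset_iff, Set.mem_singleton_iff]
    funext x
    cases f x <;> cases g x <;> cases h x <;> rfl
  have := (hf.union (hg.union hh)).trans (s' := 16)
    (T' := {fun x => Bool.atLeastTwo (f x) (g x) (h x)})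
    (by rwa [Set.singleton_union, Set.singleton_union])
  exact this.mono_size (by omega)

/-- The disjunction of a finite family. -/
theorem any {ι : Type*} (I : Finset ι) {F : ι → X → Bool} {a : ℕ}
    (h : ∀ i ∈ I, Computes B a {F i}) :
    Computes B (I.card * (a + 3)) {fun x => decide (∃ i ∈ I, F i x = true)} := by
  classical
  induction I using Finset.induction_on with
  | empty => simpa using const false
  | insert i I hi ih =>
    have h1 := (h i (Finset.mem_insert_self _ _)).or
      (ih fun j hj => h j (Finset.mem_insert_of_mem hj))
    rw [Finset.card_insert_of_notMem hi]
    refine (h1.mono_size (le_of_eq (by ring))).mono_right ?_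
    rw [Set.singleton_subset_iff, Set.mem_singleton_iff]
    funext x
    simp

/-- The conjunction of a finite family. -/
theorem all {ι : Type*} (I : Finset ι) {F : ι → X → Bool} {a : ℕ}
    (h : ∀ i ∈ I, Computes B a {F i}) :
    Computes B (I.card * (a + 4) + 1) {fun x => decide (∀ i ∈ I, F i x = true)} := by
  have h1 := (any I fun i hi => (h i hi).not).not
  refine (h1.mono_size (le_of_eq (by ring))).mono_right ?_
  rw [Set.singleton_subset_iff, Set.mem_singleton_iff]
  funext x
  rw [← decide_not]
  simp

theorem image {Y : Type} (h : Computes B s T) (φ : Y → X) :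
    Computes ((· ∘ φ) '' B) s ((· ∘ φ) '' T) := by
  obtain ⟨r, hr, U, hU, h⟩ := h
  refine ⟨r, hr, _, Set.image_mono hU, ?_⟩
  have hc : (· ∘ φ) '' (B ∪ constFns X) = (· ∘ φ) '' B ∪ constFns Y := by
    rw [Set.image_union]
    congr 1
    simp only [constFns, Set.image_insert_eq, Set.image_singleton]
    rfl
  rw [← hc]
  exact h.image _ fun _ _ => rfl

end Computes

/-! ### Wires of encoded data -/

/-- The first `n` bits of a string-valued function. -/
def lbits (n : ℕ) (s : X → List Bool) : Set (X → Bool) :=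
  {g | ∃ i < n, g = fun x => (s x).getD i false}

/-- The bits of the encoding of an `α`-valued function. -/
def wires {α : Type} [BitCode α] (F : X → α) : Set (X → Bool) :=
  lbits (BitCode.len α) fun x => encode (F x)

theorem lbits_append (n k : ℕ) (s t : X → List Bool) (h : ∀ x, (s x).length = n) :
    lbits (n + k) (fun x => s x ++ t x) = lbits n s ∪ lbits k t := by
  ext g
  constructor
  · rintro ⟨i, hi, rfl⟩
    by_cases h' : i < n
    · exact Or.inl ⟨i, h', funext fun x => List.getD_append _ _ _ _ (by rw [h x]; exact h')⟩
    · refine Or.inr ⟨i - n, by omega, funext fun x => ?_⟩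
      rw [List.getD_append_right _ _ _ _ (by rw [h x]; omega), h x]
  · rintro (⟨i, hi, rfl⟩ | ⟨i, hi, rfl⟩)
    · exact ⟨i, by omega, funext fun x =>
        (List.getD_append _ _ _ _ (by rw [h x]; exact hi)).symm⟩
    · refine ⟨n + i, by omega, funext fun x => ?_⟩
      rw [List.getD_append_right _ _ _ _ (by rw [h x]; omega), h x]
      simp

theorem wires_prod {α β : Type} [BitCode α] [BitCode β] (F : X → α × β) :
    wires F = wires (fun x => (F x).1) ∪ wires (fun x => (F x).2) :=
  lbits_append _ _ _ _ fun _ => BitCode.length_encode _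

theorem wires_pi {α : Type} [BitCode α] {k : ℕ} (F : X → Fin k → α) :
    wires F = ⋃ i, wires fun x => F x i := by
  induction k with
  | zero =>
    simp only [Set.iUnion_of_empty]
    ext g
    simp [wires, lbits, BitCode.len]
  | succ k ih =>
    have h1 : wires F = lbits (BitCode.len α + k * BitCode.len α) fun x =>
        encode (F x 0) ++ encode fun i : Fin k => F x i.succ := by
      unfold wires
      congr 1
      · simp only [BitCode.len]; ring
      · funext x
        simp [encode, List.ofFn_succ]
    rw [h1, lbits_append _ _ _ _ fun _ => BitCode.length_encode _]
    have h2 := ih fun x i => F x i.succ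
    unfold wires at h2 ⊢
    rw [show BitCode.len (Fin k → α) = k * BitCode.len α from rfl] at h2
    rw [h2]
    ext g
    simp only [Set.mem_union, Set.mem_iUnion, Fin.exists_fin_succ]

theorem wires_pi_prod {α : Type} [BitCode α] {k l : ℕ} (F : X → Fin k × Fin l → α) :
    wires F = ⋃ i, ⋃ j, wires fun x => F x (i, j) := by
  have h : wires F = wires fun x (i : Fin k) (j : Fin l) => F x (i, j) := rfl
  rw [h, wires_pi]
  exact Set.iUnion_congr fun i => wires_pi _

theorem wires_bool (F : X → Bool) : wires F = {F} := by
  ext g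
  simp [wires, lbits, BitCode.len, encode]

theorem wires_Zq {ℓ : ℕ} (F : X → Zq ℓ) :
    wires F = {g | ∃ b < ℓ, g = fun x => (F x).val.testBit b} := by
  ext g
  refine exists_congr fun i => and_congr_right fun hi => ?_
  have hi' : i < ℓ := hi
  refine Eq.congr_right (funext fun x => ?_)
  simp [encode, List.getD, hi']

theorem Computes.wires_const {α : Type} [BitCode α] (a : α) :
    Computes B s (wires fun _ => a) := by
  refine of_subset_union ?_
  rintro _ ⟨i, hi, rfl⟩
  refine Or.inr ?_
  simp only [constFns, Set.mem_insert_iff, Set.mem_singleton_iff]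
  cases (encode a).getD i false <;> simp

/-! ### From computations to circuits -/

/-- A computation from the bits of a string to the bits of another one is a circuit. One more input
wire, beyond the end of the string, supplies the constant `false`. -/
theorem Computes.exists_circuit {n o : ℕ} {str out : X → List Bool}
    (hn : ∀ x, (str x).length = n) (ho : ∀ x, (out x).length = o)
    (h : Computes (lbits n str) s (lbits o out)) :
    ∃ C : Circuit (n + 1) o, C.size ≤ n + s + 2 + o ∧ ∀ x, C.run (str x) = out x := by
  obtain ⟨r, hr, U, hU, h⟩ := h
  let inp : Fin (n + 1) → X → Bool := fun i x => (str x).getD i false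
  have hb : Derives nandFn (Set.range inp) 1 (lbits n str ∪ constFns X) := by
    have hf : (fun _ : X => false) ∈ Set.range inp :=
      ⟨Fin.last n, funext fun x => by simp [inp, List.getD, hn x]⟩
    have h1 := (Derives.base (op := nandFn) (B := Set.range inp)).gate hf hf
    refine cast ?_ h1
    congr 1
    ext g
    simp only [Set.mem_insert_iff, Set.mem_range, Set.mem_union, constFns,
      Set.mem_singleton_iff]
    constructor
    · rintro (rfl | ⟨i, rfl⟩)
      · exact Or.inr (Or.inr rfl)
      · by_cases hi : (i : ℕ) < n
        · exact Or.inl ⟨i, hi, rfl⟩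
        · refine Or.inr (Or.inl (funext fun x => ?_))
          exact List.getD_eq_default _ _ (by rw [hn x]; omega)
    · rintro (⟨i, hi, rfl⟩ | rfl | rfl)
      · exact Or.inr ⟨⟨i, by omega⟩, rfl⟩
      · exact Or.inr hf
      · exact Or.inl rfl
  obtain ⟨c, hc⟩ := (hb.trans h).exists_net
  have hw : ∀ j : Fin o, ∃ i, c.eval nandFn inp i = fun x => (out x).getD j false := by
    intro j
    have : (fun x => (out x).getD j false) ∈ Set.range (c.eval nandFn inp) := by
      rw [hc]
      exact hU ⟨j, j.2, rfl⟩
    exact this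
  choose w hw using hw
  refine ⟨⟨_, c, w⟩, by simp only [Circuit.size]; omega, fun x => ?_⟩
  apply List.ext_getElem
  · simp [Circuit.run, ho x]
  · intro j h1 h2
    have hj : j < o := by rw [← ho x]; exact h2
    have h3 := Net.eval_map (op := nandFn) (op' := fun a b => !(a && b))
      (fun f : X → Bool => f x) (fun _ _ => rfl) inp c (w ⟨j, hj⟩)
    have h4 : (Circuit.run ⟨_, c, w⟩ (str x))[j] =
        c.eval (fun a b => !(a && b)) (fun i => inp i x) (w ⟨j, hj⟩) := by
      simp [Circuit.run, Circuit.evalBool, Circuit.eval, inp]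
    rw [h4, ← h3, hw]
    simp [List.getD, h2]

end Computes

/-! ### Quantum circuits: acceptance probabilities and classical preprocessing -/

section Quantum

variable {w v : ℕ}

/-- The total weight of a state. -/
noncomputable def QState.weight (ψ : QState w) : ℝ := ∑ y, ‖ψ y‖ ^ 2

theorem Function.update_not_involutive (i : Fin w) :
    Function.Involutive fun x : Fin w → Bool => Function.update x i (!x i) := by
  intro x
  simp

theorem sum_comp_involutive {α : Type*} [Fintype α] {φ : α → α} (h : Function.Involutive φ)
    (f : α → ℝ) : ∑ x, f (φ x) = ∑ x, f x :=
  Equiv.sum_comp h.toPerm f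

theorem QGate.weight_apply (g : QGate w) (ψ : QState w) : (g.apply ψ).weight = ψ.weight := by
  cases g with
  | X i =>
    exact sum_comp_involutive (Function.update_not_involutive i) fun y => ‖ψ y‖ ^ 2
  | S i =>
    refine Finset.sum_congr rfl fun y _ => ?_
    simp only [QGate.apply]
    split_ifs <;> simp
  | CNOT i j hij =>
    refine sum_comp_involutive (φ := fun x => Function.update x j (xor (x j) (x i)))
      (fun x => ?_) fun y => ‖ψ y‖ ^ 2
    simp [Function.update_of_ne hij]
  | Toffoli i j k hij hik hjk =>
    refine sum_comp_involutive (φ := fun x => Function.update x k (xor (x k) (x i && x j)))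
      (fun x => ?_) fun y => ‖ψ y‖ ^ 2
    simp [Function.update_of_ne hik, Function.update_of_ne hjk]
  | H i =>
    -- Pair each basis state with its flip at qubit `i` and apply the parallelogram law.
    have hN := sum_comp_involutive (Function.update_not_involutive i)
    have h1 : ∀ φ : QState w, 2 * φ.weight =
        ∑ y, (‖φ y‖ ^ 2 + ‖φ (Function.update y i (!y i))‖ ^ 2) := by
      intro φ
      rw [Finset.sum_add_distrib, hN fun y => ‖φ y‖ ^ 2, QState.weight]
      ring
    have h2 : 2 * ((QGate.H i).apply ψ).weight = 2 * ψ.weight := by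
      rw [h1, h1]
      refine Finset.sum_congr rfl fun y _ => ?_
      have hs : ‖((1 / √2 : ℝ) : ℂ)‖ ^ 2 = 1 / 2 := by
        rw [Complex.norm_real, Real.norm_eq_abs, sq_abs, div_pow, one_pow,
          Real.sq_sqrt (by norm_num)]
      have hp : ∀ a b : ℂ, ‖a + b‖ ^ 2 + ‖a - b‖ ^ 2 = 2 * (‖a‖ ^ 2 + ‖b‖ ^ 2) := by
        intro a b
        have := parallelogram_law_with_norm ℝ a b
        nlinarith [this]
      have hy : Function.update y i (y i) = y := Function.update_eq_self _ _
      cases hb : y i <;> rw [hb] at hy <;>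
        simp only [QGate.apply, Function.update_idem, Function.update_self, hb, Bool.not_true,
          Bool.not_false, hy, norm_mul, mul_pow, hs, ite_true, one_mul, neg_mul,
          ← sub_eq_add_neg, Bool.false_eq_true, ite_false]
      · linarith [hp (ψ y) (ψ (Function.update y i true))]
      · linarith [hp (ψ (Function.update y i false)) (ψ y)]
    linarith

/-- The basis state of a bit assignment. -/
noncomputable def basisState (b : Fin w → Bool) : QState w := fun y => if y = b then 1 else 0

theorem weight_basisState (b : Fin w → Bool) : (basisState b).weight = 1 := by
  unfold QState.weight basisState
  rw [Finset.sum_eq_single b]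
  · simp
  · intro y _ hy
    simp [hy]
  · simp

/-- Apply a list of gates. -/
noncomputable def applyGates (gs : List (QGate w)) (ψ : QState w) : QState w :=
  gs.foldl (fun ψ g => g.apply ψ) ψ

theorem weight_applyGates (gs : List (QGate w)) (ψ : QState w) :
    (applyGates gs ψ).weight = ψ.weight := by
  induction gs generalizing ψ with
  | nil => rfl
  | cons g gs ih => exact (ih _).trans (g.weight_apply ψ)

theorem applyGates_append (gs hs : List (QGate w)) (ψ : QState w) :
    applyGates (gs ++ hs) ψ = applyGates hs (applyGates gs ψ) :=
  List.foldl_append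

theorem QCircuit.acceptProb_nonneg (Q : QCircuit) (x : List Bool) : 0 ≤ Q.acceptProb x :=
  Finset.sum_nonneg fun y _ => by split_ifs <;> positivity

theorem QCircuit.acceptProb_le_one (Q : QCircuit) (x : List Bool) : Q.acceptProb x ≤ 1 := by
  have h : (Q.finalState x).weight = 1 :=
    (weight_applyGates Q.gates _).trans (weight_basisState _)
  rw [← h]
  refine Finset.sum_le_sum fun y _ => ?_
  split_ifs
  · exact le_rfl
  · positivity

/-- The product of a basis state of the first `w` qubits and a state of the last `v` qubits. -/
noncomputable def tensorBasis (a : Fin w → Bool) (ψ : QState v) : QState (w + v) :=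
  fun y => if (fun i => y (Fin.castAdd v i)) = a then ψ fun i => y (Fin.natAdd w i) else 0

/-- A gate acting on the last `v` of `w + v` qubits. -/
def QGate.lift (w : ℕ) : QGate v → QGate (w + v)
  | .X i => .X (Fin.natAdd w i)
  | .H i => .H (Fin.natAdd w i)
  | .S i => .S (Fin.natAdd w i)
  | .CNOT i j h => .CNOT (Fin.natAdd w i) (Fin.natAdd w j) (by simpa using h)
  | .Toffoli i j k h1 h2 h3 => .Toffoli (Fin.natAdd w i) (Fin.natAdd w j) (Fin.natAdd w k)
      (by simpa using h1) (by simpa using h2) (by simpa using h3)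

theorem update_natAdd_left (y : Fin (w + v) → Bool) (j : Fin v) (b : Bool) :
    (fun i => Function.update y (Fin.natAdd w j) b (Fin.castAdd v i)) =
      fun i => y (Fin.castAdd v i) := by
  funext i
  rw [Function.update_of_ne]
  intro h
  have := congrArg Fin.val h
  simp at this
  omega

theorem update_natAdd_right (y : Fin (w + v) → Bool) (j : Fin v) (b : Bool) :
    (fun i => Function.update y (Fin.natAdd w j) b (Fin.natAdd w i)) =
      Function.update (fun i => y (Fin.natAdd w i)) j b := by
  funext i
  by_cases h : i = j
  · subst h; simp
  · rw [Function.update_of_ne h, Function.update_of_ne]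
    simpa using h

theorem QGate.lift_apply (g : QGate v) (a : Fin w → Bool) (ψ : QState v) :
    (g.lift w).apply (tensorBasis a ψ) = tensorBasis a (g.apply ψ) := by
  funext y
  cases g <;>
    simp only [QGate.lift, QGate.apply, tensorBasis, update_natAdd_left, update_natAdd_right] <;>
    split_ifs <;> simp

theorem applyGates_lift (gs : List (QGate v)) (a : Fin w → Bool) (ψ : QState v) :
    applyGates (gs.map (QGate.lift w)) (tensorBasis a ψ) = tensorBasis a (applyGates gs ψ) := by
  induction gs generalizing ψ with
  | nil => rfl
  | cons g gs ih =>
    simp only [applyGates, List.map_cons, List.foldl_cons] at ih ⊢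
    rw [QGate.lift_apply, ih]

theorem X_basisState (b : Fin w → Bool) (i : Fin w) :
    (QGate.X i).apply (basisState b) = basisState (Function.update b i (!b i)) := by
  funext y
  simp only [QGate.apply, basisState]
  congr 1
  have := (Function.update_not_involutive i).eq_iff (x := y) (y := b)
  exact propext this

theorem CNOT_basisState (b : Fin w → Bool) (i j : Fin w) (hij : i ≠ j) :
    (QGate.CNOT i j hij).apply (basisState b) =
      basisState (Function.update b j (xor (b j) (b i))) := by
  funext y
  simp only [QGate.apply, basisState]
  congr 1
  have h : Function.Involutive fun x : Fin w → Bool => Function.update x j (xor (x j) (x i)) := by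
    intro x
    simp [Function.update_of_ne hij]
  exact propext (h.eq_iff (x := y) (y := b))

theorem Toffoli_basisState (b : Fin w → Bool) (i j k : Fin w) (hij : i ≠ j) (hik : i ≠ k)
    (hjk : j ≠ k) :
    (QGate.Toffoli i j k hij hik hjk).apply (basisState b) =
      basisState (Function.update b k (xor (b k) (b i && b j))) := by
  funext y
  simp only [QGate.apply, basisState]
  congr 1
  have h : Function.Involutive fun x : Fin w → Bool =>
      Function.update x k (xor (x k) (x i && x j)) := by
    intro x
    simp [Function.update_of_ne hik, Function.update_of_ne hjk]
  exact propext (h.eq_iff (x := y) (y := b))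

/-- Reversible evaluation of a net: wire `t` is computed on qubit `t`, which is `0` before. -/
theorem exists_gates_net {k w W : ℕ} (c : Net k w) (hw : w ≤ W) :
    ∃ gs : List (QGate W), gs.length ≤ 2 * w ∧ ∀ b : Fin W → Bool,
      (∀ i : Fin W, k ≤ (i : ℕ) → (i : ℕ) < w → b i = false) → ∃ b' : Fin W → Bool,
        applyGates gs (basisState b) = basisState b' ∧
        (∀ i : Fin w, b' (Fin.castLE hw i) = c.eval (fun x y => !(x && y))
          (fun i => b ⟨i, lt_of_lt_of_le i.2 ((c.derives (fun x _ => x) fun _ => ()).2.trans hw)⟩)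
          i) ∧
        ∀ i : Fin W, w ≤ (i : ℕ) → b' i = b i := by
  induction c with
  | inputs => exact ⟨[], by simp, fun b _ => ⟨b, rfl, fun i => rfl, fun i _ => rfl⟩⟩
  | @gate w c x y ih =>
    obtain ⟨gs, hgs, h⟩ := ih (by omega)
    have hxW : (x : ℕ) < W := by omega
    have hyW : (y : ℕ) < W := by omega
    have hwW : w < W := by omega
    let X : Fin W := ⟨x, hxW⟩
    let Y : Fin W := ⟨y, hyW⟩
    let Z : Fin W := ⟨w, hwW⟩
    have hXZ : X ≠ Z := fun e => by have := congrArg Fin.val e; simp [X, Z] at this; omega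
    have hYZ : Y ≠ Z := fun e => by have := congrArg Fin.val e; simp [Y, Z] at this; omega
    let g : QGate W := if e : X = Y then .CNOT X Z hXZ else .Toffoli X Y Z e hXZ hYZ
    have hg : ∀ b : Fin W → Bool, b Z = false →
        g.apply (basisState b) = basisState (Function.update b Z (b X && b Y)) := by
      intro b hb
      by_cases e : X = Y
      · simp only [g, e, dite_true, CNOT_basisState, hb]
        simp
      · simp only [g, e, dite_false, Toffoli_basisState, hb]
        simp
    refine ⟨gs ++ [g, .X Z], by simp; omega, fun b hb => ?_⟩
    obtain ⟨b', h1, h2, h3⟩ := h b fun i h1 h2 => hb i h1 (by omega)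
    have hkw := (c.derives (fun x _ => x) fun _ => ()).2
    have hz : b' Z = false := by rw [h3 Z le_rfl]; exact hb Z hkw (by simp [Z])
    refine ⟨Function.update b' Z (!(b' X && b' Y)), ?_, fun i => ?_, fun i hi => ?_⟩
    · rw [applyGates_append, h1]
      simp only [applyGates, List.foldl_cons, List.foldl_nil]
      rw [hg b' hz, X_basisState]
      simp
    · simp only [Net.eval]
      refine Fin.lastCases ?_ (fun i => ?_) i
      · have : Fin.castLE hw (Fin.last w) = Z := rfl
        rw [this, Function.update_self, Fin.snoc_last]
        rw [← h2 x, ← h2 y]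
        rfl
      · rw [Fin.snoc_castSucc, Function.update_of_ne]
        · exact h2 i
        · intro e
          have := congrArg Fin.val e
          simp [Z] at this
          omega
    · rw [Function.update_of_ne]
      · exact h3 i (by omega)
      · intro e
        have := congrArg Fin.val e
        simp [Z] at this
        omega

/-- Copy bits of the first `w` qubits to the first bits of the last `v` qubits, which are `0`. -/
theorem exists_gates_copy (w v : ℕ) (src : ℕ → Option (Fin w)) (t : ℕ) :
    ∃ gs : List (QGate (w + v)), gs.length ≤ t ∧ ∀ a : Fin w → Bool,
      applyGates gs (basisState (Fin.append a fun _ => false)) =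
        basisState (Fin.append a fun i : Fin v =>
          if (i : ℕ) < t then ((src i).map a).getD false else false) := by
  induction t with
  | zero => exact ⟨[], by simp, fun a => by simp [applyGates]⟩
  | succ t ih =>
    obtain ⟨gs, hgs, h⟩ := ih
    by_cases hd : t < v ∧ ∃ s, src t = some s
    · obtain ⟨ht, s, hs⟩ := hd
      have hne : Fin.castAdd v s ≠ Fin.natAdd w ⟨t, ht⟩ := fun e => by
        have := congrArg Fin.val e; simp at this; omega
      refine ⟨gs ++ [.CNOT _ _ hne], by simpa using hgs, fun a => ?_⟩
      rw [applyGates_append, h]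
      simp only [applyGates, List.foldl_cons, List.foldl_nil]
      rw [CNOT_basisState]
      congr 1
      funext i
      refine Fin.addCases (fun i => ?_) (fun i => ?_) i
      · rw [Function.update_of_ne]
        · simp
        · intro e; have := congrArg Fin.val e; simp at this; omega
      · by_cases hi : i = ⟨t, ht⟩
        · subst hi
          simp only [Function.update_self, Fin.append_right, Fin.append_left, hs]
          simp
        · rw [Function.update_of_ne fun e => hi (Fin.ext (by
            have := congrArg Fin.val e; simp at this; exact this))]
          have : (i : ℕ) ≠ t := fun e => hi (Fin.ext e)
          simp only [Fin.append_right]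
          congr 1
          exact propext (by omega)
    · refine ⟨gs, by omega, fun a => ?_⟩
      rw [h]
      congr 2
      funext i
      by_cases hi : (i : ℕ) = t
      · have hs : src t = none := by
          rcases e : src t with _ | s
          · rfl
          · exact absurd ⟨by omega, s, e⟩ hd
        simp [hi, hs]
      · congr 1
        exact propext (by omega)

/-- A quantum circuit can be preceded by a classical circuit. -/
theorem QCircuit.exists_precompose {k o : ℕ} (Q : QCircuit) (C : Circuit k o) :
    ∃ Q' : QCircuit, Q'.size ≤ 3 * C.size + 2 * Q.size ∧
      ∀ x : List Bool, x.length ≤ k → Q'.acceptProb x = Q.acceptProb (C.run x) := by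
  obtain ⟨gs, hgs, hg⟩ := exists_gates_net C.net (Nat.le_add_right C.width Q.width)
  obtain ⟨gs', hgs', hg'⟩ := exists_gates_copy C.width Q.width
    (fun i => if h : i < o then some (C.out ⟨i, h⟩) else none) Q.width
  have hkw := (C.net.derives (fun x _ => x) fun _ => ()).2
  refine ⟨⟨C.width + Q.width, gs ++ gs' ++ Q.gates.map (QGate.lift C.width),
    Fin.natAdd _ Q.out⟩, ?_, fun x hx => ?_⟩
  · simp only [QCircuit.size, Circuit.size, List.length_append, List.length_map]
    omega
  obtain ⟨b', h1, h2, h3⟩ := hg (fun i => x.getD i false) fun i hi _ =>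
    List.getD_eq_default _ _ (by omega)
  let a : Fin C.width → Bool := C.net.eval (fun a b => !(a && b)) fun i => x.getD i false
  have hb : b' = Fin.append a fun _ => false := by
    funext i
    refine Fin.addCases (fun i => ?_) (fun i => ?_) i
    · rw [Fin.append_left]
      exact h2 i
    · rw [Fin.append_right, h3 _ (by simp)]
      exact List.getD_eq_default _ _ (by simp; omega)
  have hfin : (QCircuit.mk (C.width + Q.width) (gs ++ gs' ++ Q.gates.map (QGate.lift C.width))
      (Fin.natAdd _ Q.out)).finalState x = tensorBasis a (Q.finalState (C.run x)) := by
    change applyGates _ (basisState _) = _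
    rw [applyGates_append, applyGates_append, h1, hb, hg']
    have : basisState (Fin.append a fun i : Fin Q.width => if (i : ℕ) < Q.width then
        ((if h : (i : ℕ) < o then some (C.out ⟨i, h⟩) else none).map a).getD false else false) =
        tensorBasis a (basisState fun i : Fin Q.width => (C.run x).getD i false) := by
      funext y
      simp only [basisState, tensorBasis]
      have hr : ∀ i : Fin Q.width, (if (i : ℕ) < Q.width then
          ((if h : (i : ℕ) < o then some (C.out ⟨i, h⟩) else none).map a).getD false
            else false) = (C.run x).getD i false := by
        intro i
        simp only [i.2, if_true]
        by_cases ho : (i : ℕ) < o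
        · simp [ho, Circuit.run, List.getD, Circuit.evalBool, Circuit.eval, a]
        · simp [ho, Circuit.run, List.getD]
      simp only [hr]
      rw [← ite_and]
      congr 1
      apply propext
      constructor
      · rintro rfl
        exact ⟨by funext i; simp, by funext i; simp⟩
      · rintro ⟨e1, e2⟩
        funext i
        refine Fin.addCases (fun i => ?_) (fun i => ?_) i
        · rw [Fin.append_left, ← e1]
        · rw [Fin.append_right]; exact congrFun e2 i
    rw [this, applyGates_lift]
    rfl
  unfold QCircuit.acceptProb
  rw [hfin]
  simp only [tensorBasis]
  rw [← (Fin.appendEquiv C.width Q.width).sum_comp, Fintype.sum_prod_type]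
  rw [Finset.sum_eq_single a]
  · refine Finset.sum_congr rfl fun z _ => ?_
    simp [Fin.appendEquiv]
  · intro z _ hz
    refine Finset.sum_eq_zero fun y _ => ?_
    simp [Fin.appendEquiv, hz]
  · simp

end Quantum

/-! ### Product distributions, expectations and total variation distance -/

theorem PMF.monad_bind {α β : Type} (p : PMF α) (f : α → PMF β) : p >>= f = p.bind f := rfl

theorem PMF.monad_pure {α : Type} (a : α) : (Pure.pure a : PMF α) = PMF.pure a := rfl

section PiPMF

variable {ι κ α β : Type} [Fintype ι] [DecidableEq ι] [Fintype κ] [DecidableEq κ] [Fintype α]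
  [Fintype β]

theorem piPMF_apply (p : ι → PMF α) (x : ι → α) : piPMF p x = ∏ i, p i (x i) := rfl

theorem piPMF_bind (p : ι → PMF α) (q : ι → α → PMF β) :
    (piPMF fun i => (p i).bind (q i)) = (piPMF p).bind fun a => piPMF fun i => q i (a i) := by
  classical
  ext x
  simp only [PMF.bind_apply, piPMF_apply, tsum_fintype]
  rw [Finset.prod_univ_sum, Fintype.piFinset_univ]
  exact Finset.sum_congr rfl fun a _ => Finset.prod_mul_distrib

theorem piPMF_pure (a : ι → α) : (piPMF fun i => PMF.pure (a i)) = PMF.pure a := by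
  classical
  ext x
  simp only [piPMF_apply, PMF.pure_apply]
  rw [Finset.prod_ite_zero]
  simp [funext_iff]

theorem piPMF_map (p : ι → PMF α) (g : ι → α → β) :
    (piPMF fun i => (p i).map (g i)) = (piPMF p).map fun a i => g i (a i) := by
  simp only [PMF.map, Function.comp_def]
  rw [piPMF_bind]
  simp only [piPMF_pure]

theorem piPMF_ite_pure (t : ι) (p : PMF α) (f : ι → α) :
    (piPMF fun i => if i = t then p else PMF.pure (f i)) = p.map (Function.update f t) := by
  classical
  ext x
  rw [piPMF_apply, PMF.map_apply, tsum_fintype, ← Finset.mul_prod_erase _ _ (Finset.mem_univ t)]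
  rw [Finset.sum_eq_single (x t)]
  · have h : ∀ i ∈ Finset.univ.erase t, (if i = t then p else PMF.pure (f i)) (x i) =
        if x i = f i then (1 : ENNReal) else 0 := by
      intro i hi
      rw [if_neg (Finset.ne_of_mem_erase hi), PMF.pure_apply]
    rw [Finset.prod_congr rfl h, Finset.prod_ite_zero]
    simp only [if_true, Finset.prod_const_one, Finset.mem_erase, Finset.mem_univ, and_true,
      mul_ite, mul_one, mul_zero]
    congr 1
    apply propext
    constructor
    · intro h
      funext i
      by_cases hi : i = t
      · subst hi; simp
      · rw [Function.update_of_ne hi]; exact h i hi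
    · intro h i hi
      have := congrFun h i
      rwa [Function.update_of_ne hi] at this
  · intro a _ ha
    rw [if_neg]
    rintro rfl
    simp at ha
  · simp

/-- A coordinate of a product distribution can be sampled separately; the distribution which the
remaining product uses for that coordinate is irrelevant. -/
theorem piPMF_split (t : ι) (p r : ι → PMF α) (h : ∀ i, i ≠ t → r i = p i) :
    piPMF p = (piPMF r).bind fun f => (p t).map (Function.update f t) := by
  have h1 : p = fun i => (r i).bind fun b => if i = t then p t else PMF.pure b := by
    funext i
    by_cases hi : i = t
    · subst hi; simp [PMF.bind_const]
    · simp [hi, h i hi, PMF.bind_pure]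
  conv_lhs => rw [h1]
  rw [piPMF_bind]
  simp only [piPMF_ite_pure]

theorem piPMF_reindex (e : ι ≃ κ) (p : κ → PMF α) :
    piPMF p = (piPMF fun i => p (e i)).map fun f k => f (e.symm k) := by
  classical
  ext x
  rw [piPMF_apply, PMF.map_apply, tsum_fintype, Finset.sum_eq_single fun i => x (e i)]
  · simp only [Equiv.apply_symm_apply, if_true, piPMF_apply]
    exact (Equiv.prod_comp e (fun k => p k (x k) : κ → ENNReal)).symm
  · intro f _ hf
    rw [if_neg]
    rintro rfl
    simp at hf
  · simp

theorem piPMF_curry (p : ι → κ → PMF α) :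
    (piPMF fun i => piPMF (p i)) =
      (piPMF fun x : ι × κ => p x.1 x.2).map fun f i j => f (i, j) := by
  classical
  ext x
  rw [piPMF_apply, PMF.map_apply, tsum_fintype, Finset.sum_eq_single fun y => x y.1 y.2]
  · simp only [if_true, piPMF_apply]
    exact (Fintype.prod_prod_type (fun y : ι × κ => (p y.1 y.2 (x y.1 y.2) : ENNReal))).symm
  · intro f _ hf
    rw [if_neg]
    rintro rfl
    simp at hf
  · simp

theorem piPMF_swap (p : ι → κ → PMF α) :
    (piPMF fun i => piPMF (p i)) =
      (piPMF fun j => piPMF fun i => p i j).map fun f i j => f j i := by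
  rw [piPMF_curry, piPMF_curry, piPMF_reindex (Equiv.prodComm κ ι), PMF.map_comp, PMF.map_comp]
  rfl

theorem uniform_pi [Nonempty α] :
    PMF.uniformOfFintype (ι → α) = piPMF fun _ => PMF.uniformOfFintype α := by
  ext x
  simp only [piPMF_apply, PMF.uniformOfFintype_apply, Finset.prod_const, Finset.card_univ,
    Fintype.card_fun, Nat.cast_pow, ENNReal.inv_pow]

theorem uniform_prod [Nonempty α] [Nonempty β] :
    PMF.uniformOfFintype (α × β) =
      (PMF.uniformOfFintype α).bind fun a => (PMF.uniformOfFintype β).map fun b => (a, b) := by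
  classical
  ext ⟨a, b⟩
  simp only [PMF.bind_apply, PMF.map_apply, tsum_fintype, PMF.uniformOfFintype_apply,
    Prod.mk.injEq, Fintype.card_prod, Nat.cast_mul]
  rw [Finset.sum_eq_single a, Finset.sum_eq_single b]
  · simp only [and_self, if_true]
    exact ENNReal.mul_inv (Or.inr (ENNReal.natCast_ne_top _)) (Or.inl (ENNReal.natCast_ne_top _))
  · intro c _ hc; rw [if_neg]; exact fun h => hc h.2.symm
  · simp
  · intro c _ hc
    rw [Finset.sum_eq_zero, mul_zero]
    intro d _; rw [if_neg]; exact fun h => hc h.1.symm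
  · simp

theorem uniform_map_equiv [Nonempty α] [Nonempty β] (e : α ≃ β) :
    (PMF.uniformOfFintype α).map e = PMF.uniformOfFintype β := by
  classical
  ext b
  rw [PMF.map_apply, tsum_fintype, Finset.sum_eq_single (e.symm b)]
  · simp [PMF.uniformOfFintype_apply, Fintype.card_congr e]
  · intro a _ ha
    rw [if_neg]
    rintro rfl
    simp at ha
  · simp

theorem piPMF_cons {k : ℕ} (p : Fin (k + 1) → PMF α) :
    piPMF p = (p 0).bind fun a => (piPMF fun i : Fin k => p i.succ).map
      fun f => Fin.cons (α := fun _ => α) a f := by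
  classical
  ext x
  simp only [PMF.bind_apply, PMF.map_apply, tsum_fintype, piPMF_apply]
  rw [Finset.sum_eq_single (x 0), Finset.sum_eq_single fun i => x i.succ]
  · rw [Fin.prod_univ_succ, if_pos]
    exact (Fin.cons_self_tail x).symm
  · intro f _ hf
    rw [if_neg]
    intro h
    apply hf
    rw [h]
    funext i
    simp
  · simp
  · intro a _ ha
    rw [Finset.sum_eq_zero, mul_zero]
    intro f _
    rw [if_neg]
    intro h
    apply ha
    rw [h]
    simp
  · simp

theorem piPMF_const_eval (p : ι → PMF α) (t : ι) : (piPMF p).map (fun f => f t) = p t := by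
  rw [piPMF_split t p p fun _ _ => rfl, PMF.map_bind]
  simp only [PMF.map_comp, Function.comp_def, Function.update_self]
  rw [PMF.bind_const]
  exact PMF.map_id _

end PiPMF

theorem PMF.summable_toReal {α : Type*} (p : PMF α) : Summable fun x => (p x).toReal :=
  ENNReal.summable_toReal p.tsum_coe_ne_top

theorem PMF.tsum_toReal {α : Type*} (p : PMF α) : ∑' x, (p x).toReal = 1 := by
  rw [← ENNReal.tsum_toReal_eq fun x => p.apply_ne_top x, p.tsum_coe]
  rfl

theorem PMF.sum_toReal {α : Type*} [Fintype α] (p : PMF α) : ∑ x, (p x).toReal = 1 := by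
  rw [← tsum_fintype (L := .unconditional _), p.tsum_toReal]

theorem PMF.bind_apply_toReal {α β : Type*} [Fintype α] (p : PMF α) (f : α → PMF β) (b : β) :
    ((p.bind f) b).toReal = ∑ a, (p a).toReal * (f a b).toReal := by
  rw [PMF.bind_apply, tsum_fintype, ENNReal.toReal_sum]
  · simp
  · intro a _
    exact ENNReal.mul_ne_top (p.apply_ne_top a) ((f a).apply_ne_top b)

section TV

variable {α β : Type} {p q r : PMF α}

theorem summable_tv (p q : PMF α) : Summable fun x => |(p x).toReal - (q x).toReal| :=
  (p.summable_toReal.sub q.summable_toReal).abs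

theorem tvDist_self (p : PMF α) : tvDist p p = 0 := by simp [tvDist]

theorem tvDist_triangle (p q r : PMF α) : tvDist p r ≤ tvDist p q + tvDist q r := by
  unfold tvDist
  rw [← mul_add, ← (summable_tv p q).tsum_add (summable_tv q r)]
  refine mul_le_mul_of_nonneg_left ?_ (by norm_num)
  exact (summable_tv p r).tsum_le_tsum (fun x => abs_sub_le _ _ _)
    ((summable_tv p q).add (summable_tv q r))

theorem tvDist_le_one (p q : PMF α) : tvDist p q ≤ 1 := by
  have h : ∑' x, |(p x).toReal - (q x).toReal| ≤ 2 := by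
    calc _ ≤ ∑' x, ((p x).toReal + (q x).toReal) :=
          (summable_tv p q).tsum_le_tsum (fun x => abs_le.mpr
            ⟨by linarith [ENNReal.toReal_nonneg (a := p x), ENNReal.toReal_nonneg (a := q x)],
             by linarith [ENNReal.toReal_nonneg (a := p x), ENNReal.toReal_nonneg (a := q x)]⟩)
            (p.summable_toReal.add q.summable_toReal)
      _ = 2 := by
          rw [p.summable_toReal.tsum_add q.summable_toReal, p.tsum_toReal, q.tsum_toReal]
          norm_num
  unfold tvDist
  linarith

theorem tvDist_bind_le [Fintype α] (p q : PMF α) (f : α → PMF β) :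
    tvDist (p.bind f) (q.bind f) ≤ tvDist p q := by
  unfold tvDist
  refine mul_le_mul_of_nonneg_left ?_ (by norm_num)
  have hs : ∀ a, Summable fun b => |(p a).toReal - (q a).toReal| * (f a b).toReal :=
    fun a => (f a).summable_toReal.mul_left _
  calc ∑' b, |((p.bind f) b).toReal - ((q.bind f) b).toReal|
      ≤ ∑' b, ∑ a, |(p a).toReal - (q a).toReal| * (f a b).toReal := by
        refine (summable_tv _ _).tsum_le_tsum (fun b => ?_) (summable_sum fun a _ => hs a)
        rw [PMF.bind_apply_toReal, PMF.bind_apply_toReal, ← Finset.sum_sub_distrib]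
        refine (Finset.abs_sum_le_sum_abs _ _).trans (le_of_eq (Finset.sum_congr rfl fun a _ => ?_))
        rw [← sub_mul, abs_mul, abs_of_nonneg (ENNReal.toReal_nonneg (a := f a b))]
    _ = ∑ a, ∑' b, |(p a).toReal - (q a).toReal| * (f a b).toReal :=
        Summable.tsum_finsetSum fun a _ => hs a
    _ = ∑' a, |(p a).toReal - (q a).toReal| := by
        rw [tsum_fintype]
        refine Finset.sum_congr rfl fun a _ => ?_
        rw [tsum_mul_left, PMF.tsum_toReal, mul_one]

theorem tvDist_map_le [Fintype α] (p q : PMF α) (f : α → β) :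
    tvDist (p.map f) (q.map f) ≤ tvDist p q :=
  tvDist_bind_le p q _

theorem tvDist_bind_right_le [Fintype α] (p : PMF α) (f g : α → PMF β) :
    tvDist (p.bind f) (p.bind g) ≤ ∑ a, (p a).toReal * tvDist (f a) (g a) := by
  unfold tvDist
  have hs : ∀ a, Summable fun b => (p a).toReal * |(f a b).toReal - (g a b).toReal| :=
    fun a => (summable_tv (f a) (g a)).mul_left _
  have h : ∑' b, |((p.bind f) b).toReal - ((p.bind g) b).toReal| ≤
      ∑ a, (p a).toReal * ∑' b, |(f a b).toReal - (g a b).toReal| := by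
    calc _ ≤ ∑' b, ∑ a, (p a).toReal * |(f a b).toReal - (g a b).toReal| := by
          refine (summable_tv _ _).tsum_le_tsum (fun b => ?_) (summable_sum fun a _ => hs a)
          rw [PMF.bind_apply_toReal, PMF.bind_apply_toReal, ← Finset.sum_sub_distrib]
          refine (Finset.abs_sum_le_sum_abs _ _).trans
            (le_of_eq (Finset.sum_congr rfl fun a _ => ?_))
          rw [← mul_sub, abs_mul, abs_of_nonneg (ENNReal.toReal_nonneg (a := p a))]
      _ = _ := by
          rw [Summable.tsum_finsetSum fun a _ => hs a]
          simp only [tsum_mul_left]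
  calc _ ≤ 1 / 2 * ∑ a, (p a).toReal * ∑' b, |(f a b).toReal - (g a b).toReal| :=
        mul_le_mul_of_nonneg_left h (by norm_num)
    _ = _ := by
        rw [Finset.mul_sum]
        exact Finset.sum_congr rfl fun a _ => by ring

theorem tvDist_bind_right_le_of_forall [Fintype α] (p : PMF α) (f g : α → PMF β) {ε : ℝ}
    (h : ∀ a, tvDist (f a) (g a) ≤ ε) : tvDist (p.bind f) (p.bind g) ≤ ε := by
  refine (tvDist_bind_right_le p f g).trans ?_
  calc _ ≤ ∑ a, (p a).toReal * ε :=
        Finset.sum_le_sum fun a _ => mul_le_mul_of_nonneg_left (h a) ENNReal.toReal_nonneg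
    _ = ε := by rw [← Finset.sum_mul, p.sum_toReal, one_mul]

theorem tvDist_piPMF_le {ι : Type} [Fintype ι] [DecidableEq ι] [Fintype α] (p q : ι → PMF α) :
    tvDist (piPMF p) (piPMF q) ≤ ∑ i, tvDist (p i) (q i) := by
  have key : ∀ s : Finset ι,
      tvDist (piPMF p) (piPMF (s.piecewise q p)) ≤ ∑ i ∈ s, tvDist (p i) (q i) := by
    intro s
    induction s using Finset.induction_on with
    | empty => simp [tvDist_self]
    | insert t s ht ih =>
      rw [Finset.sum_insert ht, add_comm]
      refine (tvDist_triangle _ (piPMF (s.piecewise q p)) _).trans (add_le_add ih ?_)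
      rw [piPMF_split t (s.piecewise q p) (s.piecewise q p) fun _ _ => rfl,
        piPMF_split t ((insert t s).piecewise q p) (s.piecewise q p) fun i hi => by
          simp [Finset.piecewise, hi]]
      refine tvDist_bind_right_le_of_forall _ _ _ fun f => ?_
      rw [show s.piecewise q p t = p t by simp [ht],
        show (insert t s).piecewise q p t = q t by simp]
      exact tvDist_map_le _ _ _
  simpa using key Finset.univ

theorem tvDist_piPMF_const_le {ι : Type} [Fintype ι] [DecidableEq ι] [Fintype α] (p q : ι → PMF α)
    {ε : ℝ} (h : ∀ i, tvDist (p i) (q i) ≤ ε) :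
    tvDist (piPMF p) (piPMF q) ≤ Fintype.card ι * ε :=
  (tvDist_piPMF_le p q).trans ((Finset.sum_le_sum fun i _ => h i).trans (by simp))

end TV

/-- The expectation of `f` under `D`. -/
noncomputable def PMF.expect {α : Type} (D : PMF α) (f : α → ℝ) : ℝ := ∑' x, (D x).toReal * f x

section Expect

variable {α β : Type}

theorem PMF.expect_fintype [Fintype α] (D : PMF α) (f : α → ℝ) :
    D.expect f = ∑ x, (D x).toReal * f x := tsum_fintype _

theorem PMF.expect_bind [Fintype α] [Fintype β] (D : PMF α) (g : α → PMF β) (f : β → ℝ) :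
    (D.bind g).expect f = D.expect fun a => (g a).expect f := by
  simp only [PMF.expect_fintype, PMF.bind_apply_toReal, Finset.sum_mul, Finset.mul_sum]
  rw [Finset.sum_comm]
  simp only [mul_assoc]

theorem PMF.expect_pure [Fintype α] (a : α) (f : α → ℝ) : (PMF.pure a).expect f = f a := by
  classical
  rw [PMF.expect_fintype, Finset.sum_eq_single a]
  · simp
  · intro b _ hb
    simp [PMF.pure_apply, hb]
  · simp

theorem PMF.expect_map [Fintype α] [Fintype β] (D : PMF α) (g : α → β) (f : β → ℝ) :
    (D.map g).expect f = D.expect fun a => f (g a) := by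
  rw [PMF.map, PMF.expect_bind]
  simp only [Function.comp, PMF.expect_pure]

theorem PMF.expect_comm [Fintype α] [Fintype β] (D : PMF α) (P : PMF β) (f : α → β → ℝ) :
    (D.expect fun a => P.expect (f a)) = P.expect fun b => D.expect fun a => f a b := by
  simp only [PMF.expect_fintype, Finset.mul_sum]
  rw [Finset.sum_comm]
  exact Finset.sum_congr rfl fun _ _ => Finset.sum_congr rfl fun _ _ => by ring

theorem PMF.expect_const [Fintype α] (D : PMF α) (c : ℝ) : (D.expect fun _ => c) = c := by
  rw [PMF.expect_fintype, ← Finset.sum_mul, D.sum_toReal, one_mul]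

theorem PMF.expect_mono [Fintype α] (D : PMF α) {f g : α → ℝ} (h : ∀ a, f a ≤ g a) :
    D.expect f ≤ D.expect g := by
  rw [PMF.expect_fintype, PMF.expect_fintype]
  exact Finset.sum_le_sum fun a _ => mul_le_mul_of_nonneg_left (h a) ENNReal.toReal_nonneg

theorem PMF.expect_sub [Fintype α] (D : PMF α) (f g : α → ℝ) :
    (D.expect fun a => f a - g a) = D.expect f - D.expect g := by
  simp only [PMF.expect_fintype, mul_sub, Finset.sum_sub_distrib]

theorem PMF.abs_expect_le [Fintype α] (D : PMF α) (f : α → ℝ) :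
    |D.expect f| ≤ D.expect fun a => |f a| := by
  rw [PMF.expect_fintype, PMF.expect_fintype]
  refine (Finset.abs_sum_le_sum_abs _ _).trans (le_of_eq (Finset.sum_congr rfl fun a _ => ?_))
  rw [abs_mul, abs_of_nonneg ENNReal.toReal_nonneg]

theorem PMF.abs_expect_sub_le_tvDist [Fintype α] (D D' : PMF α) {f : α → ℝ}
    (hf : ∀ a, |f a| ≤ 1) : |D.expect f - D'.expect f| ≤ 2 * tvDist D D' := by
  rw [PMF.expect_fintype, PMF.expect_fintype, ← Finset.sum_sub_distrib, tvDist, tsum_fintype,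
    ← mul_assoc, show (2 : ℝ) * (1 / 2) = 1 by norm_num, one_mul]
  refine (Finset.abs_sum_le_sum_abs _ _).trans (Finset.sum_le_sum fun a _ => ?_)
  rw [← sub_mul, abs_mul]
  exact mul_le_of_le_one_right (abs_nonneg _) (hf a)

end Expect

/-! ### Computational indistinguishability -/

section CompIndist

variable {X Y Ω : ℕ → Type} [∀ lam, BitCode (X lam)] [∀ lam, BitCode (Y lam)]

theorem CompIndist.symm {D₀ D₁ : ∀ lam, PMF (X lam)} (h : CompIndist D₀ D₁) :
    CompIndist D₁ D₀ := by
  intro Q hQ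
  simpa only [abs_sub_comm] using h Q hQ

theorem CompIndist.trans {D₀ D₁ D₂ : ∀ lam, PMF (X lam)} (h : CompIndist D₀ D₁)
    (h' : CompIndist D₁ D₂) : CompIndist D₀ D₂ := by
  intro Q hQ
  refine ((h Q hQ).add (h' Q hQ)).mono (Eventually.of_forall fun lam => ?_)
  rw [abs_abs]
  exact abs_sub_le _ _ _

theorem QCircuit.acceptOn_eq_expect {α : Type} [BitCode α] (Q : QCircuit) (D : PMF α) :
    Q.acceptOn D = D.expect fun x => Q.acceptProb (encode x) := rfl

theorem QCircuit.abs_acceptProb_le (Q : QCircuit) (x : List Bool) : |Q.acceptProb x| ≤ 1 := by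
  rw [abs_of_nonneg (Q.acceptProb_nonneg x)]
  exact Q.acceptProb_le_one x

theorem CompIndist.of_tvDist [∀ lam, Fintype (X lam)] {D₀ D₁ : ∀ lam, PMF (X lam)} {ε : ℕ → ℝ}
    (hε : Negligible ε) (h : ∀ᶠ lam in atTop, tvDist (D₀ lam) (D₁ lam) ≤ ε lam) :
    CompIndist D₀ D₁ := by
  intro Q _
  refine (hε.const_mul 2).mono (h.mono fun lam hl => ?_)
  rw [abs_abs, QCircuit.acceptOn_eq_expect, QCircuit.acceptOn_eq_expect]
  refine (PMF.abs_expect_sub_le_tvDist _ _ fun x => (Q lam).abs_acceptProb_le _).trans ?_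
  linarith

/-- The hybrid argument: a chain of polynomially many distributions whose neighbours are
indistinguishable, for every choice of a position in the chain. -/
theorem CompIndist.hybrid (H : ∀ lam, ℕ → PMF (X lam)) {T : ℕ → ℕ} (hT : PolyBd id T)
    (hpos : ∀ lam, 0 < T lam)
    (h : ∀ t : ℕ → ℕ, (∀ lam, t lam < T lam) →
      CompIndist (fun lam => H lam (t lam)) (fun lam => H lam (t lam + 1))) :
    CompIndist (fun lam => H lam 0) (fun lam => H lam (T lam)) := by
  intro Q hQ
  have hmax : ∀ lam, ∃ t < T lam, ∀ i < T lam,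
      |(Q lam).acceptOn (H lam i) - (Q lam).acceptOn (H lam (i + 1))| ≤
        |(Q lam).acceptOn (H lam t) - (Q lam).acceptOn (H lam (t + 1))| := by
    intro lam
    obtain ⟨t, ht, hm⟩ := Finset.exists_max_image (Finset.range (T lam))
      (fun i => |(Q lam).acceptOn (H lam i) - (Q lam).acceptOn (H lam (i + 1))|)
      ⟨0, Finset.mem_range.mpr (hpos lam)⟩
    exact ⟨t, Finset.mem_range.mp ht, fun i hi => hm i (Finset.mem_range.mpr hi)⟩
  choose t ht hm using hmax
  refine ((h t ht Q hQ).mul_nat hT).mono (Eventually.of_forall fun lam => ?_)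
  rw [abs_abs]
  have key : ∀ k ≤ T lam, |(Q lam).acceptOn (H lam 0) - (Q lam).acceptOn (H lam k)| ≤
      k * |(Q lam).acceptOn (H lam (t lam)) - (Q lam).acceptOn (H lam (t lam + 1))| := by
    intro k hk
    induction k with
    | zero => simp
    | succ k ih =>
      refine (abs_sub_le _ ((Q lam).acceptOn (H lam k)) _).trans ?_
      have := ih (by omega)
      have := hm lam k (by omega)
      push_cast
      linarith
  exact key _ le_rfl

/-- Indistinguishability is preserved by reductions which are computed by circuits of polynomial
size for every value of the auxiliary randomness; the randomness itself need not be efficiently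
samplable since its best value can be hardwired. -/
theorem CompIndist.bind_map [∀ lam, Fintype (X lam)] [∀ lam, Fintype (Y lam)]
    [∀ lam, Fintype (Ω lam)] {D₀ D₁ : ∀ lam, PMF (X lam)} (h : CompIndist D₀ D₁)
    (P : ∀ lam, PMF (Ω lam)) (F : ∀ lam, X lam → Ω lam → Y lam) {s : ℕ → ℕ} (hs : PolyBd id s)
    (hX : PolyBd id fun lam => BitCode.len (X lam)) (hY : PolyBd id fun lam => BitCode.len (Y lam))
    (hF : ∀ lam ω, Computes (wires fun x : X lam => x) (s lam) (wires fun x => F lam x ω)) :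
    CompIndist (fun lam => (D₀ lam).bind fun x => (P lam).map (F lam x))
      (fun lam => (D₁ lam).bind fun x => (P lam).map (F lam x)) := by
  intro Q hQ
  have hC : ∀ lam ω, ∃ Q' : QCircuit,
      Q'.size ≤ 3 * (BitCode.len (X lam) + s lam + 2 + BitCode.len (Y lam)) + 2 * (Q lam).size ∧
      ∀ x, Q'.acceptProb (encode x) = (Q lam).acceptProb (encode (F lam x ω)) := by
    intro lam ω
    obtain ⟨C, hC, hrun⟩ := (hF lam ω).exists_circuit (fun _ => BitCode.length_encode _)
      (fun _ => BitCode.length_encode _)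
    obtain ⟨Q', hQ', hacc⟩ := (Q lam).exists_precompose C
    refine ⟨Q', by omega, fun x => ?_⟩
    rw [hacc _ (by rw [BitCode.length_encode]; omega), hrun]
  choose Q' hQ' hacc using hC
  let g : ∀ lam, Ω lam → ℝ := fun lam ω =>
    (Q' lam ω).acceptOn (D₀ lam) - (Q' lam ω).acceptOn (D₁ lam)
  have hmax : ∀ lam, ∃ ω, ∀ ω', |g lam ω'| ≤ |g lam ω| := by
    intro lam
    obtain ⟨ω₀, _⟩ := (P lam).support_nonempty
    obtain ⟨ω, _, hm⟩ := Finset.exists_max_image Finset.univ (fun ω => |g lam ω|)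
      ⟨ω₀, Finset.mem_univ _⟩
    exact ⟨ω, fun ω' => hm ω' (Finset.mem_univ _)⟩
  choose ω hω using hmax
  have hneg := h (fun lam => Q' lam (ω lam)) (by
    refine PolyBd.mono ?_ fun lam => hQ' lam (ω lam)
    exact ((PolyBd.const 3).mul (((hX.add hs).add (.const 2)).add hY)).add
      ((PolyBd.const 2).mul hQ))
  refine hneg.mono (Eventually.of_forall fun lam => ?_)
  rw [abs_abs]
  have hexp : ∀ D : PMF (X lam), (Q lam).acceptOn (D.bind fun x => (P lam).map (F lam x)) =
      (P lam).expect fun ω => (Q' lam ω).acceptOn D := by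
    intro D
    simp only [QCircuit.acceptOn_eq_expect, PMF.expect_bind, PMF.expect_map, hacc]
    exact PMF.expect_comm _ _ _
  rw [hexp, hexp, ← PMF.expect_sub]
  refine (PMF.abs_expect_le _ _).trans ?_
  refine ((P lam).expect_mono (g := fun _ => |g lam (ω lam)|) fun ω' => hω lam ω').trans ?_
  rw [PMF.expect_const]

theorem CompIndist.map [∀ lam, Fintype (X lam)] [∀ lam, Fintype (Y lam)]
    {D₀ D₁ : ∀ lam, PMF (X lam)} (h : CompIndist D₀ D₁)
    (F : ∀ lam, X lam → Y lam) {s : ℕ → ℕ} (hs : PolyBd id s)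
    (hX : PolyBd id fun lam => BitCode.len (X lam)) (hY : PolyBd id fun lam => BitCode.len (Y lam))
    (hF : ∀ lam, Computes (wires fun x : X lam => x) (s lam) (wires fun x => F lam x)) :
    CompIndist (fun lam => (D₀ lam).map (F lam)) (fun lam => (D₁ lam).map (F lam)) := by
  have := h.bind_map (Ω := fun _ => Unit) (fun _ => PMF.pure ()) (fun lam x _ => F lam x) hs hX hY
    fun lam _ => hF lam
  simpa [PMF.pure_map, PMF.map, Function.comp_def] using this

end CompIndist

/-! ### Circuits for arithmetic in `ℤ_q` -/

section Arith

variable {X : Type} {B : Set (X → Bool)} {ℓ a b s : ℕ}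

theorem wires_mono_pi {α : Type} [BitCode α] {k : ℕ} (F : X → Fin k → α) (i : Fin k) :
    (wires fun x => F x i) ⊆ wires F := by
  rw [wires_pi]
  exact Set.subset_iUnion (fun i => wires fun x => F x i) i

theorem wires_mono_pi_prod {α : Type} [BitCode α] {k l : ℕ} (F : X → Fin k × Fin l → α)
    (i : Fin k × Fin l) : (wires fun x => F x i) ⊆ wires F := by
  rw [wires_pi_prod]
  exact (Set.subset_iUnion (fun j => wires fun x => F x (i.1, j)) i.2).trans
    (Set.subset_iUnion (fun i => ⋃ j, wires fun x => F x (i, j)) i.1)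

theorem wires_mono_matrix {ι α : Type} {k : ℕ} [BitCode (ι → α)] (F : X → Matrix (Fin k) ι α)
    (i : Fin k) : (wires fun x => F x i) ⊆ wires F :=
  wires_mono_pi (α := ι → α) F i

theorem wires_mono_fst {α β : Type} [BitCode α] [BitCode β] (F : X → α × β) :
    (wires fun x => (F x).1) ⊆ wires F := by
  rw [wires_prod]; exact Set.subset_union_left

theorem wires_mono_snd {α β : Type} [BitCode α] [BitCode β] (F : X → α × β) :
    (wires fun x => (F x).2) ⊆ wires F := by
  rw [wires_prod]; exact Set.subset_union_right

theorem wires_mono_bit (F : X → Zq ℓ) {i : ℕ} (hi : i < ℓ) :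
    {fun x => (F x).val.testBit i} ⊆ wires F := by
  rw [wires_Zq, Set.singleton_subset_iff]
  exact ⟨i, hi, rfl⟩

namespace Computes

theorem wires_self {α : Type} [BitCode α] (F : X → α) : Computes (wires F) 0 (wires F) :=
  of_subset subset_rfl

theorem pi {α : Type} [BitCode α] {k : ℕ} {F : X → Fin k → α}
    (h : ∀ i, Computes B a (wires fun x => F x i)) : Computes B (k * a) (wires F) := by
  rw [wires_pi]
  simpa using iUnion h

theorem pi_prod {α : Type} [BitCode α] {k l : ℕ} {F : X → Fin k × Fin l → α}
    (h : ∀ i, Computes B a (wires fun x => F x i)) : Computes B (k * (l * a)) (wires F) := by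
  rw [wires_pi_prod]
  simpa using iUnion fun i => iUnion fun j => h (i, j)

theorem matrix {ι α : Type} {k : ℕ} [BitCode (ι → α)] {F : X → Matrix (Fin k) ι α}
    (h : ∀ i, Computes B a (wires fun x => F x i)) : Computes B (k * a) (wires F) :=
  pi (α := ι → α) h

theorem prod {α β : Type} [BitCode α] [BitCode β] {F : X → α} {G : X → β}
    (hF : Computes B a (wires F)) (hG : Computes B b (wires G)) :
    Computes B (a + b) (wires fun x => (F x, G x)) := by
  rw [wires_prod]
  exact hF.union hG

theorem proj {α : Type} [BitCode α] {k : ℕ} {F : X → Fin k → α} (h : Computes B a (wires F))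
    (i : Fin k) : Computes B a (wires fun x => F x i) :=
  h.mono_right (wires_mono_pi F i)

theorem proj_prod {α : Type} [BitCode α] {k l : ℕ} {F : X → Fin k × Fin l → α}
    (h : Computes B a (wires F)) (i : Fin k × Fin l) : Computes B a (wires fun x => F x i) :=
  h.mono_right (wires_mono_pi_prod F i)

theorem row {ι α : Type} {k : ℕ} [BitCode (ι → α)] {F : X → Matrix (Fin k) ι α}
    (h : Computes B a (wires F)) (i : Fin k) : Computes B a (wires fun x => F x i) :=
  h.mono_right (wires_mono_matrix F i)

theorem fst {α β : Type} [BitCode α] [BitCode β] {F : X → α × β} (h : Computes B a (wires F)) :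
    Computes B a (wires fun x => (F x).1) :=
  h.mono_right (wires_mono_fst F)

theorem snd {α β : Type} [BitCode α] [BitCode β] {F : X → α × β} (h : Computes B a (wires F)) :
    Computes B a (wires fun x => (F x).2) :=
  h.mono_right (wires_mono_snd F)

theorem bool {f : X → Bool} : Computes B a (wires f) ↔ Computes B a {f} := by
  rw [wires_bool]

theorem bit {F : X → Zq ℓ} (h : Computes B a (wires F)) (i : ℕ) :
    Computes B a {fun x => (F x).val.testBit i} := by
  by_cases hi : i < ℓ
  · exact h.mono_right (wires_mono_bit F hi)
  · refine ((const false).mono_size (Nat.zero_le a)).mono_right ?_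
    rw [Set.singleton_subset_iff, Set.mem_singleton_iff]
    funext x
    exact Nat.testBit_lt_two_pow
      ((ZMod.val_lt (F x)).trans_le (Nat.pow_le_pow_right (by norm_num) (not_lt.mp hi)))

theorem of_lbits {n : ℕ} {str : X → List Bool}
    (h : ∀ i < n, Computes B a {fun x => (str x).getD i false}) :
    Computes B (n * a) (lbits n str) := by
  refine (biUnion_finset (Finset.range n)
    (t := fun i => {fun x => (str x).getD i false}) fun i hi =>
      h i (Finset.mem_range.mp hi)).mono_right ?_ |>.mono_size (by simp)
  rintro _ ⟨i, hi, rfl⟩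
  simp only [Set.mem_iUnion]
  exact ⟨i, Finset.mem_range.mpr hi, rfl⟩

theorem of_bits {F : X → Zq ℓ}
    (h : ∀ i < ℓ, Computes B a {fun x => (F x).val.testBit i}) :
    Computes B (ℓ * a) (wires F) := by
  refine (biUnion_finset (Finset.range ℓ)
    (t := fun i => {fun x => (F x).val.testBit i}) fun i hi =>
      h i (Finset.mem_range.mp hi)).mono_right ?_ |>.mono_size (by simp)
  rw [wires_Zq]
  rintro _ ⟨i, hi, rfl⟩
  simp only [Set.mem_iUnion]
  exact ⟨i, Finset.mem_range.mpr hi, rfl⟩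

/-- A case distinction on one bit. -/
theorem select {α : Type} [BitCode α] {f : X → Bool} {F G : X → α} {c : ℕ}
    (hf : Computes B a {f}) (hF : Computes B b (wires F)) (hG : Computes B c (wires G)) :
    Computes B (a + b + c + BitCode.len α * 8) (wires fun x => if f x then F x else G x) := by
  have h := (hf.union hF).union hG
  refine h.trans (of_lbits fun i hi => ?_)
  have hmem : ∀ K : X → α, (fun x => (encode (K x)).getD i false) ∈ wires K :=
    fun K => ⟨i, hi, rfl⟩
  refine ((ite (B := {f} ∪ wires F ∪ wires G) (of_mem (Or.inl (Or.inl rfl)))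
    (of_mem (Or.inl (Or.inr (hmem F)))) (of_mem (Or.inr (hmem G)))).mono_size
      (by omega)).mono_right ?_
  rw [Set.singleton_subset_iff, Set.mem_singleton_iff]
  funext x
  cases hx : f x <;> simp [hx]

end Computes

/-- The bit vector of an element of `ℤ_q`. -/
def Zq.toBV (x : Zq ℓ) : BitVec ℓ := BitVec.ofNat ℓ x.val

theorem Zq.val_lt (x : Zq ℓ) : x.val < 2 ^ ℓ := ZMod.val_lt x

theorem Zq.getLsbD_toBV (x : Zq ℓ) (i : ℕ) : x.toBV.getLsbD i = x.val.testBit i := by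
  rw [Zq.toBV, BitVec.getLsbD_ofNat]
  by_cases hi : i < ℓ
  · simp [hi]
  · have : x.val.testBit i = false := Nat.testBit_lt_two_pow
      (x.val_lt.trans_le (Nat.pow_le_pow_right (by norm_num) (not_lt.mp hi)))
    simp [this]

theorem Zq.toBV_add (x y : Zq ℓ) : (x + y).toBV = x.toBV + y.toBV := by
  rw [Zq.toBV, Zq.toBV, Zq.toBV, ← BitVec.ofNat_add, ZMod.val_add]
  apply BitVec.eq_of_toNat_eq
  simp

theorem Zq.testBit_add (x y : Zq ℓ) {i : ℕ} (hi : i < ℓ) :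
    (x + y).val.testBit i = Bool.xor (x.val.testBit i) (Bool.xor (y.val.testBit i)
      (BitVec.carry i x.toBV y.toBV false)) := by
  rw [← Zq.getLsbD_toBV, Zq.toBV_add, BitVec.getLsbD_add hi, Zq.getLsbD_toBV, Zq.getLsbD_toBV]

/-- The complement of all bits is `-1 - x`. -/
theorem Zq.testBit_neg_one_sub (x : Zq ℓ) {i : ℕ} (hi : i < ℓ) :
    (-1 - x : Zq ℓ).val.testBit i = !x.val.testBit i := by
  have h1 : (-1 - x : Zq ℓ) = ((2 ^ ℓ - (x.val + 1) : ℕ) : Zq ℓ) := by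
    rw [Nat.cast_sub (by have := x.val_lt; omega)]
    push_cast
    have h2 : ((2 : Zq ℓ) ^ ℓ) = 0 := by
      have := ZMod.natCast_self (2 ^ ℓ)
      push_cast at this
      exact this
    rw [h2, ZMod.natCast_zmod_val]
    ring
  rw [h1, ZMod.val_natCast_of_lt (by have := Nat.two_pow_pos ℓ; omega),
    Nat.testBit_two_pow_sub_succ x.val_lt]
  simp [hi]

theorem Zq.testBit_two_pow_mul (x : Zq ℓ) (k : ℕ) {i : ℕ} (hi : i < ℓ) :
    (2 ^ k * x : Zq ℓ).val.testBit i = (decide (k ≤ i) && x.val.testBit (i - k)) := by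
  have h1 : (2 ^ k * x : Zq ℓ) = ((2 ^ k * x.val : ℕ) : Zq ℓ) := by
    push_cast
    rw [ZMod.natCast_zmod_val]
  rw [h1, ZMod.val_natCast, Nat.testBit_mod_two_pow, Nat.testBit_two_pow_mul]
  simp [hi]

theorem Nat.sum_testBit_mod (x k : ℕ) :
    ∑ i ∈ Finset.range k, (if x.testBit i then 2 ^ i else 0) = x % 2 ^ k := by
  induction k with
  | zero => simp [Nat.mod_one]
  | succ k ih =>
    rw [Finset.sum_range_succ, ih, Nat.mod_pow_succ, ← Nat.toNat_testBit]
    cases x.testBit k <;> simp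

theorem Zq.eq_sum_bits (x : Zq ℓ) :
    x = ∑ i ∈ Finset.range ℓ, if x.val.testBit i then (2 : Zq ℓ) ^ i else 0 := by
  have h := Nat.sum_testBit_mod x.val ℓ
  rw [Nat.mod_eq_of_lt x.val_lt] at h
  have h2 := congrArg (Nat.cast (R := Zq ℓ)) h
  rw [ZMod.natCast_zmod_val] at h2
  refine h2.symm.trans ?_
  push_cast
  rfl

namespace Computes

variable {F G : X → Zq ℓ}

theorem carries (i : ℕ) : Computes (wires F ∪ wires G) (16 * i)
    {g | ∃ j ≤ i, g = fun x => BitVec.carry j (F x).toBV (G x).toBV false} := by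
  induction i with
  | zero =>
    refine of_subset_union ?_
    rintro _ ⟨j, hj, rfl⟩
    obtain rfl : j = 0 := by omega
    exact Or.inr (Or.inl (by simp))
  | succ i ih =>
    let g : X → Bool := fun x => BitVec.carry i (F x).toBV (G x).toBV false
    have hF := (of_subset (T := wires F) (B := wires F ∪ wires G ∪ {g' | ∃ j ≤ i, g' = fun x =>
      BitVec.carry j (F x).toBV (G x).toBV false}) (s := 0)
      (Set.subset_union_left.trans Set.subset_union_left)).bit i
    have hG := (of_subset (T := wires G) (B := wires F ∪ wires G ∪ {g' | ∃ j ≤ i, g' = fun x =>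
      BitVec.carry j (F x).toBV (G x).toBV false}) (s := 0)
      (Set.subset_union_right.trans Set.subset_union_left)).bit i
    have h := ih.cut_union (hF.atLeastTwo hG (of_mem (f := g) (Or.inr ⟨i, le_rfl, rfl⟩)))
    refine (h.mono_size (by omega)).mono_right ?_
    rintro _ ⟨j, hj, rfl⟩
    rcases Nat.lt_or_ge i j with h' | h'
    · obtain rfl : j = i + 1 := by omega
      refine Or.inr ?_
      rw [Set.mem_singleton_iff]
      funext x
      rw [BitVec.carry_succ, Zq.getLsbD_toBV, Zq.getLsbD_toBV]
    · exact Or.inl ⟨j, h', rfl⟩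

theorem add (hF : Computes B a (wires F)) (hG : Computes B b (wires G)) :
    Computes B (a + b + 32 * ℓ) (wires fun x => F x + G x) := by
  have h := (hF.union hG).trans ((carries ℓ).cut_union
    (T' := wires fun x => F x + G x) (s' := ℓ * 16) (of_bits fun i hi => ?_))
  · exact (h.mono_right Set.subset_union_right).mono_size (by omega)
  · have h1 : wires F ⊆ wires F ∪ wires G ∪ {g' | ∃ j ≤ ℓ, g' = fun x =>
      BitVec.carry j (F x).toBV (G x).toBV false} :=
      Set.subset_union_left.trans Set.subset_union_left
    have h2 : wires G ⊆ wires F ∪ wires G ∪ {g' | ∃ j ≤ ℓ, g' = fun x =>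
      BitVec.carry j (F x).toBV (G x).toBV false} :=
      Set.subset_union_right.trans Set.subset_union_left
    have h3 := ((of_subset (s := 0) h1).bit i).xor (((of_subset (s := 0) h2).bit i).xor
      (of_mem (f := fun x => BitVec.carry i (F x).toBV (G x).toBV false)
        (Or.inr ⟨i, hi.le, rfl⟩)))
    refine (h3.mono_size (by omega)).mono_right ?_
    rw [Set.singleton_subset_iff, Set.mem_singleton_iff]
    funext x
    exact Zq.testBit_add _ _ hi

theorem congr {T : Set (X → Bool)} {α : Type} [BitCode α] {F G : X → α}
    (h : Computes T a (wires F)) (e : ∀ x, F x = G x) : Computes T a (wires G) := by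
  rwa [← funext e]

theorem neg (hF : Computes B a (wires F)) : Computes B (a + 33 * ℓ) (wires fun x => -F x) := by
  have h1 : Computes (wires F) (ℓ * 1) (wires fun x => -1 - F x) := by
    refine of_bits fun i hi => ?_
    have h2 := ((wires_self F).bit i).not
    refine (h2.mono_size (by omega)).mono_right ?_
    rw [Set.singleton_subset_iff, Set.mem_singleton_iff]
    funext x
    exact Zq.testBit_neg_one_sub _ hi
  have h2 := (hF.trans h1).add (wires_const (s := 0) (1 : Zq ℓ))
  exact (h2.congr fun x => by ring).mono_size (by omega)

theorem sub (hF : Computes B a (wires F)) (hG : Computes B b (wires G)) :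
    Computes B (a + b + 65 * ℓ) (wires fun x => F x - G x) :=
  ((hF.add hG.neg).congr fun x => (sub_eq_add_neg _ _).symm).mono_size (by omega)

theorem sum {ι : Type} (I : Finset ι) {F : ι → X → Zq ℓ}
    (h : ∀ i ∈ I, Computes B a (wires (F i))) :
    Computes B (I.card * (a + 32 * ℓ)) (wires fun x => ∑ i ∈ I, F i x) := by
  classical
  induction I using Finset.induction_on with
  | empty => simpa using wires_const (0 : Zq ℓ)
  | insert i I hi ih =>
    have h1 := (h i (Finset.mem_insert_self _ _)).add
      (ih fun j hj => h j (Finset.mem_insert_of_mem hj))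
    rw [Finset.card_insert_of_notMem hi]
    exact (h1.congr fun x => (Finset.sum_insert (f := fun i => F i x) hi).symm).mono_size
      (le_of_eq (by ring))

theorem len_Zq : BitCode.len (Zq ℓ) = ℓ := rfl

theorem bitMul {f : X → Bool} (hf : Computes B a {f}) (hF : Computes B b (wires F)) :
    Computes B (a + b + 8 * ℓ) (wires fun x => if f x then F x else 0) :=
  (hf.select hF (wires_const (s := 0) (0 : Zq ℓ))).mono_size (by rw [len_Zq]; omega)

theorem shift (hF : Computes B a (wires F)) (k : ℕ) :
    Computes B a (wires fun x => 2 ^ k * F x) := by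
  refine (hF.trans (s' := 0) ?_)
  refine of_subset_union ?_
  rw [wires_Zq]
  rintro _ ⟨i, hi, rfl⟩
  by_cases hk : k ≤ i
  · refine Or.inl ?_
    rw [wires_Zq]
    exact ⟨i - k, by omega, funext fun x => by rw [Zq.testBit_two_pow_mul _ _ hi]; simp [hk]⟩
  · exact Or.inr (Or.inl (funext fun x => by rw [Zq.testBit_two_pow_mul _ _ hi]; simp [hk]))

theorem mul (hF : Computes B a (wires F)) (hG : Computes B b (wires G)) :
    Computes B (a + b + 40 * ℓ * ℓ) (wires fun x => F x * G x) := by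
  have h : Computes (wires F ∪ wires G) (ℓ * (8 * ℓ + 32 * ℓ)) (wires fun x =>
      ∑ i ∈ Finset.range ℓ, if (G x).val.testBit i then 2 ^ i * F x else 0) := by
    have := sum (B := wires F ∪ wires G) (Finset.range ℓ) (a := 8 * ℓ)
      (F := fun i x => if (G x).val.testBit i then 2 ^ i * F x else 0) fun i _ =>
      ((((of_subset (s := 0) Set.subset_union_right).bit i).bitMul
        ((of_subset (s := 0) Set.subset_union_left).shift i)).mono_size (by omega))
    simpa using this
  refine (((hF.union hG).trans h).congr fun x => ?_).mono_size (le_of_eq (by ring))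
  conv_rhs => rw [Zq.eq_sum_bits (G x), Finset.mul_sum]
  refine Finset.sum_congr rfl fun i _ => ?_
  split_ifs
  · ring
  · simp

/-- Evaluation of a net over encoded data. -/
theorem net_eval {β : Type} [BitCode β] {op : β → β → β}
    (hop : ∀ F G : X → β, Computes (wires F ∪ wires G) s (wires fun x => op (F x) (G x)))
    {k w : ℕ} (c : Net k w) (inp : X → Fin k → β) (hinp : ∀ i, Computes B 0 (wires (inp · i))) :
    Computes B (w * s) (⋃ j, wires fun x => c.eval op (inp x) j) := by
  induction c with
  | inputs =>
    simpa [Net.eval] using (iUnion hinp).mono_size (Nat.zero_le (k * s))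
  | @gate w c i j ih =>
    have h1 : Computes (⋃ j, wires fun x => c.eval op (inp x) j) s
        (wires fun x => op (c.eval op (inp x) i) (c.eval op (inp x) j)) :=
      (hop _ _).mono_left (Set.union_subset
        (Set.subset_iUnion (fun j => wires fun x => c.eval op (inp x) j) i)
        (Set.subset_iUnion (fun j => wires fun x => c.eval op (inp x) j) j))
    refine ((ih.cut_union (h1.mono_left Set.subset_union_right)).mono_size
      (le_of_eq (by ring))).mono_right ?_
    refine Set.iUnion_subset fun t => ?_
    refine Fin.lastCases ?_ (fun t => ?_) t
    · simp only [Net.eval, Fin.snoc_last]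
      exact Set.subset_union_right
    · simp only [Net.eval, Fin.snoc_castSucc]
      exact (Set.subset_iUnion (fun j => wires fun x => c.eval op (inp x) j) t).trans
        Set.subset_union_left

theorem circuit_eval {β : Type} [BitCode β] {op : β → β → β}
    (hop : ∀ F G : X → β, Computes (wires F ∪ wires G) s (wires fun x => op (F x) (G x)))
    {k o : ℕ} (C : Circuit k o) (inp : X → Fin k → β) (hinp : ∀ i, Computes B 0 (wires (inp · i)))
    (j : Fin o) : Computes B (C.size * s) (wires fun x => C.eval op (inp x) j) :=
  ((net_eval hop C.net inp hinp).mono_size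
    (Nat.mul_le_mul_right _ (Nat.le_add_right _ _))).mono_right
    (Set.subset_iUnion (fun j => wires fun x => C.net.eval op (inp x) j) (C.out j))

end Computes

/-! ### Circuits for the operations of DualHE -/

namespace DualHE

variable {m : ℕ}

/-- The size of a circuit for the homomorphic NAND. -/
def nandCost (m ℓ : ℕ) : ℕ := (m + 1) * ((m + 1) * (ℓ * ((m + 1) * ℓ * (40 * ℓ) + 65 * ℓ)))

theorem computes_nand (F G : X → CT m ℓ) :
    Computes (wires F ∪ wires G) (nandCost m ℓ) (wires fun x => nand (F x) (G x)) := by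
  refine Computes.matrix fun i => Computes.pi_prod fun j => ?_
  have h1 : Computes (wires F ∪ wires G) ((m + 1) * ℓ * (8 * ℓ + 32 * ℓ)) (wires fun x =>
      ∑ k : Fin (m + 1) × Fin ℓ, if (G x k.1 j).val.testBit k.2 then F x i k else 0) := by
    have := Computes.sum (B := wires F ∪ wires G) (Finset.univ : Finset (Fin (m + 1) × Fin ℓ))
      (a := 8 * ℓ) (F := fun k x => if (G x k.1 j).val.testBit k.2 then F x i k else 0)
      fun k _ => ((((Computes.of_subset (s := 0) Set.subset_union_right).row
        (F := G) k.1).proj_prod j).bit k.2).bitMul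
          (((Computes.of_subset (s := 0) Set.subset_union_left).row (F := F) i).proj_prod k)
          |>.mono_size (by omega)
    simpa using this
  have h2 := (Computes.wires_const (s := 0) (DualHE.G m ℓ i j)).sub h1
  refine (h2.congr fun x => ?_).mono_size (le_of_eq (by ring))
  simp only [nand, Matrix.sub_apply, Matrix.mul_apply, Ginv, Matrix.of_apply, mul_ite, mul_one,
    mul_zero]

theorem computes_convert (F : X → CT m ℓ) :
    Computes (wires F) 0 (wires fun x => convert (F x)) := by
  have : Computes (wires F) ((m + 1) * 0) (wires fun x => convert (F x)) := by
    refine Computes.pi fun i => ?_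
    by_cases h : 0 < ℓ
    · simp only [convert, h, dite_true]
      exact ((Computes.wires_self F).row i).proj_prod _
    · simp only [convert, h, dite_false]
      exact Computes.wires_const _
  simpa using this

theorem computes_ctBits (F : X → Fin (m + 1) → Zq ℓ) (j : Fin ((m + 1) * ℓ)) :
    Computes (wires F) 0 {fun x => Dual.ctBits (F x) j} :=
  ((Computes.wires_self F).proj (finProdFinEquiv.symm j).1).bit (finProdFinEquiv.symm j).2

theorem computes_ite_const {α : Type} [BitCode α] {f : X → Bool} (hf : f ∈ B) (A A' : α) :
    Computes B (BitCode.len α * 8) (wires fun x => if f x then A else A') := by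
  have := (Computes.of_mem hf).select (Computes.wires_const (s := 0) A)
    (Computes.wires_const (s := 0) A')
  exact this.mono_size (by omega)

/-- The size of a circuit for bootstrapping, in terms of the size of the decryption circuit. -/
def refreshCost (m ℓ d : ℕ) : ℕ :=
  (m + 1) * ℓ * (BitCode.len (CT m ℓ) * 8) + d * nandCost m ℓ

theorem computes_refresh (D : Circuit (m + (m + 1) * ℓ) 1) (E : X → Fin m → CT m ℓ)
    (F : X → CT m ℓ) :
    Computes (wires E ∪ wires F) (refreshCost m ℓ D.size)
      (wires fun x => refresh D (E x) (F x)) := by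
  let K : X → Fin ((m + 1) * ℓ) → CT m ℓ := fun x j =>
    if Dual.ctBits (convert (F x)) j then DualHE.G m ℓ else 0
  have hK : Computes (wires E ∪ wires F) ((m + 1) * ℓ * (BitCode.len (CT m ℓ) * 8))
      (wires K) := by
    refine Computes.pi fun j => ?_
    have h1 := ((computes_convert F).trans (computes_ctBits _ j)).mono_left
      (Set.subset_union_right (s := wires E))
    exact (h1.trans (computes_ite_const (Set.mem_singleton _) (DualHE.G m ℓ) 0)).mono_size
      (by omega)
  refine hK.cut ?_
  refine Computes.circuit_eval (fun F G => computes_nand F G) D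
    (fun x => Fin.append (E x) (K x)) (fun i => ?_) 0
  refine Fin.addCases (fun i => ?_) (fun i => ?_) i
  · simp only [Fin.append_left]
    exact Computes.of_subset ((wires_mono_pi E i).trans
      (Set.subset_union_left.trans Set.subset_union_left))
  · simp only [Fin.append_right]
    exact Computes.of_subset ((wires_mono_pi K i).trans Set.subset_union_right)

/-- A circuit for decryption is also a computation of it. -/
theorem computes_dec {D : Circuit (m + (m + 1) * ℓ) 1} (hD : Dual.IsDecCircuit D)
    (E : X → Dual.SK m) (F : X → CT m ℓ) :
    Computes (wires E ∪ wires F) D.size {fun x => dec (E x) (F x)} := by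
  have h := Computes.circuit_eval (B := wires E ∪ wires F) (s := 1)
    (op := fun a b : Bool => !(a && b))
    (fun F G => by
      simp only [wires_bool]
      exact Computes.nand (Or.inl rfl) (Or.inr rfl)) D
    (fun x => Fin.append (E x) (Dual.ctBits (convert (F x)))) (fun i => ?_) 0
  · rw [wires_bool] at h
    refine (h.mono_size (by omega)).mono_right ?_
    rw [Set.singleton_subset_iff, Set.mem_singleton_iff]
    funext x
    exact (hD (E x) (convert (F x))).symm
  · rw [wires_bool]
    refine Fin.addCases (fun i => ?_) (fun i => ?_) i
    · simp only [Fin.append_left]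
      rw [← wires_bool fun x => E x i]
      exact Computes.of_subset ((wires_mono_pi E i).trans Set.subset_union_left)
    · simp only [Fin.append_right]
      exact ((computes_convert F).trans (computes_ctBits _ i)).mono_left Set.subset_union_right

end DualHE

end Arith

/-! ### The leftover hash lemma and the distribution of public keys -/

section LHL

open Matrix

variable {n k ℓ : ℕ}

/-- If a coordinate of `d` is a unit, then `d A` is uniform for uniform `A`. -/
theorem card_vecMul_eq_zero (d : Fin k → Zq ℓ) {i : Fin k} (hd : IsUnit (d i)) :
    (Finset.univ.filter fun A : Matrix (Fin k) (Fin n) (Zq ℓ) => d ᵥ* A = 0).card *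
      Fintype.card (Fin n → Zq ℓ) = Fintype.card (Matrix (Fin k) (Fin n) (Zq ℓ)) := by
  let f : Matrix (Fin k) (Fin n) (Zq ℓ) →+ (Fin n → Zq ℓ) :=
    { toFun := fun A => d ᵥ* A
      map_zero' := Matrix.vecMul_zero d
      map_add' := fun A A' => Matrix.vecMul_add A A' d }
  have hsurj : ∀ y, y ∈ Set.range f := by
    intro y
    obtain ⟨u, hu⟩ := hd
    refine ⟨Matrix.of fun j a => if j = i then (↑u⁻¹ : Zq ℓ) * y a else 0, ?_⟩
    funext a
    simp [f, Matrix.vecMul, dotProduct, ← hu]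
  have hfib : ∀ y, (Finset.univ.filter fun A => f A = y).card =
      (Finset.univ.filter fun A => f A = 0).card := fun y =>
    AddMonoidHom.card_fiber_eq_of_mem_range f (hsurj y) (hsurj 0)
  have h := Finset.card_eq_sum_card_fiberwise (f := f) (s := Finset.univ) (t := Finset.univ)
    fun _ _ => Finset.mem_univ _
  rw [Finset.sum_congr rfl fun y _ => hfib y, Finset.sum_const, Finset.card_univ, smul_eq_mul,
    Finset.card_univ, mul_comm] at h
  exact h.symm

theorem PMF.uniform_toReal {α : Type} [Fintype α] [Nonempty α] (a : α) :
    (PMF.uniformOfFintype α a).toReal = (Fintype.card α : ℝ)⁻¹ := by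
  simp [PMF.uniformOfFintype_apply]

theorem PMF.expect_uniform {α : Type} [Fintype α] [Nonempty α] (f : α → ℝ) :
    (PMF.uniformOfFintype α).expect f = (Fintype.card α : ℝ)⁻¹ * ∑ a, f a := by
  simp only [PMF.expect_fintype, PMF.uniform_toReal, Finset.mul_sum]

/-- The distance from uniform is controlled by the collision probability. -/
theorem tvDist_uniform_le_sqrt {α : Type} [Fintype α] [Nonempty α] (p : PMF α) :
    tvDist p (PMF.uniformOfFintype α) ≤
      1 / 2 * √(Fintype.card α * ∑ y, (p y).toReal ^ 2 - 1) := by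
  have hQ : (0 : ℝ) < Fintype.card α := by exact_mod_cast Fintype.card_pos
  unfold tvDist
  refine mul_le_mul_of_nonneg_left ?_ (by norm_num)
  rw [tsum_fintype]
  refine Real.le_sqrt_of_sq_le ?_
  refine (sq_sum_le_card_mul_sum_sq (s := Finset.univ)).trans (le_of_eq ?_)
  simp only [sq_abs, PMF.uniform_toReal, sub_sq, Finset.sum_add_distrib, Finset.sum_sub_distrib,
    Finset.card_univ, Finset.sum_const, nsmul_eq_mul]
  rw [← Finset.sum_mul, ← Finset.mul_sum, p.sum_toReal]
  field_simp
  ring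

theorem PMF.expect_sqrt_le {α : Type} [Fintype α] (p : PMF α) (f : α → ℝ) (hf : ∀ a, 0 ≤ f a) :
    (p.expect fun a => √(f a)) ≤ √(p.expect f) := by
  refine Real.le_sqrt_of_sq_le ?_
  rw [PMF.expect_fintype, PMF.expect_fintype]
  have h := Finset.sum_mul_sq_le_sq_mul_sq Finset.univ (fun a => √(p a).toReal)
    fun a => √((p a).toReal) * √(f a)
  have h1 : ∀ a, √(p a).toReal * (√((p a).toReal) * √(f a)) = (p a).toReal * √(f a) := by
    intro a
    rw [← mul_assoc, Real.mul_self_sqrt ENNReal.toReal_nonneg]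
  have h2 : ∀ a, √(p a).toReal ^ 2 = (p a).toReal := fun a => Real.sq_sqrt ENNReal.toReal_nonneg
  have h3 : ∀ a, (√(p a).toReal * √(f a)) ^ 2 = (p a).toReal * f a := by
    intro a
    rw [mul_pow, h2, Real.sq_sqrt (hf a)]
  simp only [h1, h2, h3, p.sum_toReal, one_mul] at h
  exact h

/-- The leftover hash lemma for `ω ↦ v ω A`: the law of the hash is on average close to uniform if
any two different inputs differ by a unit in some coordinate. -/
theorem leftover_hash {Ω : Type} [Fintype Ω] [Nonempty Ω] (v : Ω → Fin k → Zq ℓ)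
    (hv : ∀ ω ω', ω ≠ ω' → ∃ i, IsUnit (v ω i - v ω' i)) :
    ((PMF.uniformOfFintype (Matrix (Fin k) (Fin n) (Zq ℓ))).expect fun A =>
      tvDist ((PMF.uniformOfFintype Ω).map fun ω => v ω ᵥ* A) (PMF.uniformOfFintype _)) ≤
      1 / 2 * √(2 ^ (n * ℓ) / Fintype.card Ω) := by
  classical
  let U := PMF.uniformOfFintype (Matrix (Fin k) (Fin n) (Zq ℓ))
  let P : Matrix (Fin k) (Fin n) (Zq ℓ) → PMF (Fin n → Zq ℓ) := fun A =>
    (PMF.uniformOfFintype Ω).map fun ω => v ω ᵥ* A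
  have hcard : (Fintype.card (Fin n → Zq ℓ) : ℝ) = 2 ^ (n * ℓ) := by
    simp [ZMod.card, ← pow_mul, mul_comm]
  have hQ : (0 : ℝ) < Fintype.card (Fin n → Zq ℓ) := by exact_mod_cast Fintype.card_pos
  have hΩ : (0 : ℝ) < Fintype.card Ω := by exact_mod_cast Fintype.card_pos
  have hU : (0 : ℝ) < Fintype.card (Matrix (Fin k) (Fin n) (Zq ℓ)) := by
    exact_mod_cast Fintype.card_pos
  -- the collision probability of the hash
  have hcoll : ∀ A, ∑ y, (P A y).toReal ^ 2 = (Fintype.card Ω : ℝ)⁻¹ ^ 2 *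
      ∑ ω, ∑ ω', if (v ω - v ω') ᵥ* A = 0 then (1 : ℝ) else 0 := by
    intro A
    have h1 : ∀ y, (P A y).toReal =
        (Fintype.card Ω : ℝ)⁻¹ * ∑ ω, if v ω ᵥ* A = y then (1 : ℝ) else 0 := by
      intro y
      simp only [P, PMF.map, PMF.bind_apply_toReal, PMF.uniform_toReal, Finset.mul_sum,
        Function.comp, PMF.pure_apply]
      refine Finset.sum_congr rfl fun ω _ => ?_
      by_cases h : v ω ᵥ* A = y
      · simp [h]
      · simp [h, Ne.symm h]
    simp only [h1, mul_pow, ← Finset.mul_sum]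
    congr 1
    simp only [pow_two, Finset.sum_mul_sum]
    rw [Finset.sum_comm]
    refine Finset.sum_congr rfl fun ω _ => ?_
    rw [Finset.sum_comm]
    refine Finset.sum_congr rfl fun ω' _ => ?_
    simp only [mul_ite, mul_one, mul_zero]
    rw [Finset.sum_eq_single (v ω' ᵥ* A)]
    · simp [Matrix.sub_vecMul, sub_eq_zero]
    · intro y _ hy
      simp [Ne.symm hy]
    · simp
  have hpair : ∀ ω ω', U.expect (fun A => if (v ω - v ω') ᵥ* A = 0 then (1 : ℝ) else 0) ≤
      (Fintype.card (Fin n → Zq ℓ) : ℝ)⁻¹ + if ω = ω' then 1 else 0 := by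
    intro ω ω'
    by_cases h : ω = ω'
    · subst h
      simp only [sub_self, Matrix.zero_vecMul, if_true, PMF.expect_const]
      linarith [inv_pos.mpr hQ]
    · obtain ⟨i, hi⟩ := hv ω ω' h
      rw [if_neg h, add_zero, PMF.expect_uniform, Finset.sum_boole]
      have := card_vecMul_eq_zero (n := n) (v ω - v ω') (i := i) hi
      rw [← this]
      push_cast
      rw [mul_inv, mul_right_comm]
      by_cases h0 : ((Finset.univ.filter fun A : Matrix (Fin k) (Fin n) (Zq ℓ) =>
        (v ω - v ω') ᵥ* A = 0).card : ℝ) = 0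
      · rw [h0]; simp
      · rw [inv_mul_cancel₀ h0]
        simp
  have hexp : (U.expect fun A => ∑ y, (P A y).toReal ^ 2) ≤
      (Fintype.card (Fin n → Zq ℓ) : ℝ)⁻¹ + (Fintype.card Ω : ℝ)⁻¹ := by
    simp only [hcoll]
    have h1 : (U.expect fun A => (Fintype.card Ω : ℝ)⁻¹ ^ 2 *
        ∑ ω, ∑ ω', if (v ω - v ω') ᵥ* A = 0 then (1 : ℝ) else 0) = (Fintype.card Ω : ℝ)⁻¹ ^ 2 *
        ∑ ω, ∑ ω', U.expect fun A => if (v ω - v ω') ᵥ* A = 0 then (1 : ℝ) else 0 := by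
      simp only [PMF.expect_fintype]
      simp only [Finset.mul_sum]
      rw [Finset.sum_comm]
      refine Finset.sum_congr rfl fun ω _ => ?_
      rw [Finset.sum_comm]
      exact Finset.sum_congr rfl fun ω' _ => Finset.sum_congr rfl fun A _ => by ring
    rw [h1]
    calc _ ≤ (Fintype.card Ω : ℝ)⁻¹ ^ 2 * ∑ ω : Ω, ∑ ω' : Ω,
          ((Fintype.card (Fin n → Zq ℓ) : ℝ)⁻¹ + if ω = ω' then 1 else 0) :=
          mul_le_mul_of_nonneg_left (Finset.sum_le_sum fun ω _ => Finset.sum_le_sum fun ω' _ =>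
            hpair ω ω') (by positivity)
      _ = _ := by
          simp only [Finset.sum_add_distrib, Finset.sum_const, Finset.card_univ, nsmul_eq_mul,
            Finset.sum_ite_eq, Finset.mem_univ, if_true]
          field_simp
  have hnn : ∀ A, 0 ≤ (Fintype.card (Fin n → Zq ℓ) : ℝ) * ∑ y, (P A y).toReal ^ 2 - 1 := by
    intro A
    have := sq_sum_le_card_mul_sum_sq (s := Finset.univ) (f := fun y => (P A y).toReal)
    rw [(P A).sum_toReal, Finset.card_univ] at this
    linarith
  refine (U.expect_mono fun A => tvDist_uniform_le_sqrt (P A)).trans ?_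
  have h2 : (U.expect fun A => 1 / 2 * √((Fintype.card (Fin n → Zq ℓ) : ℝ) *
      ∑ y, (P A y).toReal ^ 2 - 1)) = 1 / 2 * U.expect fun A =>
        √((Fintype.card (Fin n → Zq ℓ) : ℝ) * ∑ y, (P A y).toReal ^ 2 - 1) := by
    simp only [PMF.expect_fintype, Finset.mul_sum]
    exact Finset.sum_congr rfl fun _ _ => by ring
  rw [h2]
  refine mul_le_mul_of_nonneg_left ((U.expect_sqrt_le _ hnn).trans (Real.sqrt_le_sqrt ?_))
    (by norm_num)
  rw [PMF.expect_sub, PMF.expect_const]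
  have h3 : (U.expect fun A => (Fintype.card (Fin n → Zq ℓ) : ℝ) * ∑ y, (P A y).toReal ^ 2) =
      Fintype.card (Fin n → Zq ℓ) * U.expect fun A => ∑ y, (P A y).toReal ^ 2 := by
    simp only [PMF.expect_fintype, Finset.mul_sum]
    exact Finset.sum_congr rfl fun _ _ => Finset.sum_congr rfl fun _ _ => by ring
  rw [h3, ← hcard]
  have h4 := mul_le_mul_of_nonneg_left hexp hQ.le
  rw [mul_add, mul_inv_cancel₀ hQ.ne'] at h4
  rw [div_eq_mul_inv]
  linarith

/-- The average distance between a row of `R A` and the uniform distribution, where `R` is a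
trapdoor. -/
theorem leftover_hash_trapdoor :
    ((PMF.uniformOfFintype (Matrix (Fin k) (Fin n) (Zq ℓ))).expect fun A =>
      tvDist ((piPMF fun _ : Fin k => Dual.trapdoorEntry).map fun r =>
        (fun i => ((r i : SignType) : Zq ℓ)) ᵥ* A) (PMF.uniformOfFintype _)) ≤
      1 / 2 * √(2 ^ (n * ℓ) / 2 ^ k) := by
  -- For fixed signs the row is determined by uniform bits, which say where it is nonzero.
  let sg : (Fin k → Bool) → (Fin k → Bool) → Fin k → SignType := fun σ b i =>
    if b i then (if σ i then 1 else -1) else 0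
  have hentry : Dual.trapdoorEntry = (PMF.uniformOfFintype Bool).bind fun σ =>
      (PMF.uniformOfFintype Bool).map fun b =>
        if b then (if σ then (1 : SignType) else -1) else 0 := by
    rw [Dual.trapdoorEntry, uniform_prod, PMF.map_bind]
    simp only [PMF.map_comp]
    exact PMF.bind_comm _ _ fun b σ : Bool =>
      PMF.pure (if b then (if σ then (1 : SignType) else -1) else 0)
  have hrow : (piPMF fun _ : Fin k => Dual.trapdoorEntry) =
      (PMF.uniformOfFintype (Fin k → Bool)).bind fun σ =>
        (PMF.uniformOfFintype (Fin k → Bool)).map (sg σ) := by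
    simp only [hentry, uniform_pi]
    rw [piPMF_bind]
    simp only [piPMF_map]
    rfl
  have hσ : ∀ σ : Fin k → Bool, ((PMF.uniformOfFintype (Matrix (Fin k) (Fin n) (Zq ℓ))).expect
      fun A => tvDist ((PMF.uniformOfFintype (Fin k → Bool)).map fun b =>
        (fun i => ((sg σ b i : SignType) : Zq ℓ)) ᵥ* A) (PMF.uniformOfFintype _)) ≤
      1 / 2 * √(2 ^ (n * ℓ) / 2 ^ k) := by
    intro σ
    have h := leftover_hash (n := n) (k := k) (ℓ := ℓ)
      (fun (b : Fin k → Bool) i => ((sg σ b i : SignType) : Zq ℓ)) fun b b' hb => by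
        obtain ⟨i, hi⟩ := Function.ne_iff.mp hb
        refine ⟨i, ?_⟩
        simp only [sg]
        cases h1 : b i <;> cases h2 : b' i <;> cases σ i <;> simp_all
    simpa using h
  simp only [hrow, PMF.map_bind, PMF.map_comp, Function.comp_def]
  have hbound : ∀ A : Matrix (Fin k) (Fin n) (Zq ℓ),
      tvDist ((PMF.uniformOfFintype (Fin k → Bool)).bind fun σ =>
        (PMF.uniformOfFintype (Fin k → Bool)).map fun b =>
          (fun i => ((sg σ b i : SignType) : Zq ℓ)) ᵥ* A) (PMF.uniformOfFintype _) ≤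
      (PMF.uniformOfFintype (Fin k → Bool)).expect fun σ =>
        tvDist ((PMF.uniformOfFintype (Fin k → Bool)).map fun b =>
          (fun i => ((sg σ b i : SignType) : Zq ℓ)) ᵥ* A) (PMF.uniformOfFintype _) := by
    intro A
    have := tvDist_bind_right_le (PMF.uniformOfFintype (Fin k → Bool))
      (fun σ => (PMF.uniformOfFintype (Fin k → Bool)).map fun b =>
          (fun i => ((sg σ b i : SignType) : Zq ℓ)) ᵥ* A)
      fun _ => PMF.uniformOfFintype (Fin n → Zq ℓ)
    rw [PMF.bind_const] at this
    rw [PMF.expect_fintype]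
    exact this
  refine (PMF.expect_mono _ hbound).trans ?_
  rw [PMF.expect_comm]
  refine (PMF.expect_mono _ hσ).trans ?_
  rw [PMF.expect_const]

end LHL

namespace Dual

open Matrix

variable {n m ℓ : ℕ}

/-- Stack `m - n ℓ` and `n ℓ` rows. -/
def stackRows (hm : n * ℓ ≤ m) :
    Matrix (Fin (m - n * ℓ)) (Fin n) (Zq ℓ) × (Fin (n * ℓ) → Fin n → Zq ℓ) ≃
      Matrix (Fin m) (Fin n) (Zq ℓ) where
  toFun x := Matrix.of fun i a => if h : (i : ℕ) < m - n * ℓ then x.1 ⟨i, h⟩ a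
    else x.2 ⟨i - (m - n * ℓ), by omega⟩ a
  invFun A := (Matrix.of fun i a => A ⟨i, by omega⟩ a,
    fun i a => A ⟨i + (m - n * ℓ), by omega⟩ a)
  left_inv x := by
    refine Prod.ext ?_ ?_
    · ext i a
      simp
    · funext i a
      simp
  right_inv A := by
    ext i a
    by_cases h : (i : ℕ) < m - n * ℓ
    · simp [h]
    · simp only [Matrix.of_apply, h, dite_false]
      congr 1
      exact Fin.ext (by simp; omega)

theorem tvDist_genTrap (hm : n * ℓ ≤ m) :
    tvDist ((genTrap n m ℓ).map Prod.fst) (PMF.uniformOfFintype _) ≤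
      (n * ℓ : ℕ) * (1 / 2 * √(2 ^ (n * ℓ) / 2 ^ (m - n * ℓ))) := by
  have h1 : (genTrap n m ℓ).map Prod.fst =
      ((PMF.uniformOfFintype (Matrix (Fin (m - n * ℓ)) (Fin n) (Zq ℓ))).bind fun A =>
        (piPMF fun r : Fin (n * ℓ) => (piPMF fun _ : Fin (m - n * ℓ) => trapdoorEntry).map
          fun x : Fin (m - n * ℓ) → SignType =>
          (fun a => if (finProdFinEquiv.symm r).1 = a then (2 : Zq ℓ) ^
            ((finProdFinEquiv.symm r).2 : ℕ) else 0) -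
            (fun i => ((x i : SignType) : Zq ℓ)) ᵥ* A).map fun T => (A, T)).map
        (stackRows hm) := by
    rw [genTrap]
    simp only [PMF.monad_bind, PMF.map_bind, PMF.monad_pure, PMF.pure_map, PMF.map_comp,
      piPMF_map, Function.comp_def]
    rfl
  have h2 : PMF.uniformOfFintype (Matrix (Fin m) (Fin n) (Zq ℓ)) =
      ((PMF.uniformOfFintype (Matrix (Fin (m - n * ℓ)) (Fin n) (Zq ℓ))).bind fun A =>
        (piPMF fun _ : Fin (n * ℓ) => PMF.uniformOfFintype (Fin n → Zq ℓ)).map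
          fun T => (A, T)).map (stackRows hm) := by
    rw [← uniform_pi, ← uniform_prod, uniform_map_equiv]
  rw [h1, h2]
  refine (tvDist_map_le _ _ _).trans ((tvDist_bind_right_le _ _ _).trans ?_)
  have h3 : ∀ A : Matrix (Fin (m - n * ℓ)) (Fin n) (Zq ℓ),
      tvDist ((piPMF fun r : Fin (n * ℓ) => (piPMF fun _ : Fin (m - n * ℓ) => trapdoorEntry).map
          fun x : Fin (m - n * ℓ) → SignType =>
          (fun a => if (finProdFinEquiv.symm r).1 = a then (2 : Zq ℓ) ^
            ((finProdFinEquiv.symm r).2 : ℕ) else 0) -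
            (fun i => ((x i : SignType) : Zq ℓ)) ᵥ* A).map fun T => (A, T))
        ((piPMF fun _ : Fin (n * ℓ) => PMF.uniformOfFintype (Fin n → Zq ℓ)).map
          fun T => (A, T)) ≤ (n * ℓ : ℕ) *
        tvDist ((piPMF fun _ : Fin (m - n * ℓ) => trapdoorEntry).map fun r =>
          (fun i => ((r i : SignType) : Zq ℓ)) ᵥ* A) (PMF.uniformOfFintype _) := by
    intro A
    refine (tvDist_map_le _ _ _).trans ?_
    have := tvDist_piPMF_const_le (ι := Fin (n * ℓ))
      (fun r => (piPMF fun _ : Fin (m - n * ℓ) => trapdoorEntry).map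
          fun x : Fin (m - n * ℓ) → SignType =>
          (fun a => if (finProdFinEquiv.symm r).1 = a then (2 : Zq ℓ) ^
            ((finProdFinEquiv.symm r).2 : ℕ) else 0) -
            (fun i => ((x i : SignType) : Zq ℓ)) ᵥ* A)
      (fun _ => PMF.uniformOfFintype (Fin n → Zq ℓ))
      (ε := tvDist ((piPMF fun _ : Fin (m - n * ℓ) => trapdoorEntry).map fun r =>
          (fun i => ((r i : SignType) : Zq ℓ)) ᵥ* A) (PMF.uniformOfFintype _)) fun r => by
        refine le_trans (le_of_eq ?_) (tvDist_map_le _ _ (Equiv.subLeft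
          (fun a => if (finProdFinEquiv.symm r).1 = a then
          (2 : Zq ℓ) ^ ((finProdFinEquiv.symm r).2 : ℕ) else 0 : Fin n → Zq ℓ)))
        rw [PMF.map_comp, uniform_map_equiv]
        rfl
    rwa [Fintype.card_fin] at this
  calc _ ≤ ∑ A, (PMF.uniformOfFintype (Matrix (Fin (m - n * ℓ)) (Fin n) (Zq ℓ)) A).toReal *
        ((n * ℓ : ℕ) * tvDist ((piPMF fun _ : Fin (m - n * ℓ) => trapdoorEntry).map fun r =>
          (fun i => ((r i : SignType) : Zq ℓ)) ᵥ* A) (PMF.uniformOfFintype _)) :=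
        Finset.sum_le_sum fun A _ => mul_le_mul_of_nonneg_left (h3 A) ENNReal.toReal_nonneg
    _ = (n * ℓ : ℕ) * (PMF.uniformOfFintype (Matrix (Fin (m - n * ℓ)) (Fin n) (Zq ℓ))).expect
        fun A => tvDist ((piPMF fun _ : Fin (m - n * ℓ) => trapdoorEntry).map fun r =>
          (fun i => ((r i : SignType) : Zq ℓ)) ᵥ* A) (PMF.uniformOfFintype _) := by
        rw [PMF.expect_fintype, Finset.mul_sum]
        exact Finset.sum_congr rfl fun A _ => by ring
    _ ≤ _ := mul_le_mul_of_nonneg_left leftover_hash_trapdoor (Nat.cast_nonneg _)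

/-- Append a last row. -/
def snocRow (n m ℓ : ℕ) :
    Matrix (Fin m) (Fin n) (Zq ℓ) × (Fin n → Zq ℓ) ≃ PK n m ℓ :=
  (Equiv.prodComm _ _).trans (Fin.snocEquiv fun _ : Fin (m + 1) => Fin n → Zq ℓ)

/-- The public key alone. -/
noncomputable def pkDist (n m ℓ : ℕ) : PMF (PK n m ℓ) := (keyGen n m ℓ).map fun K => K.1

theorem tvDist_pkDist (hm : n * ℓ ≤ m) :
    tvDist (pkDist n m ℓ) (PMF.uniformOfFintype _) ≤
      (n * ℓ : ℕ) * (1 / 2 * √(2 ^ (n * ℓ) / 2 ^ (m - n * ℓ))) +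
        1 / 2 * √(2 ^ (n * ℓ) / 2 ^ m) := by
  let K : Matrix (Fin m) (Fin n) (Zq ℓ) → PMF (PK n m ℓ) := fun A =>
    ((PMF.uniformOfFintype (SK m)).map fun e => skBits ℓ e ᵥ* A).map fun y => snocRow n m ℓ (A, y)
  have h1 : pkDist n m ℓ = ((genTrap n m ℓ).map Prod.fst).bind K := by
    rw [pkDist, keyGen]
    simp only [PMF.monad_bind, PMF.map_bind, PMF.monad_pure, PMF.pure_map, PMF.bind_map, K,
      PMF.map_comp]
    rw [PMF.bind_comm]
    simp only [PMF.map, Function.comp_def, publicKey, Matrix.mulVec_transpose]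
    rfl
  have h2 : PMF.uniformOfFintype (PK n m ℓ) =
      (PMF.uniformOfFintype (Matrix (Fin m) (Fin n) (Zq ℓ))).bind fun A =>
        (PMF.uniformOfFintype (Fin n → Zq ℓ)).map fun y => snocRow n m ℓ (A, y) := by
    rw [← uniform_map_equiv (snocRow n m ℓ), uniform_prod, PMF.map_bind]
    simp only [PMF.map_comp]
    rfl
  refine (tvDist_triangle _ ((PMF.uniformOfFintype _).bind K) _).trans (add_le_add ?_ ?_)
  · rw [h1]
    exact (tvDist_bind_le _ _ _).trans (tvDist_genTrap hm)
  · rw [h2]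
    refine (tvDist_bind_right_le _ _ _).trans ?_
    have h3 := leftover_hash (n := n) (k := m) (ℓ := ℓ) (fun e : SK m => skBits ℓ e)
      fun e e' he => by
        obtain ⟨i, hi⟩ := Function.ne_iff.mp he
        refine ⟨i, ?_⟩
        simp only [skBits]
        cases h1 : e i <;> cases h2 : e' i <;> simp_all
    rw [PMF.expect_fintype] at h3
    refine (Finset.sum_le_sum fun A _ => mul_le_mul_of_nonneg_left (tvDist_map_le _ _ _)
      ENNReal.toReal_nonneg).trans (h3.trans (le_of_eq ?_))
    simp

/-- With `m ≥ 4 n ℓ`, the public key is within `(n ℓ + 1) 2^{-n ℓ}` of uniform. -/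
theorem tvDist_pkDist_le (hm : 4 * (n * ℓ) ≤ m) :
    tvDist (pkDist n m ℓ) (PMF.uniformOfFintype _) ≤
      ((n * ℓ + 1 : ℕ) : ℝ) * (1 / 2) ^ (n * ℓ) := by
  have hs : ∀ k, 3 * (n * ℓ) ≤ k → √((2 : ℝ) ^ (n * ℓ) / 2 ^ k) ≤ (1 / 2) ^ (n * ℓ) := by
    intro k hk
    rw [Real.sqrt_le_left (by positivity), div_le_iff₀ (by positivity), div_pow, one_pow, div_pow,
      one_pow, div_mul_eq_mul_div, one_mul, le_div_iff₀ (by positivity), ← pow_mul, ← pow_add]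
    exact pow_le_pow_right₀ (by norm_num) (by omega)
  refine (tvDist_pkDist (by omega)).trans ?_
  have h1 := hs (m - n * ℓ) (by omega)
  have h2 := hs m (by omega)
  have h3 : (0 : ℝ) ≤ (1 / 2) ^ (n * ℓ) := by positivity
  have h4 : ((n * ℓ : ℕ) : ℝ) * (1 / 2 * √(2 ^ (n * ℓ) / 2 ^ (m - n * ℓ))) ≤
      (n * ℓ : ℕ) * (1 / 2) ^ (n * ℓ) :=
    mul_le_mul_of_nonneg_left (by linarith) (Nat.cast_nonneg _)
  push_cast at h4 ⊢
  linarith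

end Dual

/-! ### Security from LWE -/

namespace DualHE

open Matrix

variable {n m ℓ : ℕ}

/-- One column `A s + e` of a ciphertext. -/
noncomputable def colDist (χ : PMF (Zq ℓ)) (A : Dual.PK n m ℓ) : PMF (Fin (m + 1) → Zq ℓ) :=
  (PMF.uniformOfFintype (Fin n → Zq ℓ)).bind fun s =>
    (piPMF fun _ : Fin (m + 1) => χ).map fun e => A *ᵥ s + e

theorem uniform_transpose {ι κ α : Type} [Fintype ι] [DecidableEq ι] [Fintype κ] [DecidableEq κ]
    [Fintype α] [Inhabited α] :
    (PMF.uniformOfFintype (Matrix ι κ α)).map Matrix.transpose =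
      PMF.uniformOfFintype (Matrix κ ι α) :=
  uniform_map_equiv ⟨Matrix.transpose, Matrix.transpose, fun _ => rfl, fun _ => rfl⟩

/-- The randomness of one column in the hybrids: a secret, an error and a uniform column. -/
noncomputable def colCoins (n m : ℕ) (χ : PMF (Zq ℓ)) :
    PMF (((Fin n → Zq ℓ) × (Fin (m + 1) → Zq ℓ)) × (Fin (m + 1) → Zq ℓ)) :=
  ((PMF.uniformOfFintype (Fin n → Zq ℓ)).bind fun s =>
    (piPMF fun _ : Fin (m + 1) => χ).map fun e => (s, e)).bind fun x =>
      (PMF.uniformOfFintype (Fin (m + 1) → Zq ℓ)).map fun u => (x, u)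

/-- The column made from its coins in the hybrid where columns satisfying `c` are uniform. -/
def colOf (c : Prop) [Decidable c] (A : Dual.PK n m ℓ)
    (ω : ((Fin n → Zq ℓ) × (Fin (m + 1) → Zq ℓ)) × (Fin (m + 1) → Zq ℓ)) : Fin (m + 1) → Zq ℓ :=
  if c then ω.2 else A *ᵥ ω.1.1 + ω.1.2

theorem colCoins_map (c : Prop) [Decidable c] (χ : PMF (Zq ℓ)) (A : Dual.PK n m ℓ) :
    (colCoins n m χ).map (colOf c A) =
      if c then PMF.uniformOfFintype _ else colDist χ A := by
  unfold colOf colCoins colDist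
  split_ifs
  · simp only [PMF.map_bind, PMF.map_comp, Function.comp_def]
    rw [PMF.bind_const]
    exact PMF.map_id _
  · simp only [PMF.map_bind, PMF.map_comp, Function.comp_def, PMF.bind_bind, PMF.bind_map]
    simp only [PMF.map, Function.comp_def, PMF.bind_const]

/-- `M` columns for a uniform matrix; the first `t` columns are uniform, the others are honest. -/
noncomputable def colHybrid (n m ℓ M : ℕ) (χ : PMF (Zq ℓ)) (t : ℕ) :
    PMF (Dual.PK n m ℓ × (Fin M → Fin (m + 1) → Zq ℓ)) :=
  (PMF.uniformOfFintype (Dual.PK n m ℓ)).bind fun A =>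
    (piPMF fun j : Fin M => if (j : ℕ) < t then PMF.uniformOfFintype _ else colDist χ A).map
      fun f => (A, f)

/-- The reduction for one step of the column hybrid. -/
def colReduction {M : ℕ} (t : Fin M)
    (x : Matrix (Fin n) (Fin (m + 1)) (Zq ℓ) × (Fin (m + 1) → Zq ℓ))
    (ω : Fin M → ((Fin n → Zq ℓ) × (Fin (m + 1) → Zq ℓ)) × (Fin (m + 1) → Zq ℓ)) :
    Dual.PK n m ℓ × (Fin M → Fin (m + 1) → Zq ℓ) :=
  (x.1ᵀ, Function.update (fun j => colOf ((j : ℕ) < (t : ℕ)) x.1ᵀ (ω j)) t x.2)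

theorem piPMF_colCoins {M : ℕ} (χ : PMF (Zq ℓ)) (A : Dual.PK n m ℓ) (t : ℕ) :
    (piPMF fun j : Fin M => if (j : ℕ) < t then PMF.uniformOfFintype _ else colDist χ A) =
      (piPMF fun _ : Fin M => colCoins n m χ).map fun ω (j : Fin M) =>
        colOf ((j : ℕ) < t) A (ω j) := by
  simp only [← colCoins_map, piPMF_map]

theorem colHybrid_eq_lweSample {M : ℕ} (χ : PMF (Zq ℓ)) (t : Fin M) :
    colHybrid n m ℓ M χ t = (lweSample n (m + 1) ℓ χ).bind fun x =>
      (piPMF fun _ : Fin M => colCoins n m χ).map (colReduction t x) := by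
  unfold colHybrid lweSample
  rw [← uniform_transpose (ι := Fin n) (κ := Fin (m + 1)), PMF.bind_map]
  simp only [PMF.monad_bind, PMF.monad_pure, PMF.bind_bind, PMF.pure_bind]
  refine congrArg _ (funext fun A => ?_)
  simp only [Function.comp_def]
  rw [piPMF_split t _ _ fun _ _ => rfl]
  simp only [lt_irrefl, if_false, piPMF_colCoins]
  simp only [colDist, PMF.map_bind, PMF.map_comp, PMF.bind_map, Function.comp_def]
  rw [PMF.bind_comm]
  refine congrArg _ (funext fun s => ?_)
  refine (PMF.bind_comm _ _ _).trans ?_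
  refine congrArg _ (funext fun e => ?_)
  simp only [← Matrix.mulVec_transpose]
  rfl

theorem colHybrid_succ_eq_lweUniform {M : ℕ} (χ : PMF (Zq ℓ)) (t : Fin M) :
    colHybrid n m ℓ M χ (t + 1) = (lweUniform n (m + 1) ℓ).bind fun x =>
      (piPMF fun _ : Fin M => colCoins n m χ).map (colReduction t x) := by
  unfold colHybrid lweUniform
  rw [← uniform_transpose (ι := Fin n) (κ := Fin (m + 1)), PMF.bind_map]
  rw [uniform_prod, PMF.bind_bind]
  refine congrArg _ (funext fun A => ?_)
  simp only [Function.comp_def]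
  rw [piPMF_split t _ (fun j : Fin M => if (j : ℕ) < (t : ℕ) then PMF.uniformOfFintype _ else
    colDist χ _) fun i hi => by
      have : (i : ℕ) ≠ t := fun e => hi (Fin.ext e)
      congr 1
      exact propext (by omega)]
  rw [if_pos (Nat.lt_succ_self _), piPMF_colCoins]
  simp only [PMF.map_bind, PMF.map_comp, PMF.bind_map, Function.comp_def]
  exact PMF.bind_comm _ _ _

/-- The size of the reduction for one step of the column hybrid. -/
def colCost (n m ℓ M : ℕ) : ℕ :=
  M * ((m + 1) * (n * (40 * ℓ * ℓ + 32 * ℓ) + 32 * ℓ))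

theorem computes_matrix_entry {X α : Type} {B : Set (X → Bool)} {a k l : ℕ} [BitCode α]
    {F : X → Matrix (Fin k) (Fin l) α} (h : Computes B a (wires F)) (i : Fin k) (j : Fin l) :
    Computes B a (wires fun x => F x i j) :=
  (h.row i).proj j

theorem computes_colReduction {M : ℕ} (t : Fin M)
    (ω : Fin M → ((Fin n → Zq ℓ) × (Fin (m + 1) → Zq ℓ)) × (Fin (m + 1) → Zq ℓ)) :
    Computes (wires fun x : Matrix (Fin n) (Fin (m + 1)) (Zq ℓ) × (Fin (m + 1) → Zq ℓ) => x)
      (colCost n m ℓ M) (wires fun x => colReduction t x ω) := by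
  have hA : ∀ i a, Computes
      (wires fun x : Matrix (Fin n) (Fin (m + 1)) (Zq ℓ) × (Fin (m + 1) → Zq ℓ) => x) 0
      (wires fun x => x.1ᵀ i a) := fun i a =>
    ((Computes.wires_self _).fst.row a).proj i
  have h1 : Computes
      (wires fun x : Matrix (Fin n) (Fin (m + 1)) (Zq ℓ) × (Fin (m + 1) → Zq ℓ) => x) 0
      (wires fun x => (x.1ᵀ : Dual.PK n m ℓ)) := by
    have := Computes.matrix fun i => Computes.pi fun a => hA i a
    simpa using this
  refine (h1.prod (Computes.pi (a := (m + 1) * (n * (40 * ℓ * ℓ + 32 * ℓ) + 32 * ℓ))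
    fun j => ?_)).mono_size (by rw [colCost]; omega)
  by_cases hj : j = t
  · subst hj
    simp only [Function.update_self]
    exact (Computes.wires_self _).snd.mono_size (Nat.zero_le _)
  · simp only [Function.update_of_ne hj, colOf]
    split_ifs
    · exact Computes.wires_const _
    · refine Computes.pi fun i => ?_
      have h2 := (Computes.sum (Finset.univ : Finset (Fin n)) fun a _ =>
        (hA i a).mul (Computes.wires_const (s := 0) ((ω j).1.1 a))).add
          (Computes.wires_const (s := 0) ((ω j).1.2 i))
      refine (h2.congr fun x => ?_).mono_size ?_
      · simp [Matrix.mulVec, dotProduct]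
      · simp

section Asymptotic

variable {n m ℓ M : ℕ → ℕ}

theorem compIndist_columns {χ : ∀ lam, PMF (Zq (ℓ lam))} (hlwe : LWEHard n ℓ χ)
    (hmr : ∃ r : Polynomial ℕ, ∀ lam, m lam ≤ r.eval (n lam * ℓ lam))
    (hn : PolyBd id n) (hm : PolyBd id m) (hl : PolyBd id ℓ) (hM : PolyBd id M)
    (hMpos : ∀ lam, 0 < M lam) :
    CompIndist (fun lam => colHybrid (n lam) (m lam) (ℓ lam) (M lam) (χ lam) 0)
      (fun lam => colHybrid (n lam) (m lam) (ℓ lam) (M lam) (χ lam) (M lam)) := by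
  refine CompIndist.hybrid (fun lam t => colHybrid (n lam) (m lam) (ℓ lam) (M lam) (χ lam) t)
    hM hMpos fun t ht => ?_
  have h1 := fun lam => colHybrid_eq_lweSample (n := n lam) (m := m lam) (χ lam) ⟨t lam, ht lam⟩
  have h2 := fun lam =>
    colHybrid_succ_eq_lweUniform (n := n lam) (m := m lam) (χ lam) ⟨t lam, ht lam⟩
  simp only at h1 h2
  simp only [h1, h2]
  obtain ⟨r, hr⟩ := hmr
  have hm1 : PolyBd id fun lam => m lam + 1 := hm.add (.const 1)
  refine CompIndist.bind_map (hlwe (fun lam => m lam + 1) ⟨r + 1, fun lam => by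
      simpa using hr lam⟩) _ (fun lam => colReduction ⟨t lam, ht lam⟩)
    (s := fun lam => colCost (n lam) (m lam) (ℓ lam) (M lam)) ?_ ?_ ?_
    fun lam ω => computes_colReduction _ ω
  · exact hM.mul (hm1.mul ((hn.mul ((((PolyBd.const 40).mul hl).mul hl).add
      ((PolyBd.const 32).mul hl))).add ((PolyBd.const 32).mul hl)))
  · exact (hn.mul (hm1.mul hl)).add (hm1.mul hl)
  · exact (hm1.mul (hn.mul hl)).add (hM.mul (hm1.mul hl))

end Asymptotic

/-! ### Blocks: a public key together with `m` ciphertexts -/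

/-- A public key and `m` ciphertexts. -/
abbrev Block (n m ℓ : ℕ) : Type := Dual.PK n m ℓ × (Fin m → CT m ℓ)

/-- Group columns into ciphertexts. -/
def groupColumns {M : ℕ} (e : Fin m × (Fin (m + 1) × Fin ℓ) ≃ Fin M)
    (x : Dual.PK n m ℓ × (Fin M → Fin (m + 1) → Zq ℓ)) : Block n m ℓ :=
  (x.1, fun a => Matrix.of fun i j => x.2 (e (a, j)) i)

theorem groupColumns_bijective {M : ℕ} (e : Fin m × (Fin (m + 1) × Fin ℓ) ≃ Fin M) :
    Function.Bijective (groupColumns (n := n) e) := by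
  constructor
  · rintro ⟨A, f⟩ ⟨A', f'⟩ h
    simp only [groupColumns, Prod.mk.injEq] at h
    refine Prod.ext h.1 ?_
    funext j i
    have := congrFun (congrFun (congrFun h.2 (e.symm j).1) i) (e.symm j).2
    simpa using this
  · rintro ⟨A, C⟩
    refine ⟨(A, fun j i => C (e.symm j).1 i (e.symm j).2), ?_⟩
    simp only [groupColumns, Equiv.symm_apply_apply]
    rfl

theorem enc_false (β : ℕ) (pk : Dual.PK n m ℓ) :
    enc β pk false = (piPMF fun _ : Fin (m + 1) × Fin ℓ => colDist (gaussian ℓ β) pk).map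
      fun X => Matrix.of fun i j => X j i := by
  unfold enc colDist
  rw [piPMF_bind, PMF.map_bind, ← uniform_pi]
  have hS : PMF.uniformOfFintype (Matrix (Fin n) (Fin (m + 1) × Fin ℓ) (Zq ℓ)) =
      (PMF.uniformOfFintype (Fin (m + 1) × Fin ℓ → Fin n → Zq ℓ)).map
        fun f => Matrix.of fun i j => f j i :=
    (uniform_map_equiv (⟨fun f => Matrix.of fun i j => f j i, fun A j i => A i j, fun _ => rfl,
      fun _ => rfl⟩ : (Fin (m + 1) × Fin ℓ → Fin n → Zq ℓ) ≃ _)).symm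
  rw [hS]
  simp only [PMF.monad_bind, PMF.monad_pure]
  rw [PMF.bind_map]
  congr 1
  funext S
  simp only [piPMF_map, Function.comp_def]
  rw [piPMF_swap, PMF.map_comp, PMF.bind_map]
  simp only [PMF.map, Function.comp_def]
  congr 1
  funext E
  congr 1
  ext i j
  simp only [Bool.false_eq_true, if_false, add_zero]
  rfl

theorem enc_eq_map (β : ℕ) (pk : Dual.PK n m ℓ) (μ : Bool) :
    enc β pk μ = (enc β pk false).map fun C => C + if μ then G m ℓ else 0 := by
  unfold enc
  simp only [PMF.monad_bind, PMF.monad_pure, PMF.map_bind, PMF.pure_map]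
  simp

/-- A key and encryptions of the bits `msg` under it. -/
noncomputable def encBlock (β : ℕ) (pk : Dual.PK n m ℓ) (msg : Fin m → Bool) : PMF (Block n m ℓ) :=
  (piPMF fun j => enc β pk (msg j)).map fun c => (pk, c)

/-- Add messages to encryptions of zero. -/
def addMsg (msg : Fin m → Bool) (x : Block n m ℓ) : Block n m ℓ :=
  (x.1, fun j => x.2 j + if msg j then G m ℓ else 0)

theorem encBlock_eq_map (β : ℕ) (pk : Dual.PK n m ℓ) (msg : Fin m → Bool) :
    encBlock β pk msg = (encBlock β pk fun _ => false).map (addMsg msg) := by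
  unfold encBlock
  simp only [enc_eq_map β pk (msg _)]
  rw [piPMF_map, PMF.map_comp, PMF.map_comp]
  rfl

theorem uniform_map_addMsg (msg : Fin m → Bool) :
    (PMF.uniformOfFintype (Block n m ℓ)).map (addMsg msg) = PMF.uniformOfFintype _ :=
  uniform_map_equiv ((Equiv.refl _).prodCongr
    (Equiv.addRight fun j => if msg j then G m ℓ else 0))

theorem colHybrid_zero_map {M : ℕ} (e : Fin m × (Fin (m + 1) × Fin ℓ) ≃ Fin M) (β : ℕ) :
    (colHybrid n m ℓ M (gaussian ℓ β) 0).map (groupColumns e) =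
      (PMF.uniformOfFintype (Dual.PK n m ℓ)).bind fun pk => encBlock β pk fun _ => false := by
  unfold colHybrid encBlock
  simp only [PMF.map_bind, enc_false, not_lt_zero, if_false]
  congr 1
  funext A
  rw [piPMF_map, piPMF_curry, piPMF_reindex e.symm]
  simp only [PMF.map_comp]
  rfl

theorem colHybrid_self_map {M : ℕ} (e : Fin m × (Fin (m + 1) × Fin ℓ) ≃ Fin M) (χ : PMF (Zq ℓ)) :
    (colHybrid n m ℓ M χ M).map (groupColumns e) = PMF.uniformOfFintype _ := by
  have h : colHybrid n m ℓ M χ M = PMF.uniformOfFintype _ := by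
    unfold colHybrid
    simp only [Fin.is_lt, if_true]
    rw [← uniform_pi, ← uniform_prod]
  rw [h]
  exact uniform_map_equiv (Equiv.ofBijective _ (groupColumns_bijective e))

section Asymptotic

variable {n m ℓ β : ℕ → ℕ}

/-- Under LWE, the public key together with `m` encryptions of zero looks uniform. -/
theorem compIndist_encBlock
    (hlwe : LWEHard n ℓ (fun lam => gaussian (ℓ lam) (β lam)))
    (hmr : ∃ r : Polynomial ℕ, ∀ lam, m lam ≤ r.eval (n lam * ℓ lam))
    (hn : PolyBd id n) (hm : PolyBd id m) (hl : PolyBd id ℓ)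
    (hpos : ∀ lam, 1 ≤ n lam ∧ 1 ≤ m lam ∧ 1 ≤ ℓ lam)
    (h4 : ∀ᶠ lam in atTop, 4 * (n lam * ℓ lam) ≤ m lam)
    (hneg : Negligible fun lam => (1 / 2 : ℝ) ^ ℓ lam) :
    CompIndist (fun lam => (Dual.pkDist (n lam) (m lam) (ℓ lam)).bind fun pk =>
        encBlock (β lam) pk fun _ => false)
      (fun lam => PMF.uniformOfFintype (Block (n lam) (m lam) (ℓ lam))) := by
  have hm1 : PolyBd id fun lam => m lam + 1 := hm.add (.const 1)
  have e : ∀ lam, Fin (m lam) × (Fin (m lam + 1) × Fin (ℓ lam)) ≃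
      Fin (m lam * ((m lam + 1) * ℓ lam)) := fun lam =>
    (Equiv.prodCongr (Equiv.refl _) finProdFinEquiv).trans finProdFinEquiv
  have hM : PolyBd id fun lam => m lam * ((m lam + 1) * ℓ lam) := hm.mul (hm1.mul hl)
  have hblock : PolyBd id fun lam => BitCode.len (Block (n lam) (m lam) (ℓ lam)) :=
    (hm1.mul (hn.mul hl)).add (hm.mul (hm1.mul (hm1.mul (hl.mul hl))))
  have h1 := (compIndist_columns hlwe hmr hn hm hl hM fun lam => by
    have := hpos lam
    exact Nat.mul_pos (by omega) (Nat.mul_pos (by omega) (by omega))).map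
    (fun lam => groupColumns (e lam)) (s := fun _ => 0) (.const 0)
    ((hm1.mul (hn.mul hl)).add (hM.mul (hm1.mul hl))) hblock fun lam => by
      have h := (Computes.wires_self fun x : Dual.PK (n lam) (m lam) (ℓ lam) ×
        (Fin (m lam * ((m lam + 1) * ℓ lam)) → Fin (m lam + 1) → Zq (ℓ lam)) => x)
      have := h.fst.prod (Computes.pi fun a : Fin (m lam) => Computes.matrix fun i =>
        Computes.pi_prod fun j => (h.snd.proj (e lam (a, j))).proj i)
      exact this.mono_size (by simp)
  simp only [colHybrid_zero_map, colHybrid_self_map] at h1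
  refine CompIndist.trans (CompIndist.of_tvDist
    (ε := fun lam => ((n lam * ℓ lam + 1 : ℕ) : ℝ) * (1 / 2) ^ ℓ lam) ?_ ?_) h1
  · exact hneg.mul_nat ((hn.mul hl).add (.const 1))
  · filter_upwards [h4] with lam hlam
    refine (tvDist_bind_le _ _ _).trans ((Dual.tvDist_pkDist_le hlam).trans ?_)
    refine mul_le_mul_of_nonneg_left ?_ (Nat.cast_nonneg _)
    exact pow_le_pow_of_le_one (by norm_num) (by norm_num)
      (Nat.le_mul_of_pos_left _ (hpos lam).1)

end Asymptotic

/-! ### The chain of keys of the leveled scheme -/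

/-- The messages encrypted under key `i`: copies of the challenge bit `b` under key `0`, and the
secret key `i` under key `i + 1`. -/
def chainMsg {L : ℕ} (b : Bool) (K : Fin (L + 1) → Dual.PK n m ℓ × Dual.SK m × Dual.Trapdoor n m ℓ)
    (i : Fin (L + 1)) : Fin m → Bool :=
  Fin.cases (motive := fun _ => Fin m → Bool) (fun _ => b) (fun i => (K i.castSucc).2.1) i

theorem chainMsg_update {L : ℕ} (b : Bool)
    (K : Fin (L + 1) → Dual.PK n m ℓ × Dual.SK m × Dual.Trapdoor n m ℓ) (i t : Fin (L + 1))
    (h : i ≤ t) (κ) : chainMsg b (Function.update K t κ) i = chainMsg b K i := by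
  revert h
  refine Fin.cases (fun _ => rfl) (fun i h => ?_) i
  simp only [chainMsg, Fin.cases_succ]
  rw [Function.update_of_ne]
  intro e
  have h1 := congrArg Fin.val e
  have h2 : (i.succ : ℕ) ≤ t := h
  simp at h1 h2
  omega

/-- The distribution of block `i` in hybrid `t`. -/
noncomputable def chainBlock {L : ℕ} (β : ℕ) (b : Bool) (t : ℕ)
    (K : Fin (L + 1) → Dual.PK n m ℓ × Dual.SK m × Dual.Trapdoor n m ℓ) (i : Fin (L + 1)) :
    PMF (Block n m ℓ) :=
  if (i : ℕ) < t then encBlock β (K i).1 (chainMsg b K i) else PMF.uniformOfFintype _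

/-- The hybrids for the chain of keys: the blocks below `t` are honest, the others uniform. -/
noncomputable def chainHybrid (n m ℓ β L : ℕ) (b : Bool) (t : ℕ) :
    PMF (Fin (L + 1) → Block n m ℓ) :=
  (piPMF fun _ : Fin (L + 1) => Dual.keyGen n m ℓ).bind fun K => piPMF (chainBlock β b t K)

/-- The auxiliary randomness for one step of the chain hybrid. -/
noncomputable def chainCoins (n m ℓ β L : ℕ) (b : Bool) (t : ℕ) :
    PMF ((Fin (L + 1) → Dual.PK n m ℓ × Dual.SK m × Dual.Trapdoor n m ℓ) ×
      (Fin (L + 1) → Block n m ℓ)) :=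
  (piPMF fun _ : Fin (L + 1) => Dual.keyGen n m ℓ).bind fun K =>
    (piPMF (chainBlock β b t K)).map fun f => (K, f)

/-- The reduction for one step of the chain hybrid. -/
def chainReduction {L : ℕ} (b : Bool) (t : Fin (L + 1)) (x : Block n m ℓ)
    (ω : (Fin (L + 1) → Dual.PK n m ℓ × Dual.SK m × Dual.Trapdoor n m ℓ) ×
      (Fin (L + 1) → Block n m ℓ)) : Fin (L + 1) → Block n m ℓ :=
  Function.update ω.2 t (addMsg (chainMsg b ω.1 t) x)

theorem chainHybrid_eq_uniform {L : ℕ} (β : ℕ) (b : Bool) (t : Fin (L + 1)) :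
    chainHybrid n m ℓ β L b t = (PMF.uniformOfFintype (Block n m ℓ)).bind fun x =>
      (chainCoins n m ℓ β L b t).map (chainReduction b t x) := by
  unfold chainHybrid chainCoins
  simp only [PMF.map_bind, PMF.map_comp]
  rw [PMF.bind_comm]
  congr 1
  funext K
  conv_lhs => rw [piPMF_split t _ _ fun _ _ => rfl]
  have h : chainBlock β b t K t =
      (PMF.uniformOfFintype (Block n m ℓ)).map (addMsg (chainMsg b K t)) := by
    rw [chainBlock, if_neg (lt_irrefl _), uniform_map_addMsg]
  simp only [h, PMF.map_comp]
  exact PMF.bind_comm _ _ _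

theorem chainHybrid_succ_eq {L : ℕ} (β : ℕ) (b : Bool) (t : Fin (L + 1)) :
    chainHybrid n m ℓ β L b (t + 1) =
      ((Dual.pkDist n m ℓ).bind fun pk => encBlock β pk fun _ => false).bind fun x =>
        (chainCoins n m ℓ β L b t).map (chainReduction b t x) := by
  unfold chainHybrid chainCoins
  simp only [PMF.map_bind, PMF.map_comp]
  rw [PMF.bind_comm]
  conv_lhs => rw [piPMF_split t _ _ fun _ _ => rfl, PMF.bind_bind]
  congr 1
  funext K
  rw [PMF.bind_map]
  have h : ∀ κ : Dual.PK n m ℓ × Dual.SK m × Dual.Trapdoor n m ℓ,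
      piPMF (chainBlock β b (t + 1) (Function.update K t κ)) =
      (piPMF (chainBlock β b t K)).bind fun f =>
        (encBlock β κ.1 (chainMsg b K t)).map (Function.update f t) := by
    intro κ
    rw [piPMF_split t _ (chainBlock β b t K) fun i hi => ?_]
    · simp only [chainBlock, Nat.lt_succ_self, if_true, Function.update_self,
        chainMsg_update b K t t le_rfl κ]
    · have hne : (i : ℕ) ≠ t := fun e => hi (Fin.ext e)
      by_cases hlt : (i : ℕ) < t
      · simp only [chainBlock, hlt, if_true, show (i : ℕ) < t + 1 by omega,
          Function.update_of_ne hi, chainMsg_update b K i t hlt.le κ]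
      · simp only [chainBlock, hlt, if_false, show ¬(i : ℕ) < t + 1 by omega]
  simp only [Function.comp_def, h, encBlock_eq_map β _ (chainMsg b K t), PMF.map_comp]
  rw [PMF.bind_comm]
  refine Eq.trans ?_ (PMF.bind_comm _ _ _)
  congr 1
  funext f
  rw [Dual.pkDist, PMF.bind_map, PMF.bind_bind]
  rfl

theorem computes_chainReduction {L : ℕ} (b : Bool) (t : Fin (L + 1))
    (ω : (Fin (L + 1) → Dual.PK n m ℓ × Dual.SK m × Dual.Trapdoor n m ℓ) ×
      (Fin (L + 1) → Block n m ℓ)) :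
    Computes (wires fun x : Block n m ℓ => x)
      ((L + 1) * (m * ((m + 1) * ((m + 1) * (ℓ * (32 * ℓ))))))
      (wires fun x => chainReduction b t x ω) := by
  refine Computes.pi fun j => ?_
  by_cases hj : j = t
  · subst hj
    simp only [chainReduction, Function.update_self]
    refine ((Computes.wires_self _).fst.prod (Computes.pi
      (a := (m + 1) * ((m + 1) * (ℓ * (32 * ℓ)))) fun k => Computes.matrix fun i =>
        Computes.pi_prod fun c => ?_)).mono_size (by simp)
    have h := ((((Computes.wires_self fun x : Block n m ℓ => x).snd.proj k).row i).proj_prod c).add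
      (Computes.wires_const (s := 0) ((if chainMsg b ω.1 j k then G m ℓ else 0 : CT m ℓ) i c))
    exact (h.mono_size (by omega)).congr fun x => rfl
  · simp only [chainReduction, Function.update_of_ne hj]
    exact Computes.wires_const _

section Asymptotic

variable {n m ℓ β L : ℕ → ℕ}

/-- Under LWE the whole chain of keys, with all ciphertexts, looks uniform. Keys are replaced from
the last one down, since the secret key `i` is used only under key `i + 1`. -/
theorem compIndist_chain
    (hlwe : LWEHard n ℓ (fun lam => gaussian (ℓ lam) (β lam)))
    (hmr : ∃ r : Polynomial ℕ, ∀ lam, m lam ≤ r.eval (n lam * ℓ lam))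
    (hn : PolyBd id n) (hm : PolyBd id m) (hl : PolyBd id ℓ) (hL : PolyBd id L)
    (hpos : ∀ lam, 1 ≤ n lam ∧ 1 ≤ m lam ∧ 1 ≤ ℓ lam)
    (h4 : ∀ᶠ lam in atTop, 4 * (n lam * ℓ lam) ≤ m lam)
    (hneg : Negligible fun lam => (1 / 2 : ℝ) ^ ℓ lam) (b : Bool) :
    CompIndist (fun lam => chainHybrid (n lam) (m lam) (ℓ lam) (β lam) (L lam) b (L lam + 1))
      (fun lam => PMF.uniformOfFintype (Fin (L lam + 1) → Block (n lam) (m lam) (ℓ lam))) := by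
  have hm1 : PolyBd id fun lam => m lam + 1 := hm.add (.const 1)
  have hL1 : PolyBd id fun lam => L lam + 1 := hL.add (.const 1)
  have hblock : PolyBd id fun lam => BitCode.len (Block (n lam) (m lam) (ℓ lam)) :=
    (hm1.mul (hn.mul hl)).add (hm.mul (hm1.mul (hm1.mul (hl.mul hl))))
  have h := CompIndist.hybrid
    (fun lam t => chainHybrid (n lam) (m lam) (ℓ lam) (β lam) (L lam) b t) hL1
    (fun lam => Nat.succ_pos _) fun t ht => by
      have h1 := fun lam => chainHybrid_eq_uniform (n := n lam) (m := m lam) (ℓ := ℓ lam)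
        (β lam) b ⟨t lam, ht lam⟩
      have h2 := fun lam => chainHybrid_succ_eq (n := n lam) (m := m lam) (ℓ := ℓ lam)
        (β lam) b ⟨t lam, ht lam⟩
      simp only at h1 h2
      simp only [h1, h2]
      have : ∀ lam, Fintype ((Fin (L lam + 1) → Dual.PK (n lam) (m lam) (ℓ lam) ×
        Dual.SK (m lam) × Dual.Trapdoor (n lam) (m lam) (ℓ lam)) ×
        (Fin (L lam + 1) → Block (n lam) (m lam) (ℓ lam))) := fun _ => inferInstance
      refine CompIndist.bind_map (compIndist_encBlock hlwe hmr hn hm hl hpos h4 hneg).symm _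
        (fun lam => chainReduction b ⟨t lam, ht lam⟩)
        (s := fun lam => (L lam + 1) * (m lam * ((m lam + 1) * ((m lam + 1) *
          (ℓ lam * (32 * ℓ lam)))))) ?_ hblock (hL1.mul hblock)
        fun lam ω => computes_chainReduction b _ ω
      exact hL1.mul (hm.mul (hm1.mul (hm1.mul (hl.mul ((PolyBd.const 32).mul hl)))))
  have h0 : ∀ lam, chainHybrid (n lam) (m lam) (ℓ lam) (β lam) (L lam) b 0 =
      PMF.uniformOfFintype (Fin (L lam + 1) → Block (n lam) (m lam) (ℓ lam)) := by
    intro lam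
    have : ∀ K, chainBlock (n := n lam) (m := m lam) (ℓ := ℓ lam) (L := L lam) (β lam) b 0 K =
        fun _ => PMF.uniformOfFintype _ := fun K => by
      funext i
      rw [chainBlock, if_neg (Nat.not_lt_zero _)]
    simp only [chainHybrid, this, PMF.bind_const]
    rw [← uniform_pi]
  simp only [h0] at h
  exact h.symm

theorem isINDCPA_dualHE
    (hlwe : LWEHard n ℓ (fun lam => gaussian (ℓ lam) (β lam)))
    (hmr : ∃ r : Polynomial ℕ, ∀ lam, m lam ≤ r.eval (n lam * ℓ lam))
    (hn : PolyBd id n) (hm : PolyBd id m) (hl : PolyBd id ℓ)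
    (hpos : ∀ lam, 1 ≤ n lam ∧ 1 ≤ m lam ∧ 1 ≤ ℓ lam)
    (h4 : ∀ᶠ lam in atTop, 4 * (n lam * ℓ lam) ≤ m lam)
    (hneg : Negligible fun lam => (1 / 2 : ℝ) ^ ℓ lam) :
    IsINDCPA (fun lam => (Dual.keyGen (n lam) (m lam) (ℓ lam)).map fun K => K.1)
      (fun lam pk μ => enc (β lam) pk μ) := by
  have hm1 : PolyBd id fun lam => m lam + 1 := hm.add (.const 1)
  have hblock : PolyBd id fun lam => BitCode.len (Block (n lam) (m lam) (ℓ lam)) :=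
    (hm1.mul (hn.mul hl)).add (hm.mul (hm1.mul (hm1.mul (hl.mul hl))))
  have hpc : PolyBd id fun lam => BitCode.len (Dual.PK (n lam) (m lam) (ℓ lam) ×
      CT (m lam) (ℓ lam)) :=
    (hm1.mul (hn.mul hl)).add (hm1.mul (hm1.mul (hl.mul hl)))
  have key : ∀ b, CompIndist (fun lam => ((Dual.keyGen (n lam) (m lam) (ℓ lam)).map
        fun K => K.1).bind fun pub => (enc (β lam) pub b).map fun c => (pub, c))
      (fun lam => ((PMF.uniformOfFintype (Fin 1 → Block (n lam) (m lam) (ℓ lam))).map fun x =>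
        ((x 0).1, (x 0).2 ⟨0, (hpos lam).2.1⟩))) := by
    intro b
    have h := (compIndist_chain (L := fun _ => 0) hlwe hmr hn hm hl (.const 0) hpos h4 hneg b).map
      (fun lam x => ((x 0).1, (x 0).2 ⟨0, (hpos lam).2.1⟩)) (s := fun _ => 0) (.const 0)
      ((PolyBd.const 1).mul hblock) hpc fun lam => by
        have h := (Computes.wires_self
          fun x : Fin (0 + 1) → Block (n lam) (m lam) (ℓ lam) => x).proj 0
        exact h.fst.prod (h.snd.proj ⟨0, (hpos lam).2.1⟩)
    have e : ∀ lam, (chainHybrid (n lam) (m lam) (ℓ lam) (β lam) 0 b (0 + 1)).map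
        (fun x => ((x 0).1, (x 0).2 ⟨0, (hpos lam).2.1⟩)) =
        ((Dual.keyGen (n lam) (m lam) (ℓ lam)).map fun K => K.1).bind fun pub =>
          (enc (β lam) pub b).map fun c => (pub, c) := by
      intro lam
      have h0 : ∀ K, (piPMF (chainBlock (n := n lam) (m := m lam) (ℓ := ℓ lam) (L := 0) (β lam)
          b (0 + 1) K)).map (fun x => ((x 0).1, (x 0).2 ⟨0, (hpos lam).2.1⟩)) =
          (enc (β lam) (K 0).1 b).map fun c => ((K 0).1, c) := by
        intro K
        rw [← Function.comp_def (f := fun y : Block (n lam) (m lam) (ℓ lam) =>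
          (y.1, y.2 ⟨0, (hpos lam).2.1⟩)), ← PMF.map_comp, piPMF_const_eval]
        simp only [chainBlock, Fin.val_zero, Nat.lt_add_one, zero_add, if_true, encBlock,
          PMF.map_comp, chainMsg, Fin.cases_zero]
        conv_rhs => rw [← piPMF_const_eval (fun _ : Fin (m lam) => enc (β lam) (K 0).1 b)
          ⟨0, (hpos lam).2.1⟩, PMF.map_comp]
        rfl
      simp only [chainHybrid, PMF.map_bind, h0]
      conv_rhs => rw [← piPMF_const_eval (fun _ : Fin (0 + 1) =>
        Dual.keyGen (n lam) (m lam) (ℓ lam)) 0, PMF.map_comp, PMF.bind_map]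
      rfl
    simp only [e] at h
    exact h
  exact (key false).trans (key true).symm

theorem indCPA_leveled (D : ∀ lam, Circuit (m lam + (m lam + 1) * ℓ lam) 1)
    (hlwe : LWEHard n ℓ (fun lam => gaussian (ℓ lam) (β lam)))
    (hmr : ∃ r : Polynomial ℕ, ∀ lam, m lam ≤ r.eval (n lam * ℓ lam))
    (hn : PolyBd id n) (hm : PolyBd id m) (hl : PolyBd id ℓ)
    (hpos : ∀ lam, 1 ≤ n lam ∧ 1 ≤ m lam ∧ 1 ≤ ℓ lam)
    (h4 : ∀ᶠ lam in atTop, 4 * (n lam * ℓ lam) ≤ m lam)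
    (hneg : Negligible fun lam => (1 / 2 : ℝ) ^ ℓ lam) :
    (leveled n m ℓ β D).IndCPA := by
  intro L hL
  have hm1 : PolyBd id fun lam => m lam + 1 := hm.add (.const 1)
  have hL' : PolyBd id L := hL
  have hblock : PolyBd id fun lam => BitCode.len (Block (n lam) (m lam) (ℓ lam)) :=
    (hm1.mul (hn.mul hl)).add (hm.mul (hm1.mul (hm1.mul (hl.mul hl))))
  have hout : PolyBd id fun lam => BitCode.len ((Dual.PK (n lam) (m lam) (ℓ lam) ×
      EVK (n lam) (m lam) (ℓ lam) (L lam)) × (Bool × CT (m lam) (ℓ lam))) :=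
    ((hm1.mul (hn.mul hl)).add (hL'.mul hblock)).add
      ((PolyBd.const 1).add (hm1.mul (hm1.mul (hl.mul hl))))
  let F : ∀ lam, (Fin (L lam + 1) → Block (n lam) (m lam) (ℓ lam)) →
      (Dual.PK (n lam) (m lam) (ℓ lam) × EVK (n lam) (m lam) (ℓ lam) (L lam)) ×
        (Bool × CT (m lam) (ℓ lam)) := fun lam x =>
    (((x 0).1, fun i => x i.succ), (false, (x 0).2 ⟨0, (hpos lam).2.1⟩))
  have key : ∀ b, CompIndist (fun lam =>
      ((leveledKeyGen (n lam) (m lam) (ℓ lam) (β lam) (L lam)).map fun K => (K.1, K.2.1)).bind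
        fun pub => ((enc (β lam) pub.1 b).map fun C => (false, C)).map fun c => (pub, c))
      (fun lam => (PMF.uniformOfFintype
        (Fin (L lam + 1) → Block (n lam) (m lam) (ℓ lam))).map (F lam)) := by
    intro b
    have h := (compIndist_chain hlwe hmr hn hm hl hL' hpos h4 hneg b).map
      F (s := fun lam => L lam * 0) (.const 0)
      ((hL'.add (.const 1)).mul hblock) hout fun lam => by
        have h := (Computes.wires_self
          fun x : Fin (L lam + 1) → Block (n lam) (m lam) (ℓ lam) => x)
        have := ((h.proj 0).fst.prod (Computes.pi fun i => h.proj (Fin.succ i))).prod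
          ((Computes.wires_const (s := 0) false).prod ((h.proj 0).snd.proj ⟨0, (hpos lam).2.1⟩))
        exact this.mono_size (by simp)
    have e : ∀ lam, (chainHybrid (n lam) (m lam) (ℓ lam) (β lam) (L lam) b (L lam + 1)).map
        (F lam) =
        ((leveledKeyGen (n lam) (m lam) (ℓ lam) (β lam) (L lam)).map fun K => (K.1, K.2.1)).bind
        fun pub => ((enc (β lam) pub.1 b).map fun C => (false, C)).map fun c => (pub, c) := by
      intro lam
      unfold chainHybrid leveledKeyGen
      simp only [PMF.monad_bind, PMF.monad_pure, PMF.map_bind, PMF.pure_map, PMF.bind_bind,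
        PMF.pure_bind]
      congr 1
      funext K
      have h1 : ∀ i, chainBlock (β lam) b (L lam + 1) K i =
          encBlock (β lam) (K i).1 (chainMsg b K i) := fun i => by
        rw [chainBlock, if_pos i.2]
      rw [piPMF_cons]
      simp only [h1, PMF.map_bind, PMF.map_comp]
      refine (PMF.bind_comm _ _ _).trans ?_
      simp only [encBlock, piPMF_map, chainMsg, Fin.cases_zero, Fin.cases_succ]
      rw [PMF.bind_map]
      have h2 : ∀ c : Fin (L lam) → Fin (m lam) → CT (m lam) (ℓ lam),
          ((enc (β lam) (K 0).1 b).map fun C => (false, C)).map (fun c' =>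
            (((K 0).1, fun i : Fin (L lam) => ((K i.succ).1, c i)), c')) =
          (piPMF fun _ : Fin (m lam) => enc (β lam) (K 0).1 b).map fun C =>
            (((K 0).1, fun i : Fin (L lam) => ((K i.succ).1, c i)),
              (false, C ⟨0, (hpos lam).2.1⟩)) := by
        intro c
        conv_lhs => rw [← piPMF_const_eval (fun _ : Fin (m lam) => enc (β lam) (K 0).1 b)
          ⟨0, (hpos lam).2.1⟩, PMF.map_comp, PMF.map_comp]
        rfl
      refine congrArg _ (funext fun c => ?_)
      refine Eq.trans ?_ ((PMF.map_comp _ _ _).symm.trans (h2 c)).symm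
      simp only [Function.comp_apply]
      rw [PMF.bind_map]
      rfl
    simp only [e] at h
    exact h
  exact (key false).trans (key true).symm

end Asymptotic

end DualHE

/-! ### Formulas of small depth -/

section Depth

variable {X : Type} {B : Set (X → Bool)} {d : ℕ} {f g h : X → Bool}

/-- `f` has a NAND formula of depth at most `d` over `B` and the constants. -/
inductive DepthLE (B : Set (X → Bool)) : ℕ → (X → Bool) → Prop
  | base {f : X → Bool} (h : f ∈ B ∪ constFns X) : DepthLE B 0 f
  | nand {d : ℕ} {f g : X → Bool} (hf : DepthLE B d f) (hg : DepthLE B d g) :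
      DepthLE B (d + 1) (nandFn f g)
  | succ {d : ℕ} {f : X → Bool} (h : DepthLE B d f) : DepthLE B (d + 1) f

/-- NAND of functions labelled with their depth. -/
def labelledNand (a b : (X → Bool) × ℕ) : (X → Bool) × ℕ := (nandFn a.1 b.1, max a.2 b.2 + 1)

namespace DepthLE

theorem mono {e : ℕ} (hf : DepthLE B d f) (hde : d ≤ e) : DepthLE B e f := by
  induction hde with
  | refl => exact hf
  | step _ ih => exact ih.succ

theorem of_mem (hf : f ∈ B) : DepthLE B d f := (base (Or.inl hf)).mono (Nat.zero_le _)

theorem const (b : Bool) : DepthLE B d fun _ => b :=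
  (base (Or.inr (by cases b <;> simp [constFns]))).mono (Nat.zero_le _)

theorem congr (hf : DepthLE B d f) (e : ∀ x, f x = g x) : DepthLE B d g := by
  rwa [← funext e]

theorem not (hf : DepthLE B d f) : DepthLE B (d + 1) fun x => !f x :=
  (nand hf hf).congr fun x => by simp [nandFn]

theorem and (hf : DepthLE B d f) (hg : DepthLE B d g) : DepthLE B (d + 2) fun x => f x && g x :=
  (nand hf hg).not.congr fun x => by simp [nandFn]

theorem or (hf : DepthLE B d f) (hg : DepthLE B d g) : DepthLE B (d + 2) fun x => f x || g x :=
  (nand hf.not hg.not).congr fun x => by simp [nandFn]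

theorem xor (hf : DepthLE B d f) (hg : DepthLE B d g) :
    DepthLE B (d + 4) fun x => Bool.xor (f x) (g x) :=
  ((hf.or hg).and (nand hf hg).succ).congr fun x => by
    cases hx : f x <;> cases hy : g x <;> simp [nandFn, hx, hy]

theorem atLeastTwo (hf : DepthLE B d f) (hg : DepthLE B d g) (hh : DepthLE B d h) :
    DepthLE B (d + 6) fun x => Bool.atLeastTwo (f x) (g x) (h x) :=
  (((hf.and hg).mono (by omega : _ ≤ d + 4)).or ((hf.and hh).or (hg.and hh))).congr fun x => by
    cases hx : f x <;> cases hy : g x <;> cases hz : h x <;> simp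

theorem all_lt_two_pow {t : ℕ} {F : ℕ → X → Bool} (hF : ∀ i, DepthLE B d (F i)) :
    DepthLE B (d + 2 * t) fun x => decide (∀ i < 2 ^ t, F i x = true) := by
  induction t generalizing F with
  | zero => exact (hF 0).congr fun x => by simp
  | succ t ih =>
    refine (((ih hF).and (ih fun i => hF (i + 2 ^ t))).mono (by omega)).congr fun x => ?_
    rw [← Bool.decide_and]
    congr 1
    apply propext
    constructor
    · rintro ⟨h1, h2⟩ i hi
      rcases Nat.lt_or_ge i (2 ^ t) with h | h
      · exact h1 i h
      · have := h2 (i - 2 ^ t) (by rw [pow_succ] at hi; omega)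
        rwa [Nat.sub_add_cancel h] at this
    · intro h
      exact ⟨fun i hi => h i (by rw [pow_succ]; omega),
        fun i hi => h _ (by rw [pow_succ]; omega)⟩

theorem all_lt {t n : ℕ} (hn : n ≤ 2 ^ t) {F : ℕ → X → Bool} (hF : ∀ i < n, DepthLE B d (F i)) :
    DepthLE B (d + 2 * t) fun x => decide (∀ i < n, F i x = true) := by
  have h := all_lt_two_pow (t := t) (F := fun i => if i < n then F i else fun _ => true)
    (B := B) (d := d) fun i => by
      split_ifs with hi
      · exact hF i hi
      · exact const true
  refine h.congr fun x => ?_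
  congr 1
  apply propext
  constructor
  · intro h i hi
    have := h i (by omega)
    simpa [hi] using this
  · intro h i _
    by_cases hi : i < n
    · simpa [hi] using h i hi
    · simp [hi]

theorem any_lt {t n : ℕ} (hn : n ≤ 2 ^ t) {F : ℕ → X → Bool} (hF : ∀ i < n, DepthLE B d (F i)) :
    DepthLE B (d + 2 * t + 2) fun x => decide (∃ i < n, F i x = true) := by
  have h := (all_lt hn fun i hi => (hF i hi).not).not
  refine (h.mono (by omega)).congr fun x => ?_
  rw [← decide_not]
  simp

/-- The gates of a formula, appended to a straight-line computation which tracks depths. -/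
theorem exists_derives {k : ℕ} (hk : 0 < k) (inp : Fin k → X → Bool)
    (hf : DepthLE (Set.range inp) d f) :
    ∀ T : Set ((X → Bool) × ℕ), (Set.range fun i => (inp i, 0)) ⊆ T →
      ∃ s T' e, s + 1 ≤ 2 ^ (d + 2) ∧ e ≤ d + 3 ∧ Derives labelledNand T s T' ∧ (f, e) ∈ T' := by
  induction hf with
  | @base f hf =>
    intro T hT
    rcases hf with ⟨i, rfl⟩ | hf
    · exact ⟨0, T, 0, by norm_num, by omega, .base, hT ⟨i, rfl⟩⟩
    · -- The constants are computed from an input by one or two gates more than a negation.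
      have h0 : (inp ⟨0, hk⟩, 0) ∈ T := hT ⟨⟨0, hk⟩, rfl⟩
      have h1 := (Derives.base (op := labelledNand) (B := T)).gate h0 h0
      have h2 := h1.gate (Or.inr h0) (Or.inl rfl)
      have h3 := h2.gate (Or.inl rfl) (Or.inl rfl)
      rcases hf with rfl | rfl
      · refine ⟨3, _, 3, by norm_num, by omega, h3, Or.inl (Prod.ext (funext fun x => ?_) ?_)⟩
        · simp [labelledNand, nandFn]
        · simp [labelledNand]
      · refine ⟨2, _, 2, by norm_num, by omega, h2, Or.inl (Prod.ext (funext fun x => ?_) ?_)⟩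
        · simp [labelledNand, nandFn]
        · simp [labelledNand]
  | @nand d f g _ _ ihf ihg =>
    intro T hT
    obtain ⟨s, T', e, hs, he, hd, hm⟩ := ihf T hT
    obtain ⟨s', T'', e', hs', he', hd', hm'⟩ := ihg T' (hT.trans hd.subset)
    refine ⟨s + s' + 1, _, max e e' + 1, ?_, by omega,
      (hd.trans hd').gate (hd'.subset hm) hm', Or.inl rfl⟩
    rw [show d + 1 + 2 = (d + 2) + 1 by ring, pow_succ]
    omega
  | succ _ ih =>
    intro T hT
    obtain ⟨s, T', e, hs, he, hd, hm⟩ := ih T hT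
    exact ⟨s, T', e, hs.trans (Nat.pow_le_pow_right (by norm_num) (by omega)), by omega, hd, hm⟩

/-- Formulas of depth `d` are circuits of depth about `d` and size at most exponential in `d`. -/
theorem exists_circuit {k : ℕ} (hk : 0 < k) (inp : Fin k → X → Bool)
    (hf : DepthLE (Set.range inp) d f) :
    ∃ C : Circuit k 1, C.depth ≤ d + 3 ∧ C.size ≤ k + 2 ^ (d + 2) ∧
      ∀ x, C.evalBool (fun i => inp i x) 0 = f x := by
  obtain ⟨s, T', e, hs, he, hd, hm⟩ := exists_derives hk inp hf _ subset_rfl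
  obtain ⟨c, rfl⟩ := hd.exists_net
  obtain ⟨j, hj⟩ := hm
  refine ⟨⟨_, c, fun _ => j⟩, ?_, ?_, fun x => ?_⟩
  · have h1 := Net.eval_map (op := labelledNand (X := X)) (op' := fun a b => max a b + 1)
      Prod.snd (fun _ _ => rfl) (fun i => (inp i, 0)) c j
    rw [hj] at h1
    unfold Circuit.depth
    refine Finset.sup_le fun i _ => ?_
    simp only [Circuit.eval]
    rw [← h1]
    exact he
  · simp only [Circuit.size]
    omega
  · have h1 := Net.eval_map (op := labelledNand (X := X)) (op' := fun a b => !(a && b))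
      (fun a => a.1 x) (fun _ _ => rfl) (fun i => (inp i, 0)) c j
    rw [hj] at h1
    exact h1.symm

end DepthLE

/-! ### Decryption in logarithmic depth -/

variable {ℓ : ℕ}

/-- All bits of the `ℤ_q`-valued function `F` have formulas of depth at most `d`. -/
def ZDepthLE (B : Set (X → Bool)) (d : ℕ) (F : X → Zq ℓ) : Prop :=
  ∀ i < ℓ, DepthLE B d fun x => (F x).val.testBit i

theorem ZDepthLE.mono {e : ℕ} {F : X → Zq ℓ} (hF : ZDepthLE B d F) (h : d ≤ e) :
    ZDepthLE B e F := fun i hi => (hF i hi).mono h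

theorem ZDepthLE.const (a : Zq ℓ) : ZDepthLE B d fun _ => a := fun _ _ => DepthLE.const _

/-- Carry-save addition of natural numbers. -/
theorem Nat.add_add_eq_carrySave (x y z : ℕ) : x + y + z =
    (x ^^^ y ^^^ z) + 2 * ((x &&& y) ||| ((x &&& z) ||| (y &&& z))) := by
  obtain ⟨k, hk⟩ : ∃ k, x < 2 ^ k ∧ y < 2 ^ k ∧ z < 2 ^ k :=
    ⟨x + y + z, (by omega : x ≤ x + y + z).trans_lt Nat.lt_two_pow_self,
      (by omega : y ≤ x + y + z).trans_lt Nat.lt_two_pow_self,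
      (by omega : z ≤ x + y + z).trans_lt Nat.lt_two_pow_self⟩
  have hs : ∀ a, a < 2 ^ k → a = ∑ i ∈ Finset.range k, if a.testBit i then 2 ^ i else 0 :=
    fun a ha => by rw [Nat.sum_testBit_mod, Nat.mod_eq_of_lt ha]
  obtain ⟨hx, hy, hz⟩ := hk
  have hu := hs _ (Nat.xor_lt_two_pow (Nat.xor_lt_two_pow hx hy) hz)
  have hv := hs _ (Nat.or_lt_two_pow (Nat.and_lt_two_pow (n := k) x hy)
    (Nat.or_lt_two_pow (Nat.and_lt_two_pow (n := k) x hz) (Nat.and_lt_two_pow (n := k) y hz)))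
  rw [hu, hv]
  conv_lhs => rw [hs x hx, hs y hy, hs z hz]
  rw [← Finset.sum_add_distrib, ← Finset.sum_add_distrib, Finset.mul_sum,
    ← Finset.sum_add_distrib]
  refine Finset.sum_congr rfl fun i _ => ?_
  simp only [Nat.testBit_xor, Nat.testBit_or, Nat.testBit_and]
  cases x.testBit i <;> cases y.testBit i <;> cases z.testBit i <;> simp <;> ring

theorem ZDepthLE.carrySave {F G H : X → Zq ℓ} (hF : ZDepthLE B d F) (hG : ZDepthLE B d G)
    (hH : ZDepthLE B d H) : ∃ U V : X → Zq ℓ, ZDepthLE B (d + 8) U ∧ ZDepthLE B (d + 8) V ∧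
      ∀ x, F x + G x + H x = U x + V x := by
  let u : X → ℕ := fun x => (F x).val ^^^ (G x).val ^^^ (H x).val
  let v : X → ℕ := fun x => ((F x).val &&& (G x).val) |||
    (((F x).val &&& (H x).val) ||| ((G x).val &&& (H x).val))
  have hu : ∀ x, u x < 2 ^ ℓ := fun x =>
    Nat.xor_lt_two_pow (Nat.xor_lt_two_pow (F x).val_lt (G x).val_lt) (H x).val_lt
  have hv : ∀ x, v x < 2 ^ ℓ := fun x =>
    Nat.or_lt_two_pow (Nat.and_lt_two_pow (n := ℓ) _ (G x).val_lt)
    (Nat.or_lt_two_pow (Nat.and_lt_two_pow (n := ℓ) _ (H x).val_lt)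
      (Nat.and_lt_two_pow (n := ℓ) _ (H x).val_lt))
  refine ⟨fun x => (u x : Zq ℓ), fun x => 2 ^ 1 * (v x : Zq ℓ), fun i hi => ?_, fun i hi => ?_,
    fun x => ?_⟩
  · refine (((hF i hi).xor (hG i hi)).xor ((hH i hi).mono (by omega))).congr fun x => ?_
    rw [ZMod.val_natCast_of_lt (hu x)]
    simp [u]
  · by_cases h1 : 1 ≤ i
    · refine (((hF (i - 1) (by omega)).atLeastTwo (hG (i - 1) (by omega))
        (hH (i - 1) (by omega))).mono
        (by omega)).congr fun x => ?_
      rw [Zq.testBit_two_pow_mul _ _ hi, ZMod.val_natCast_of_lt (hv x)]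
      simp only [v, Nat.testBit_or, Nat.testBit_and, h1, decide_true, Bool.true_and]
      have h2 : ∀ a b c : Bool, Bool.atLeastTwo a b c = (a && b || (a && c || b && c)) := by decide
      exact h2 _ _ _
    · refine (DepthLE.const false).congr fun x => ?_
      rw [Zq.testBit_two_pow_mul _ _ hi]
      simp [h1]
  · have h := congrArg (Nat.cast (R := Zq ℓ))
      (Nat.add_add_eq_carrySave (F x).val (G x).val (H x).val)
    push_cast at h
    simp only [ZMod.natCast_val, ZMod.cast_id', id_eq] at h
    rw [h]
    simp [u, v]

/-- A sum of `2 ^ t` numbers is a sum of two numbers whose bits have depth `O(t)`. -/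
theorem ZDepthLE.sum_two_pow (t : ℕ) {F : ℕ → X → Zq ℓ} (hF : ∀ i, ZDepthLE B d (F i)) :
    ∃ U V : X → Zq ℓ, ZDepthLE B (d + 16 * t) U ∧ ZDepthLE B (d + 16 * t) V ∧
      ∀ x, ∑ i ∈ Finset.range (2 ^ t), F i x = U x + V x := by
  induction t generalizing F with
  | zero => exact ⟨F 0, fun _ => 0, hF 0, .const 0, fun x => by simp⟩
  | succ t ih =>
    obtain ⟨U, V, hU, hV, h⟩ := ih hF
    obtain ⟨U', V', hU', hV', h'⟩ := ih fun i => hF (2 ^ t + i)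
    obtain ⟨S, C, hS, hC, hSC⟩ := hU.carrySave hV hU'
    obtain ⟨S', C', hS', hC', hSC'⟩ := hS.carrySave hC (hV'.mono (by omega))
    refine ⟨S', C', hS'.mono (by omega), hC'.mono (by omega), fun x => ?_⟩
    rw [pow_succ, mul_two, Finset.sum_range_add, h, h', ← hSC', ← hSC]
    ring

/-- Carry lookahead. -/
theorem carry_eq_decide (x y : Zq ℓ) (i : ℕ) : BitVec.carry i x.toBV y.toBV false =
    decide (∃ j < i, (x.val.testBit j && y.val.testBit j &&
      decide (∀ k < i, (decide (k ≤ j) || (x.val.testBit k || y.val.testBit k)) = true)) =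
        true) := by
  induction i with
  | zero => simp
  | succ i ih =>
    rw [BitVec.carry_succ, ih, Zq.getLsbD_toBV, Zq.getLsbD_toBV]
    have h1 : ∀ a b : Bool, ∀ P : Prop, ∀ [Decidable P], Bool.atLeastTwo a b (decide P) =
        decide ((a = true ∧ b = true) ∨ ((a = true ∨ b = true) ∧ P)) := by
      intro a b P _
      by_cases hP : P <;> cases a <;> cases b <;> simp [hP]
    rw [h1]
    congr 1
    apply propext
    simp only [Bool.and_eq_true, decide_eq_true_eq, Bool.or_eq_true]
    constructor
    · rintro (⟨ha, hb⟩ | ⟨hab, j, hj, hg, hp⟩)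
      · exact ⟨i, by omega, ⟨ha, hb⟩, fun k hk => Or.inl (by omega)⟩
      · refine ⟨j, by omega, hg, fun k hk => ?_⟩
        rcases Nat.lt_or_ge k i with h | h
        · exact hp k h
        · obtain rfl : k = i := by omega
          exact Or.inr hab
    · rintro ⟨j, hj, hg, hp⟩
      rcases Nat.lt_or_ge j i with h | h
      · refine Or.inr ⟨?_, j, h, hg, fun k hk => hp k (by omega)⟩
        rcases hp i (by omega) with h' | h'
        · omega
        · exact h'
      · obtain rfl : j = i := by omega
        exact Or.inl hg

theorem ZDepthLE.add {t : ℕ} (ht : ℓ ≤ 2 ^ t) {F G : X → Zq ℓ} (hF : ZDepthLE B d F)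
    (hG : ZDepthLE B d G) : ZDepthLE B (d + 4 * t + 16) fun x => F x + G x := by
  intro i hi
  have hc : DepthLE B (d + 4 * t + 8) fun x => BitVec.carry i (F x).toBV (G x).toBV false := by
    have h1 := DepthLE.any_lt (B := B) (t := t) (n := i) (d := d + 2 * t + 6) (by omega)
      (F := fun j x => (F x).val.testBit j && (G x).val.testBit j &&
      decide (∀ k < i, (decide (k ≤ j) || ((F x).val.testBit k || (G x).val.testBit k)) = true))
      fun j hj => by
        have h2 := DepthLE.all_lt (B := B) (t := t) (n := i) (d := d + 4) (by omega)
          (F := fun k x => decide (k ≤ j) || ((F x).val.testBit k || (G x).val.testBit k))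
          fun k hk => (DepthLE.const _).or ((hF k (by omega)).or (hG k (by omega)))
        exact ((((hF j (by omega)).and (hG j (by omega))).mono (by omega)).and h2).mono (by omega)
    exact (h1.mono (by omega)).congr fun x => (carry_eq_decide _ _ _).symm
  refine ((((hF i hi).mono (by omega)).xor (((hG i hi).mono (by omega)).xor hc)).mono
    (by omega : d + 4 * t + 8 + 4 + 4 ≤ _)).congr fun x => ?_
  exact (Zq.testBit_add _ _ hi).symm

theorem Zq.abs_eq_min (x : Zq ℓ) : x.abs = min (x.val : ℤ) (2 ^ ℓ - x.val) := by
  have h := ZMod.valMinAbs_natAbs_eq_min x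
  have h2 := x.val_lt
  rw [Zq.abs, Int.abs_eq_natAbs, h]
  push_cast [Nat.cast_sub h2.le]
  rfl

theorem Zq.val_add_natCast (x : Zq ℓ) {a : ℕ} (ha : a < 2 ^ ℓ) :
    (x + (a : Zq ℓ)).val = if x.val + a < 2 ^ ℓ then x.val + a else x.val + a - 2 ^ ℓ := by
  have h := x.val_lt
  rw [ZMod.val_add, ZMod.val_natCast_of_lt ha]
  split_ifs with h1
  · exact Nat.mod_eq_of_lt h1
  · rw [Nat.mod_eq_sub_mod (by omega), Nat.mod_eq_of_lt (by omega)]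

theorem Zq.two_pow_eq_neg (ℓ : ℕ) (hl : 1 ≤ ℓ) : (2 : Zq ℓ) ^ (ℓ - 1) = -2 ^ (ℓ - 1) := by
  have h := ZMod.natCast_self (2 ^ ℓ)
  push_cast at h
  rw [eq_neg_iff_add_eq_zero, ← two_mul, ← pow_succ', Nat.sub_add_cancel hl]
  exact h

theorem Zq.testBit_top (x : Zq ℓ) : x.val.testBit (ℓ - 1) = true ↔ 2 ^ (ℓ - 1) ≤ x.val := by
  refine ⟨Nat.ge_two_pow_of_testBit, fun h => ?_⟩
  by_contra hc
  have := Nat.lt_pow_two_of_testBit (n := ℓ - 1) x.val fun j hj => by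
    rcases Nat.lt_or_ge (ℓ - 1) j with h' | h'
    · exact Nat.testBit_lt_two_pow (x.val_lt.trans_le
        (Nat.pow_le_pow_right (by norm_num) (by omega)))
    · obtain rfl : j = ℓ - 1 := by omega
      simpa using hc
  omega

/-- `b` is closer to `q / 2` than to `0`, or equally close, iff `b + q / 4` is `0` or its top bit
is set. -/
theorem Zq.not_abs_lt_iff (hl : 2 ≤ ℓ) (b : Zq ℓ) :
    ¬ b.abs < (b - 2 ^ (ℓ - 1) : Zq ℓ).abs ↔
      (b + 2 ^ (ℓ - 2) : Zq ℓ).val.testBit (ℓ - 1) = true ∨ (b + 2 ^ (ℓ - 2) : Zq ℓ).val = 0 := by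
  have h1 : 2 ^ (ℓ - 1) = 2 * 2 ^ (ℓ - 2) := by
    rw [← pow_succ']; congr 1; omega
  have h2 : 2 ^ ℓ = 4 * 2 ^ (ℓ - 2) := by
    rw [show 4 = 2 ^ 2 by norm_num, ← pow_add]; congr 1; omega
  have h3 := Nat.two_pow_pos (ℓ - 2)
  have hv := b.val_lt
  have e1 : (b - 2 ^ (ℓ - 1) : Zq ℓ) = b + ((2 ^ (ℓ - 1) : ℕ) : Zq ℓ) := by
    rw [sub_eq_add_neg, ← Zq.two_pow_eq_neg ℓ (by omega)]
    push_cast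
    rfl
  have e2 : (b + 2 ^ (ℓ - 2) : Zq ℓ) = b + ((2 ^ (ℓ - 2) : ℕ) : Zq ℓ) := by
    push_cast
    rfl
  have h4 := Zq.val_add_natCast b (a := 2 ^ (ℓ - 1)) (by omega)
  have h5 := Zq.val_add_natCast b (a := 2 ^ (ℓ - 2)) (by omega)
  rw [Zq.testBit_top, Zq.abs_eq_min, Zq.abs_eq_min, e1, e2, h4, h5]
  have h2' : (2 : ℤ) ^ ℓ = ((2 ^ ℓ : ℕ) : ℤ) := by push_cast; rfl
  rw [h2']
  split_ifs <;> omega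

/-- The decision of the decryption algorithm as a formula in the bits of `b + q / 4`. -/
theorem Zq.closer_to_half_eq (hl : 2 ≤ ℓ) (b : Zq ℓ) :
    ((b + 2 ^ (ℓ - 2) : Zq ℓ).val.testBit (ℓ - 1) ||
      decide (∀ i < ℓ, (!(b + 2 ^ (ℓ - 2) : Zq ℓ).val.testBit i) = true)) =
    if b.abs < (b - 2 ^ (ℓ - 1) : Zq ℓ).abs then false else true := by
  have h1 := Zq.not_abs_lt_iff hl b
  have h2 : (∀ i < ℓ, (!(b + 2 ^ (ℓ - 2) : Zq ℓ).val.testBit i) = true) ↔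
      (b + 2 ^ (ℓ - 2) : Zq ℓ).val = 0 := by
    constructor
    · intro h
      apply Nat.eq_of_testBit_eq
      intro i
      rw [Nat.zero_testBit]
      by_cases hi : i < ℓ
      · simpa using h i hi
      · exact Nat.testBit_lt_two_pow ((Zq.val_lt _).trans_le
          (Nat.pow_le_pow_right (by norm_num) (not_lt.mp hi)))
    · intro h i _
      rw [h]
      simp
  simp only [h2]
  by_cases h3 : b.abs < (b - 2 ^ (ℓ - 1) : Zq ℓ).abs
  · rw [if_pos h3]
    have h4 := fun h => h1.mpr h h3
    rw [Bool.or_eq_false_iff]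
    exact ⟨by simpa using fun h => h4 (Or.inl h), by simpa using fun h => h4 (Or.inr h)⟩
  · rw [if_neg h3]
    simpa using h1.mp h3

end Depth

namespace Dual

variable {m ℓ : ℕ}

/-- The inputs of a decryption circuit, as functions of the secret key and the ciphertext. -/
def decInput (m ℓ : ℕ) (i : Fin (m + (m + 1) * ℓ)) (x : SK m × (Fin (m + 1) → Zq ℓ)) : Bool :=
  Fin.append x.1 (ctBits x.2) i

theorem depthLE_key (i : Fin m) :
    DepthLE (Set.range (decInput m ℓ)) 0 fun x => x.1 i :=
  DepthLE.of_mem ⟨Fin.castAdd _ i, funext fun x => by simp [decInput]⟩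

theorem zDepthLE_ct (i : Fin (m + 1)) :
    ZDepthLE (Set.range (decInput m ℓ)) 0 fun x => x.2 i := fun b hb =>
  DepthLE.of_mem ⟨Fin.natAdd m (finProdFinEquiv (i, ⟨b, hb⟩)), funext fun x => by
    simp only [decInput, Fin.append_right, ctBits, Equiv.symm_apply_apply]⟩

/-- The inner product of the decryption vector with the ciphertext, up to a constant. -/
theorem exists_zDepthLE_innerProduct {t : ℕ} (ht : m + 2 ≤ 2 ^ t) (ht' : ℓ ≤ 2 ^ t) (K : Zq ℓ) :
    ZDepthLE (Set.range (decInput m ℓ)) (20 * t + 19) fun x =>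
      (∑ i, skVec ℓ x.1 i * x.2 i) + K := by
  -- `-y` is the complement of `y` plus one; the ones are collected in the constant.
  let F : ℕ → SK m × (Fin (m + 1) → Zq ℓ) → Zq ℓ := fun i x =>
    if h : i < m then -1 - (if x.1 ⟨i, h⟩ then x.2 ⟨i, by omega⟩ else 0)
    else if i = m then x.2 (Fin.last m) else if i = m + 1 then (m : Zq ℓ) + K else 0
  have hF : ∀ i, ZDepthLE (Set.range (decInput m ℓ)) 3 (F i) := by
    intro i b hb
    by_cases h : i < m
    · refine ((depthLE_key ⟨i, h⟩).and (zDepthLE_ct ⟨i, by omega⟩ b hb)).not.congr fun x => ?_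
      simp only [F, h, dite_true]
      rw [Zq.testBit_neg_one_sub _ hb]
      cases x.1 ⟨i, h⟩ <;> simp
    · by_cases h' : i = m
      · refine ((zDepthLE_ct (Fin.last m)).mono (by omega) b hb).congr fun x => ?_
        simp [F, h']
      · simp only [F, h, h', dite_false, if_false]
        split_ifs <;> exact DepthLE.const _
  obtain ⟨U, V, hU, hV, hUV⟩ := ZDepthLE.sum_two_pow t hF
  have hs : ∀ x, U x + V x = (∑ i, skVec ℓ x.1 i * x.2 i) + K := by
    intro x
    rw [← hUV, show 2 ^ t = (m + 2) + (2 ^ t - (m + 2)) by omega, Finset.sum_range_add,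
      Finset.sum_eq_zero (s := Finset.range (2 ^ t - (m + 2))), add_zero, Finset.sum_range_succ,
      Finset.sum_range_succ, Finset.sum_range, Fin.sum_univ_castSucc]
    · simp only [F, Fin.is_lt, dite_true, lt_irrefl, dite_false, if_true, skVec, Fin.snoc_last,
        Fin.snoc_castSucc, Pi.neg_apply, skBits, Finset.sum_sub_distrib, Finset.sum_const,
        Finset.card_univ, Fintype.card_fin, one_mul, neg_mul, Finset.sum_neg_distrib, ite_mul,
        zero_mul, show ¬m + 1 < m by omega, show ¬m + 1 = m by omega, if_false]
      have : ∀ i : Fin m, (⟨i, by omega⟩ : Fin (m + 1)) = i.castSucc := fun i => rfl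
      simp only [this, Fin.eta]
      rw [nsmul_eq_mul]
      ring
    · intro i _
      simp [F, show ¬ m + 2 + i < m by omega, show ¬ m + 2 + i = m by omega,
        show ¬ m + 2 + i = m + 1 by omega]
  intro i hi
  exact ((ZDepthLE.add ht' hU hV i hi).mono (by omega)).congr fun x =>
    congrArg (fun z : Zq ℓ => z.val.testBit i) (hs x)

theorem exists_decCircuit (hl : 1 ≤ ℓ) {t : ℕ} (ht : m + 2 ≤ 2 ^ t) (ht' : ℓ ≤ 2 ^ t) :
    ∃ D : Circuit (m + (m + 1) * ℓ) 1, IsDecCircuit D ∧ D.depth ≤ 22 * t + 25 ∧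
      D.size ≤ (m + (m + 1) * ℓ) + 2 ^ (22 * t + 24) := by
  have key : DepthLE (Set.range (decInput m ℓ)) (22 * t + 22) fun x => dec x.1 x.2 := by
    rcases Nat.lt_or_ge ℓ 2 with h | h
    · obtain rfl : ℓ = 1 := by omega
      refine ((exists_zDepthLE_innerProduct ht ht' (0 : Zq 1) 0 (by omega)).mono
        (by omega)).congr fun x => ?_
      simp only [add_zero]
      have h1 : ∀ b : Zq 1, b.val.testBit 0 =
          if b.abs < (b - 2 ^ (1 - 1) : Zq 1).abs then false else true := by decide
      exact h1 _
    · have hw := exists_zDepthLE_innerProduct (m := m) ht ht' ((2 : Zq ℓ) ^ (ℓ - 2))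
      have h0 := DepthLE.all_lt ht' fun i hi => (hw i hi).not
      refine ((((hw (ℓ - 1) (by omega)).mono (by omega)).or h0).mono (by omega)).congr fun x => ?_
      exact Zq.closer_to_half_eq h _
  obtain ⟨D, h1, h2, h3⟩ := key.exists_circuit 
    (Nat.add_pos_right _ (Nat.mul_pos (Nat.succ_pos m) hl)) (decInput m ℓ)
  exact ⟨D, fun e c => h3 (e, c), h1, h2⟩

end Dual

/-! ### Noise growth and correctness -/

namespace Zq

variable {ℓ : ℕ}

theorem abs_nonneg (x : Zq ℓ) : 0 ≤ x.abs := _root_.abs_nonneg _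

theorem abs_zero : (0 : Zq ℓ).abs = 0 := by simp [Zq.abs]

theorem abs_neg (x : Zq ℓ) : (-x).abs = x.abs := by
  rw [Zq.abs, Zq.abs, Int.abs_eq_natAbs, Int.abs_eq_natAbs, ZMod.natAbs_valMinAbs_neg]

theorem abs_add_le (x y : Zq ℓ) : (x + y).abs ≤ x.abs + y.abs := by
  simp only [Zq.abs, Int.abs_eq_natAbs]
  exact_mod_cast (ZMod.natAbs_valMinAbs_add_le x y).trans (Int.natAbs_add_le _ _)

theorem abs_sub_le (x y : Zq ℓ) : (x - y).abs ≤ x.abs + y.abs := by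
  rw [sub_eq_add_neg, ← abs_neg y]
  exact abs_add_le _ _

theorem abs_sum_le {ι : Type*} [Fintype ι] {f : ι → Zq ℓ} {b : ℕ} (h : ∀ i, (f i).abs ≤ b) :
    (∑ i, f i).abs ≤ Fintype.card ι * b :=
  (Finset.le_sum_of_subadditive _ abs_zero.le abs_add_le _ _).trans
    ((Finset.sum_le_card_nsmul _ _ (b : ℤ) fun i _ => h i).trans (by simp))

theorem abs_two_pow (hl : 1 ≤ ℓ) : (2 ^ (ℓ - 1) : Zq ℓ).abs = 2 ^ (ℓ - 1) := by
  have h1 : 2 ^ ℓ = 2 * 2 ^ (ℓ - 1) := by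
    rw [← pow_succ']; congr 1; omega
  have h2 : (2 ^ (ℓ - 1) : Zq ℓ).val = 2 ^ (ℓ - 1) := by
    have := ZMod.val_natCast_of_lt (n := 2 ^ ℓ) (a := 2 ^ (ℓ - 1))
      (by have := Nat.two_pow_pos (ℓ - 1); omega)
    push_cast at this
    exact this
  have h3 : (2 : ℤ) ^ ℓ = 2 * 2 ^ (ℓ - 1) := by exact_mod_cast h1
  rw [abs_eq_min, h2, h3]
  push_cast
  omega

end Zq

namespace Dual

variable {n m ℓ : ℕ}

theorem abs_skVec_mul_le (e : SK m) (i : Fin (m + 1)) (x : Zq ℓ) :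
    (skVec ℓ e i * x).abs ≤ x.abs := by
  refine Fin.lastCases ?_ (fun j => ?_) i
  · simp [skVec]
  · simp only [skVec, Fin.snoc_castSucc, Pi.neg_apply, skBits]
    split_ifs
    · rw [neg_one_mul, Zq.abs_neg]
    · simpa [Zq.abs_zero] using Zq.abs_nonneg x

theorem vecMul_skVec_publicKey (A : Matrix (Fin m) (Fin n) (Zq ℓ)) (e : SK m) :
    Matrix.vecMul (skVec ℓ e) (publicKey A e) = 0 := by
  funext a
  simp [Matrix.vecMul, dotProduct, Fin.sum_univ_castSucc, skVec, publicKey, Matrix.mulVec,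
    mul_comm]

end Dual

namespace DualHE

variable {n m ℓ : ℕ}

theorem G_mul_Ginv (C : CT m ℓ) : G m ℓ * Ginv C = C := by
  ext i j
  rw [Matrix.mul_apply, Fintype.sum_prod_type, Finset.sum_eq_single i]
  · simp only [G, Ginv, Matrix.of_apply, if_true, mul_ite, mul_one, mul_zero]
    exact ((Zq.eq_sum_bits (C i j)).trans (Finset.sum_range _)).symm
  · intro i' _ hi'
    simp [G, hi'.symm]
  · simp

/-- The noise `skᵀ C - μ skᵀ G` of `C` as an encryption of `μ`. -/
def noise (e : Dual.SK m) (C : CT m ℓ) (μ : Bool) : Fin (m + 1) × Fin ℓ → Zq ℓ :=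
  Matrix.vecMul (Dual.skVec ℓ e) C - if μ then Matrix.vecMul (Dual.skVec ℓ e) (G m ℓ) else 0

/-- `C` encrypts `μ` under the secret key `e` with noise at most `b`. -/
def Encrypts (e : Dual.SK m) (b : ℕ) (C : CT m ℓ) (μ : Bool) : Prop :=
  ∀ j, (noise e C μ j).abs ≤ b

theorem Encrypts.mono {e : Dual.SK m} {b b' : ℕ} {C : CT m ℓ} {μ : Bool} (h : Encrypts e b C μ)
    (hb : b ≤ b') : Encrypts e b' C μ := fun j => (h j).trans (by exact_mod_cast hb)

/-- The gadget matrix is a noiseless encryption under every key. -/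
theorem encrypts_ite (e : Dual.SK m) (b : ℕ) (μ : Bool) :
    Encrypts e b (if μ then G m ℓ else 0) μ := by
  intro j
  cases μ <;> simp [noise, Zq.abs_zero]

theorem noise_nand (e : Dual.SK m) (C₀ C₁ : CT m ℓ) (μ₀ μ₁ : Bool) :
    noise e (nand C₀ C₁) (!(μ₀ && μ₁)) =
      -((if μ₀ then noise e C₁ μ₁ else 0) + Matrix.vecMul (noise e C₀ μ₀) (Ginv C₁)) := by
  have h : Matrix.vecMul (noise e C₀ μ₀) (Ginv C₁) =
      Matrix.vecMul (Dual.skVec ℓ e) (C₀ * Ginv C₁) -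
        if μ₀ then Matrix.vecMul (Dual.skVec ℓ e) C₁ else 0 := by
    rw [noise, Matrix.sub_vecMul, Matrix.vecMul_vecMul]
    cases μ₀
    · simp
    · simp only [if_true]
      rw [Matrix.vecMul_vecMul, G_mul_Ginv]
  rw [h, nand, noise, Matrix.vecMul_sub]
  cases μ₀ <;> cases μ₁ <;> simp [noise]

/-- The noise of a NAND is `-(μ₀ e₁ + e₀ G⁻¹(C₁))` for the noises `e₀`, `e₁` of its arguments, and
`G⁻¹(C₁)` has `N = (m + 1) ℓ` rows with entries in `{0, 1}`. -/
theorem Encrypts.nand {e : Dual.SK m} {b : ℕ} {C₀ C₁ : CT m ℓ} {μ₀ μ₁ : Bool}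
    (h₀ : Encrypts e b C₀ μ₀) (h₁ : Encrypts e b C₁ μ₁) :
    Encrypts e (b * ((m + 1) * ℓ + 1)) (nand C₀ C₁) (!(μ₀ && μ₁)) := by
  intro j
  have h2 : ((if μ₀ then noise e C₁ μ₁ else 0 : Fin (m + 1) × Fin ℓ → Zq ℓ) j).abs ≤ b := by
    cases μ₀
    · simp [Zq.abs_zero]
    · simpa using h₁ j
  have h3 : (Matrix.vecMul (noise e C₀ μ₀) (Ginv C₁) j).abs ≤ (m + 1) * ℓ * b := by
    refine (Zq.abs_sum_le fun i => ?_).trans (by simp :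
      (Fintype.card (Fin (m + 1) × Fin ℓ) : ℤ) * b ≤ (m + 1) * ℓ * b)
    simp only [Ginv, Matrix.of_apply]
    split_ifs
    · simpa using h₀ i
    · simp [Zq.abs_zero]
  rw [noise_nand, Pi.neg_apply, Zq.abs_neg, Pi.add_apply]
  refine (Zq.abs_add_le _ _).trans ((add_le_add h2 h3).trans (le_of_eq ?_))
  push_cast
  ring

theorem Encrypts.net_eval {e : Dual.SK m} {b k : ℕ} {x : Fin k → CT m ℓ} {μ : Fin k → Bool}
    (h : ∀ i, Encrypts e b (x i) (μ i)) {w : ℕ} (c : Net k w) (j : Fin w) :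
    Encrypts e (b * ((m + 1) * ℓ + 1) ^ c.eval (fun a b => max a b + 1) (fun _ => 0) j)
      (c.eval DualHE.nand x j) (c.eval (fun a b => !(a && b)) μ j) := by
  induction c with
  | inputs => simpa [Net.eval] using h j
  | gate c a a' ih =>
    refine Fin.lastCases ?_ (fun j => ?_) j
    · simp only [Net.eval, Fin.snoc_last]
      rw [pow_succ, ← mul_assoc]
      exact Encrypts.nand
        ((ih a).mono (Nat.mul_le_mul_left _ (Nat.pow_le_pow_right (Nat.succ_pos _)
          (le_max_left _ _))))
        ((ih a').mono (Nat.mul_le_mul_left _ (Nat.pow_le_pow_right (Nat.succ_pos _)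
          (le_max_right _ _))))
    · simpa only [Net.eval, Fin.snoc_castSucc] using ih j

/-- Refreshing replaces the noise of the ciphertext by that of the evaluated decryption circuit. -/
theorem Encrypts.refresh {D : Circuit (m + (m + 1) * ℓ) 1} (hD : Dual.IsDecCircuit D)
    {e e' : Dual.SK m} {b : ℕ} {encSK : Fin m → CT m ℓ}
    (h : ∀ i, Encrypts e' b (encSK i) (e i)) (C : CT m ℓ) :
    Encrypts e' (b * ((m + 1) * ℓ + 1) ^ D.depth) (refresh D encSK C) (dec e C) := by
  rw [dec, ← hD]
  refine Encrypts.mono (Encrypts.net_eval (fun i => ?_) D.net (D.out 0))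
    (Nat.mul_le_mul_left _ (Nat.pow_le_pow_right (Nat.succ_pos _)
      (Finset.le_sup (f := D.eval (fun a b => max a b + 1) fun _ => 0) (Finset.mem_univ 0))))
  refine Fin.addCases (fun i => ?_) (fun i => ?_) i
  · simpa only [Fin.append_left] using h i
  · simpa only [Fin.append_right] using encrypts_ite e' b _

/-- In the last column the encoding of `μ` is `μ q / 2`. -/
theorem Encrypts.dec_eq (hl : 1 ≤ ℓ) {e : Dual.SK m} {b : ℕ} {C : CT m ℓ} {μ : Bool}
    (h : Encrypts e b C μ) (hb : 4 * b < 2 ^ ℓ) : dec e C = μ := by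
  have h1 := h (Fin.last m, ⟨ℓ - 1, by omega⟩)
  set x := noise e C μ (Fin.last m, ⟨ℓ - 1, by omega⟩) with hx
  have hG : Matrix.vecMul (Dual.skVec ℓ e) (G m ℓ) (Fin.last m, ⟨ℓ - 1, by omega⟩) =
      2 ^ (ℓ - 1) := by
    simp [Matrix.vecMul, dotProduct, G, Dual.skVec]
  have hs : (∑ i, Dual.skVec ℓ e i * convert C i) = x + if μ then 2 ^ (ℓ - 1) else 0 := by
    have h2 : (∑ i, Dual.skVec ℓ e i * convert C i) =
        Matrix.vecMul (Dual.skVec ℓ e) C (Fin.last m, ⟨ℓ - 1, by omega⟩) := by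
      simp [convert, show 0 < ℓ by omega, Matrix.vecMul, dotProduct]
    rw [h2, hx, noise, Pi.sub_apply]
    cases μ
    · simp
    · simp [hG]
  have hq : (2 : ℤ) ^ ℓ = 2 * 2 ^ (ℓ - 1) := by
    rw [← pow_succ']; congr 1; omega
  have hb' : 4 * (b : ℤ) < 2 ^ ℓ := by exact_mod_cast hb
  have h2 := Zq.abs_two_pow hl
  rw [dec, Dual.dec]
  simp only [hs]
  cases μ
  · have h3 : (2 ^ (ℓ - 1) : Zq ℓ).abs ≤ x.abs + (x - 2 ^ (ℓ - 1)).abs := by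
      have := Zq.abs_sub_le x (x - 2 ^ (ℓ - 1))
      rwa [sub_sub_cancel] at this
    simp only [Bool.false_eq_true, if_false, add_zero]
    rw [if_pos (by omega)]
  · have h3 : (2 ^ (ℓ - 1) : Zq ℓ).abs ≤ x.abs + (x + 2 ^ (ℓ - 1)).abs := by
      have := Zq.abs_sub_le (x + 2 ^ (ℓ - 1)) x
      rw [add_sub_cancel_left] at this
      omega
    simp only [if_true, add_sub_cancel_right]
    rw [if_neg (by omega)]

/-- The data needed for correct homomorphic evaluation: the evaluation key consists of encryptions
with noise at most `b`, and `b` leaves room for the decryption circuit and one more gate. -/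
structure GoodKeys {L : ℕ} (D : Circuit (m + (m + 1) * ℓ) 1) (b : ℕ)
    (e : Fin (L + 1) → Dual.SK m) (evk : EVK n m ℓ L) : Prop where
  one_le : 1 ≤ ℓ
  isDec : Dual.IsDecCircuit D
  bound : 4 * (b * ((m + 1) * ℓ + 1) ^ (D.depth + 1)) < 2 ^ ℓ
  encrypts : ∀ i j, Encrypts (e i.succ) b ((evk i).2 j) (e i.castSucc j)

namespace GoodKeys

variable {L : ℕ} {D : Circuit (m + (m + 1) * ℓ) 1} {b : ℕ} {e : Fin (L + 1) → Dual.SK m}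
  {evk : EVK n m ℓ L}

theorem step (h : GoodKeys D b e evk) {d : ℕ} (hd : d + 1 ≤ L) {C : CT m ℓ} {μ : Bool}
    (hC : Encrypts (e ⟨d, by omega⟩) (b * ((m + 1) * ℓ + 1) ^ (D.depth + 1)) C μ) :
    Encrypts (e ⟨d + 1, by omega⟩) (b * ((m + 1) * ℓ + 1) ^ D.depth) (step D evk d C) μ := by
  have hd' : d < L := hd
  rw [DualHE.step, dif_pos hd', ← hC.dec_eq h.one_le h.bound]
  exact Encrypts.refresh h.isDec (fun j => h.encrypts ⟨d, hd'⟩ j) C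

theorem leveledEval_wire (h : GoodKeys D b e evk) {l : ℕ} {c : Fin l → CT m ℓ} {μ : Fin l → Bool}
    (hc : ∀ i, Encrypts (e 0) b (c i) (μ i)) {w : ℕ} (f : Net l w) (j : Fin w) (d : ℕ)
    (hd : f.eval (fun a b => max a b + 1) (fun _ => 0) j ≤ d) (hL : d ≤ L) :
    Encrypts (e ⟨d, by omega⟩) (b * ((m + 1) * ℓ + 1) ^ D.depth)
      (f.eval (α := ℕ → CT m ℓ)
        (fun u v d => match d with
          | 0 => 0
          | d + 1 => DualHE.step D evk d (DualHE.nand (u d) (v d)))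
        (fun i d => Nat.rec (c i) (fun d' C => DualHE.step D evk d' C) d) j d)
      (f.eval (fun a b => !(a && b)) μ j) := by
  induction f generalizing d with
  | inputs =>
    simp only [Net.eval] at hd ⊢
    clear hd
    induction d with
    | zero => exact (hc j).mono (Nat.le_mul_of_pos_right _ (Nat.pow_pos (Nat.succ_pos _)))
    | succ d ih =>
      exact h.step hL ((ih (by omega)).mono (Nat.mul_le_mul_left _
        (Nat.pow_le_pow_right (Nat.succ_pos _) (by omega))))
  | gate f a a' ih =>
    revert hd
    refine Fin.lastCases ?_ (fun j => ?_) j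
    · simp only [Net.eval, Fin.snoc_last]
      intro hd
      obtain ⟨d, rfl⟩ : ∃ d', d = d' + 1 := ⟨d - 1, by omega⟩
      refine h.step hL ?_
      rw [pow_succ, ← mul_assoc]
      exact (ih a d (by omega) (by omega)).nand (ih a' d (by omega) (by omega))
    · simp only [Net.eval, Fin.snoc_castSucc]
      intro hd
      exact ih j d hd hL

/-- Evaluation of circuits of depth at most `L` on encryptions under key `0` is correct. -/
theorem dec_leveledEval (h : GoodKeys D b e evk) {l : ℕ} {c : Fin l → CT m ℓ} {μ : Fin l → Bool}
    (hc : ∀ i, Encrypts (e 0) b (c i) (μ i)) (f : Circuit l 1) (hf : f.depth ≤ L) :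
    dec (e (Fin.last L)) (leveledEval D evk f c) = f.evalBool μ 0 := by
  have h1 := h.leveledEval_wire hc f.net (f.out 0) L
    ((Finset.le_sup (f := f.eval (fun a b => max a b + 1) fun _ => 0)
      (Finset.mem_univ 0)).trans hf) le_rfl
  exact (h1.mono (Nat.mul_le_mul_left _ (Nat.pow_le_pow_right (Nat.succ_pos _)
    (Nat.le_succ _)))).dec_eq h.one_le h.bound

end GoodKeys

end DualHE

/-! ### Correctness of the leveled scheme -/

theorem PMF.prTrue_eq_one {p : PMF Bool} (h : ∀ b ∈ p.support, b = true) : p.prTrue = 1 := by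
  have h1 : p true = 1 := by
    rw [PMF.apply_eq_one_iff]
    ext b
    constructor
    · intro hb; exact h b hb
    · rintro rfl
      obtain ⟨b, hb⟩ := p.support_nonempty
      rwa [h b hb] at hb
  rw [PMF.prTrue, h1, ENNReal.toReal_one]

theorem PMF.prTrue_nonneg (p : PMF Bool) : 0 ≤ p.prTrue := ENNReal.toReal_nonneg

theorem mem_support_of_piPMF {ι α : Type} [Fintype ι] [DecidableEq ι] [Fintype α]
    {p : ι → PMF α} {x : ι → α} (hx : x ∈ (piPMF p).support) (i : ι) : x i ∈ (p i).support := by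
  rw [PMF.mem_support_iff, piPMF_apply] at hx
  exact (PMF.mem_support_iff _ _).mpr (Finset.prod_ne_zero_iff.mp hx i (Finset.mem_univ i))

theorem Zq.abs_le_of_mem_support_gaussian {ℓ B : ℕ} {x : Zq ℓ} (hx : x ∈ (gaussian ℓ B).support) :
    x.abs ≤ B := by
  rw [gaussian, PMF.mem_support_normalize_iff] at hx
  by_contra h
  exact hx (if_neg h)

namespace DualHE

variable {n m ℓ : ℕ}

theorem encrypts_of_mem_support {β : ℕ} {A : Matrix (Fin m) (Fin n) (Zq ℓ)} {e : Dual.SK m}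
    {μ : Bool} {C : CT m ℓ} (hC : C ∈ (enc β (Dual.publicKey A e) μ).support) :
    Encrypts e ((m + 1) * β) C μ := by
  simp only [enc, PMF.monad_bind, PMF.monad_pure, PMF.mem_support_bind_iff,
    PMF.mem_support_pure_iff] at hC
  obtain ⟨S, -, E, hE, rfl⟩ := hC
  intro j
  have h1 : noise e (Dual.publicKey A e * S + Matrix.of E + if μ then G m ℓ else 0) μ =
      Matrix.vecMul (Dual.skVec ℓ e) (Matrix.of E) := by
    rw [noise, Matrix.vecMul_add, Matrix.vecMul_add, ← Matrix.vecMul_vecMul,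
      Dual.vecMul_skVec_publicKey]
    cases μ <;> simp
  rw [h1]
  refine (Zq.abs_sum_le fun i => ?_).trans
    (by simp : ((Fintype.card (Fin (m + 1)) : ℤ) * β ≤ ((m + 1) * β : ℕ)))
  exact (Dual.abs_skVec_mul_le e i _).trans
    (Zq.abs_le_of_mem_support_gaussian (mem_support_of_piPMF (mem_support_of_piPMF hE i) j))

theorem exists_eq_publicKey {K : Dual.PK n m ℓ × Dual.SK m × Dual.Trapdoor n m ℓ}
    (hK : K ∈ (Dual.keyGen n m ℓ).support) : ∃ A, K.1 = Dual.publicKey A K.2.1 := by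
  simp only [Dual.keyGen, PMF.monad_bind, PMF.monad_pure, PMF.mem_support_bind_iff,
    PMF.mem_support_pure_iff] at hK
  obtain ⟨e, -, At, -, rfl⟩ := hK
  exact ⟨At.1, rfl⟩

theorem goodKeys_of_mem_support {β L : ℕ} {D : Circuit (m + (m + 1) * ℓ) 1} (hl : 1 ≤ ℓ)
    (hD : Dual.IsDecCircuit D)
    (hb : 4 * ((m + 1) * β * ((m + 1) * ℓ + 1) ^ (D.depth + 1)) < 2 ^ ℓ)
    {K : Dual.PK n m ℓ × EVK n m ℓ L × (Dual.SK m × Dual.SK m)}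
    (hK : K ∈ (leveledKeyGen n m ℓ β L).support) :
    ∃ e : Fin (L + 1) → Dual.SK m, GoodKeys D ((m + 1) * β) e K.2.1 ∧
      K.2.2 = (e 0, e (Fin.last L)) ∧ ∃ A, K.1 = Dual.publicKey A (e 0) := by
  simp only [leveledKeyGen, PMF.monad_bind, PMF.monad_pure, PMF.mem_support_bind_iff,
    PMF.mem_support_pure_iff] at hK
  obtain ⟨k, hk, c, hc, rfl⟩ := hK
  have hA := fun i => exists_eq_publicKey (mem_support_of_piPMF hk i)
  refine ⟨fun i => (k i).2.1, ⟨hl, hD, hb, fun i j => ?_⟩, rfl, hA 0⟩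
  have h1 := mem_support_of_piPMF (mem_support_of_piPMF hc i) j
  obtain ⟨A, h2⟩ := hA i.succ
  rw [h2] at h1
  exact encrypts_of_mem_support h1

theorem correct_leveled {n m ℓ β : ℕ → ℕ} {D : ∀ lam, Circuit (m lam + (m lam + 1) * ℓ lam) 1}
    (hl : ∀ lam, 1 ≤ ℓ lam) (hD : ∀ lam, Dual.IsDecCircuit (D lam))
    (hb : ∀ᶠ lam in atTop, 4 * ((m lam + 1) * β lam *
      ((m lam + 1) * ℓ lam + 1) ^ ((D lam).depth + 1)) < 2 ^ ℓ lam) (L : ℕ → ℕ) :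
    (leveled n m ℓ β D).Correct L := by
  classical
  -- Failures occur at most for the finitely many parameters that violate the noise bound.
  refine ⟨fun lam => if 4 * ((m lam + 1) * β lam *
      ((m lam + 1) * ℓ lam + 1) ^ ((D lam).depth + 1)) < 2 ^ ℓ lam then 0 else 1,
    Negligible.zero.mono (hb.mono fun lam h => by simp [h]), fun lam => ?_⟩
  beta_reduce
  split_ifs with h
  swap
  · exact ⟨fun b => by simpa using PMF.prTrue_nonneg _,
      fun l f b _ => by simpa using PMF.prTrue_nonneg _⟩
  have hfresh : ∀ {A e μ} {c : Bool × CT (m lam) (ℓ lam)},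
      c ∈ ((leveled n m ℓ β D).enc lam (L lam) (Dual.publicKey A e) μ).support →
      c.1 = false ∧ Encrypts e ((m lam + 1) * β lam) c.2 μ := by
    intro A e μ c hc
    obtain ⟨C, hC, rfl⟩ := (PMF.mem_support_map_iff _ _ _).mp hc
    exact ⟨rfl, encrypts_of_mem_support hC⟩
  have hdec : ∀ {e : Dual.SK (m lam)} {μ} {C : CT (m lam) (ℓ lam)},
      Encrypts e ((m lam + 1) * β lam) C μ → dec e C = μ := fun hC =>
    (hC.mono (Nat.le_mul_of_pos_right _ (Nat.pow_pos (Nat.succ_pos _)))).dec_eq (hl lam) h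
  refine ⟨fun b => ?_, fun l f b hf => ?_⟩
  · rw [sub_zero]
    refine (PMF.prTrue_eq_one ?_).ge
    simp only [PMF.monad_bind, PMF.monad_pure, PMF.mem_support_bind_iff,
      PMF.mem_support_pure_iff]
    rintro _ ⟨K, hK, c, hc, rfl⟩
    obtain ⟨e, -, hsk, A, hA⟩ := goodKeys_of_mem_support (hl lam) (hD lam) h hK
    rw [hA] at hc
    obtain ⟨h1, h2⟩ := hfresh hc
    rw [beq_iff_eq]
    change dec (if c.1 then K.2.2.2 else K.2.2.1) c.2 = b
    rw [hsk, h1]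
    exact hdec h2
  · rw [sub_zero]
    refine (PMF.prTrue_eq_one ?_).ge
    simp only [PMF.monad_bind, PMF.monad_pure, PMF.mem_support_bind_iff,
      PMF.mem_support_pure_iff]
    rintro _ ⟨K, hK, c, hc, rfl⟩
    obtain ⟨e, he, hsk, A, hA⟩ := goodKeys_of_mem_support (hl lam) (hD lam) h hK
    rw [hA] at hc
    have h1 := fun i => hfresh (mem_support_of_piPMF hc i)
    rw [beq_iff_eq]
    change dec K.2.2.2 (leveledEval (D lam) K.2.1 f fun i => (c i).2) =
      f.evalBool (fun i => dec (if (c i).1 then K.2.2.2 else K.2.2.1) (c i).2) 0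
    have h2 : (fun i => dec (if (c i).1 then K.2.2.2 else K.2.2.1) (c i).2) = b := by
      funext i
      rw [hsk, (h1 i).1]
      exact hdec (h1 i).2
    rw [h2, hsk]
    exact he.dec_leveledEval (fun i => (h1 i).2) f hf

end DualHE

/-! ### Simulation of encoded circuits -/

namespace Net

theorem eq_inputs {k : ℕ} : ∀ {v : ℕ} (c : Net k v) (h : v = k), h ▸ c = .inputs
  | _, .inputs, _ => rfl
  | _, .gate c _ _, h => absurd (Net.derives (fun a _ : Bool => a) (fun _ => true) c).2 (by omega)

theorem exists_eq_gate {k w : ℕ} (hk : k ≤ w) :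
    ∀ {v : ℕ} (c : Net k v) (h : v = w + 1), ∃ c' a b, h ▸ c = .gate c' a b
  | _, .inputs, h => absurd hk (by omega)
  | _, .gate c a b, h => by
    obtain rfl := Nat.succ.inj h
    exact ⟨c, a, b, rfl⟩

/-- The length of the encoding of a network with `k` inputs and `g` gates. -/
def codeLen (k : ℕ) : ℕ → ℕ
  | 0 => 0
  | g + 1 => codeLen k g + (k + g) + (k + g)

theorem codeLen_le (k g : ℕ) : codeLen k g ≤ g * (2 * (k + g)) := by
  induction g with
  | zero => simp [codeLen]
  | succ g ih =>
    have : g * (2 * (k + g)) ≤ g * (2 * (k + (g + 1))) := Nat.mul_le_mul_left _ (by omega)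
    rw [codeLen, Nat.succ_mul]
    omega

theorem length_encode {k g : ℕ} (c : Net k (k + g)) : c.encode.length = codeLen k g := by
  induction g with
  | zero => rw [show c = .inputs from eq_inputs c rfl]; rfl
  | succ g ih =>
    obtain ⟨c', a, b, h⟩ := exists_eq_gate (Nat.le_add_right k g) c rfl
    rw [show c = .gate c' a b from h, Net.encode, codeLen, List.length_append, List.length_append,
      ih c', List.length_ofFn, List.length_ofFn]
    rfl

end Net

namespace Computes

variable {X : Type} {s : ℕ}

/-- Selection by an indicator vector. -/
theorem oneHot {β : Type} [BitCode β] {k : ℕ} (F : X → Fin k → β) (a : X → Fin k) :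
    Computes ((⋃ i, wires fun x => F x i) ∪ lbits k fun x => List.ofFn fun i => decide (i = a x))
      (BitCode.len β * (k * 5)) (wires fun x => F x (a x)) := by
  refine of_lbits fun t ht => ?_
  have h := any (Finset.univ : Finset (Fin k))
    (F := fun i x => decide (i = a x) && (encode (F x i)).getD t false) fun i _ =>
      (of_mem (B := (⋃ i, wires fun x => F x i) ∪
        lbits k fun x => List.ofFn fun i => decide (i = a x))
        (Or.inr ⟨i, i.2, funext fun x => by simp⟩)).and
      (of_mem (Or.inl (Set.mem_iUnion.mpr ⟨i, t, ht, rfl⟩)))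
  rw [Finset.card_univ, Fintype.card_fin] at h
  refine h.mono_right ?_
  rw [Set.singleton_subset_iff, Set.mem_singleton_iff]
  funext x
  rw [Bool.eq_iff_iff]
  simp

/-- All wires of a network that is itself part of the input, given by its encoding. -/
theorem net_eval_of_encode {β : Type} [BitCode β] {A : Set (X → Bool)} {op : X → β → β → β}
    (hop : ∀ F G : X → β, Computes (A ∪ (wires F ∪ wires G)) s (wires fun x => op x (F x) (G x)))
    {k : ℕ} (inp : X → Fin k → β) (g : ℕ) (net : X → Net k (k + g)) :
    Computes ((A ∪ ⋃ i, wires fun x => inp x i) ∪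
        lbits (Net.codeLen k g) fun x => (net x).encode)
      (g * (2 * (BitCode.len β * ((k + g) * 5)) + s))
      (⋃ j, wires fun x => (net x).eval (op x) (inp x) j) := by
  induction g with
  | zero =>
    have h : ∀ x, net x = .inputs := fun x => Net.eq_inputs (net x) rfl
    simp only [h]
    exact of_subset (Set.subset_union_right.trans Set.subset_union_left)
  | succ g ih =>
    choose c a b h using fun x => Net.exists_eq_gate (Nat.le_add_right k g) (net x) rfl
    obtain rfl : net = fun x => .gate (c x) (a x) (b x) := funext h
    have hcode : (lbits (Net.codeLen k (g + 1)) fun x => (Net.gate (c x) (a x) (b x)).encode) =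
        (lbits (Net.codeLen k g) (fun x => (c x).encode) ∪
          lbits (k + g) fun x => List.ofFn fun i => decide (i = a x)) ∪
          lbits (k + g) fun x => List.ofFn fun i => decide (i = b x) := by
      rw [← lbits_append _ _ _ _ fun x => (c x).length_encode, ← lbits_append]
      · rfl
      · intro x
        rw [List.length_append, Net.length_encode, List.length_ofFn]
    rw [hcode]
    set W := ⋃ j, wires fun x => (c x).eval (op x) (inp x) j with hW
    have h1 := (ih c).mono_left (B' := (A ∪ ⋃ i, wires fun x => inp x i) ∪
      ((lbits (Net.codeLen k g) (fun x => (c x).encode) ∪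
          lbits (k + g) fun x => List.ofFn fun i => decide (i = a x)) ∪
          lbits (k + g) fun x => List.ofFn fun i => decide (i = b x)))
      (Set.union_subset_union_right _ (Set.subset_union_left.trans Set.subset_union_left))
    have h2 := h1.cut_union
      ((((oneHot (fun x j => (c x).eval (op x) (inp x) j) a).mono_left ?_).union
      ((oneHot (fun x j => (c x).eval (op x) (inp x) j) b).mono_left ?_)).cut
      ((hop (fun x => (c x).eval (op x) (inp x) (a x)) fun x =>
        (c x).eval (op x) (inp x) (b x)).mono_left ?_))
    · refine (h2.mono_size ?_).mono_right (Set.iUnion_subset fun j => ?_)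
      · have h3 : BitCode.len β * ((k + g) * 5) ≤ BitCode.len β * ((k + (g + 1)) * 5) :=
          Nat.mul_le_mul_left _ (by omega)
        have h4 := Nat.mul_le_mul_left g (Nat.add_le_add_right (Nat.mul_le_mul_left 2 h3) s)
        have h5 := Nat.succ_mul g (2 * (BitCode.len β * ((k + (g + 1)) * 5)) + s)
        rw [Nat.succ_eq_add_one] at h5
        omega
      · refine Fin.lastCases ?_ (fun j => ?_) j
        · simp only [Net.eval, Fin.snoc_last]
          exact Set.subset_union_right
        · simp only [Net.eval, Fin.snoc_castSucc]
          exact (Set.subset_iUnion (fun j => wires fun x => (c x).eval (op x) (inp x) j) j).trans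
            Set.subset_union_left
    · exact Set.union_subset Set.subset_union_right
        (Set.subset_union_of_subset_left (Set.subset_union_of_subset_right
          (Set.subset_union_right.trans Set.subset_union_left) _) _)
    · exact Set.union_subset Set.subset_union_right
        (Set.subset_union_of_subset_left (Set.subset_union_of_subset_right
          Set.subset_union_right _) _)
    · refine Set.union_subset ?_ Set.subset_union_right
      exact Set.subset_union_of_subset_left (Set.subset_union_of_subset_left
        (Set.subset_union_of_subset_left Set.subset_union_left _) _) _

end Computes

/-! ### Efficiency of evaluation and decryption -/

namespace DualHE

variable {n m ℓ L l : ℕ}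

/-- A gate of the leveled evaluation, on the ciphertexts under the keys `0, …, L`. -/
def levelGate (D : Circuit (m + (m + 1) * ℓ) 1) (evk : EVK n m ℓ L)
    (u v : Fin (L + 1) → CT m ℓ) : Fin (L + 1) → CT m ℓ :=
  Fin.cases 0 fun d => refresh D (evk d).2 (nand (u d.castSucc) (v d.castSucc))

/-- An input of the leveled evaluation under the keys `0, …, L`. -/
def levelInput (D : Circuit (m + (m + 1) * ℓ) 1) (evk : EVK n m ℓ L) (C : CT m ℓ)
    (d : Fin (L + 1)) : CT m ℓ :=
  Nat.rec C (fun d' C => step D evk d' C) d.val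

theorem leveledEval_eq (D : Circuit (m + (m + 1) * ℓ) 1) (evk : EVK n m ℓ L) (f : Circuit l 1)
    (c : Fin l → CT m ℓ) : leveledEval D evk f c =
      f.net.eval (levelGate D evk) (fun i => levelInput D evk (c i)) (f.out 0) (Fin.last L) := by
  have h := Net.eval_map
    (op := fun (u v : ℕ → CT m ℓ) d => match d with
      | 0 => 0
      | d + 1 => step D evk d (nand (u d) (v d)))
    (op' := levelGate D evk) (fun u (d : Fin (L + 1)) => u d) (fun u v => by
      funext d
      refine Fin.cases rfl (fun d => ?_) d
      simp [levelGate, step])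
    (fun i d => Nat.rec (c i) (fun d' C => step D evk d' C) d) f.net (f.out 0)
  exact congrFun h (Fin.last L)

variable {X : Type}

theorem computes_levelGate (D : Circuit (m + (m + 1) * ℓ) 1) (E : X → EVK n m ℓ L)
    (F G : X → Fin (L + 1) → CT m ℓ) :
    Computes (wires E ∪ (wires F ∪ wires G)) ((L + 1) * (nandCost m ℓ + refreshCost m ℓ D.size))
      (wires fun x => levelGate D (E x) (F x) (G x)) := by
  refine Computes.pi fun d => Fin.cases ?_ (fun d => ?_) d
  · exact Computes.wires_const 0
  · have h1 := (computes_nand (fun x => F x d.castSucc) fun x => G x d.castSucc).mono_left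
      (B' := wires E ∪ (wires F ∪ wires G))
      (Set.subset_union_of_subset_right
        (Set.union_subset_union (wires_mono_pi F _) (wires_mono_pi G _)) _)
    refine h1.cut ((computes_refresh D (fun x => (E x d).2)
      fun x => nand (F x d.castSucc) (G x d.castSucc)).mono_left (Set.union_subset_union_left _ ?_))
    exact ((wires_mono_snd fun x => E x d).trans (wires_mono_pi E d)).trans Set.subset_union_left

theorem computes_levelInput (D : Circuit (m + (m + 1) * ℓ) 1) (E : X → EVK n m ℓ L)
    (F : X → CT m ℓ) :
    Computes (wires E ∪ wires F) ((L + 1) * (L * refreshCost m ℓ D.size))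
      (wires fun x => levelInput D (E x) (F x)) := by
  refine Computes.pi fun d => ?_
  have h : ∀ k ≤ L, Computes (wires E ∪ wires F) (k * refreshCost m ℓ D.size)
      (wires fun x => (Nat.rec (F x) (fun d' C => step D (E x) d' C) k : CT m ℓ)) := by
    intro k hk
    induction k with
    | zero => exact Computes.of_subset Set.subset_union_right
    | succ k ih =>
      have hk' : k < L := hk
      simp only [step, hk', dite_true] at ih ⊢
      rw [Nat.succ_mul]
      refine (ih hk'.le).cut ((computes_refresh D (fun x => (E x ⟨k, hk'⟩).2) _).mono_left
        (Set.union_subset_union_left _ ?_))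
      exact ((wires_mono_snd fun x => E x ⟨k, hk'⟩).trans
        (wires_mono_pi E ⟨k, hk'⟩)).trans Set.subset_union_left
  exact (h d (Nat.lt_succ_iff.mp d.2)).mono_size
    (Nat.mul_le_mul_right _ (Nat.lt_succ_iff.mp d.2))

/-- The size of a circuit for the evaluation of circuits with `l` inputs and `g` gates. -/
def evalCost (m ℓ L d l g : ℕ) : ℕ :=
  l * ((L + 1) * (L * refreshCost m ℓ d)) +
    (g * (2 * ((L + 1) * BitCode.len (CT m ℓ) * ((l + g) * 5)) +
      (L + 1) * (nandCost m ℓ + refreshCost m ℓ d)) +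
    (L + 1) * BitCode.len (CT m ℓ) * ((l + g) * 5))

theorem exists_circuit_leveledEval (D : Circuit (m + (m + 1) * ℓ) 1) (n L l g : ℕ) :
    ∃ (k o : ℕ) (U : Circuit k o),
      U.size ≤ BitCode.len (EVK n m ℓ L) + (Net.codeLen l g + (l + g)) +
        l * BitCode.len (Bool × CT m ℓ) + evalCost m ℓ L D.size l g + 2 +
        BitCode.len (Bool × CT m ℓ) ∧
      ∀ (evk : EVK n m ℓ L) (f : Circuit l 1) (c : Fin l → Bool × CT m ℓ), f.width = l + g →
        U.run (encode evk ++ f.encode ++ encode c) =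
          encode (true, leveledEval D evk f fun i => (c i).2) := by
  let X := EVK n m ℓ L × (Net l (l + g) × (Fin 1 → Fin (l + g))) × (Fin l → Bool × CT m ℓ)
  let E : X → EVK n m ℓ L := fun x => x.1
  let K : X → Circuit l 1 := fun x => ⟨l + g, x.2.1.1, x.2.1.2⟩
  let c : X → Fin l → Bool × CT m ℓ := fun x => x.2.2
  let out : X → List Bool := fun x => List.ofFn fun i => decide (i = x.2.1.2 0)
  have hK : ∀ x, (K x).encode = x.2.1.1.encode ++ out x := fun x => by
    simp [K, Circuit.encode, out]
  have hlen1 : ∀ x : X, (x.2.1.1.encode ++ out x).length = Net.codeLen l g + (l + g) := fun x => by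
    rw [List.length_append, Net.length_encode, List.length_ofFn]
  have hlen2 : ∀ x : X, (encode (E x) ++ (K x).encode).length =
      BitCode.len (EVK n m ℓ L) + (Net.codeLen l g + (l + g)) := fun x => by
    rw [List.length_append, BitCode.length_encode, hK, hlen1]
  have hstr : lbits (BitCode.len (EVK n m ℓ L) + (Net.codeLen l g + (l + g)) +
      l * BitCode.len (Bool × CT m ℓ)) (fun x => encode (E x) ++ (K x).encode ++ encode (c x)) =
      wires E ∪ (lbits (Net.codeLen l g) (fun x : X => x.2.1.1.encode) ∪ lbits (l + g) out) ∪
        wires c := by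
    rw [lbits_append _ _ _ _ hlen2, lbits_append _ _ _ _ fun x => BitCode.length_encode (E x),
      ← lbits_append _ _ _ _ fun x : X => x.2.1.1.length_encode]
    simp only [hK]
    rfl
  set B := wires E ∪ (lbits (Net.codeLen l g) (fun x : X => x.2.1.1.encode) ∪ lbits (l + g) out) ∪
        wires c
  have hE : wires E ⊆ B := Set.subset_union_left.trans Set.subset_union_left
  have h1 := Computes.iUnion fun i => (computes_levelInput D E fun x => (c x i).2).mono_left
    (B' := B) (Set.union_subset hE (((wires_mono_snd fun x => c x i).trans
      (wires_mono_pi c i)).trans Set.subset_union_right))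
  rw [Fintype.card_fin] at h1
  have h2 := Computes.net_eval_of_encode (A := wires E) (op := fun x => levelGate D (E x))
    (computes_levelGate D E) (fun x i => levelInput D (E x) (c x i).2) g fun x : X => x.2.1.1
  have h3 := Computes.oneHot (fun (x : X) j => x.2.1.1.eval (levelGate D (E x))
    (fun i => levelInput D (E x) (c x i).2) j) fun x : X => x.2.1.2 0
  have h4 := h1.cut ((h2.mono_left ?_).cut (h3.mono_left ?_))
  · have h5 := (Computes.wires_const (B := B) (s := 0) true).prod (h4.proj (Fin.last L))
    rw [← hstr] at h5
    obtain ⟨U, hU, hrun⟩ := h5.exists_circuit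
      (str := fun x => encode (E x) ++ (K x).encode ++ encode (c x))
      (fun x => by rw [List.length_append, hlen2, BitCode.length_encode]; rfl)
      fun x => BitCode.length_encode _
    refine ⟨_, _, U, hU.trans (le_of_eq ?_), fun evk f c hf => ?_⟩
    · rw [Nat.zero_add]
      rfl
    · obtain ⟨w, net, o⟩ := f
      obtain rfl : w = l + g := hf
      rw [leveledEval_eq]
      exact hrun (evk, (net, o), c)
  · refine Set.union_subset (Set.union_subset_union hE (Set.iUnion_subset fun i => ?_)) ?_
    · exact Set.subset_iUnion (fun i => wires fun x => levelInput D (E x) (c x i).2) i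
    · exact Set.subset_union_of_subset_left ((Set.subset_union_left.trans
        Set.subset_union_right).trans Set.subset_union_left) _
  · refine Set.union_subset Set.subset_union_right (Set.subset_union_of_subset_left
      (Set.subset_union_of_subset_left ?_ _) _)
    exact (Set.subset_union_right.trans Set.subset_union_right).trans Set.subset_union_left

theorem evalPolyTime_leveled {n m ℓ β : ℕ → ℕ}
    {D : ∀ lam, Circuit (m lam + (m lam + 1) * ℓ lam) 1} (hn : PolyBd id n) (hm : PolyBd id m)
    (hl : PolyBd id ℓ) (hD : PolyBd id fun lam => (D lam).size) {L : ℕ → ℕ} (hL : PolyBd id L) :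
    (leveled n m ℓ β D).EvalPolyTime L := by
  let μ : ℕ × ℕ × ℕ → ℕ := fun x => x.1 + (x.2.1 + x.2.2)
  have lift : ∀ {f : ℕ → ℕ}, PolyBd id f → PolyBd μ fun x => f x.1 := fun h =>
    h.lift (fun x : ℕ × ℕ × ℕ => x.1) fun x => Nat.le_add_right _ _
  have hl' : PolyBd μ fun x => x.2.1 := PolyBd.self.mono fun x => by simp only [μ]; omega
  have hg' : PolyBd μ fun x => x.2.2 := PolyBd.self.mono fun x => by simp only [μ]; omega
  have hlg := hl'.add hg'
  have c := fun k => PolyBd.const (μ := μ) k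
  have hm1 := (lift hm).add (c 1)
  have hL1 := (lift hL).add (c 1)
  have hct : PolyBd μ fun x => BitCode.len (CT (m x.1) (ℓ x.1)) :=
    hm1.mul (hm1.mul ((lift hl).mul (lift hl)))
  have hct' : PolyBd μ fun x => BitCode.len (Bool × CT (m x.1) (ℓ x.1)) := (c 1).add hct
  have hnand : PolyBd μ fun x => nandCost (m x.1) (ℓ x.1) :=
    hm1.mul (hm1.mul ((lift hl).mul (((hm1.mul (lift hl)).mul ((c 40).mul (lift hl))).add
      ((c 65).mul (lift hl)))))
  have href : PolyBd μ fun x => refreshCost (m x.1) (ℓ x.1) (D x.1).size :=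
    ((hm1.mul (lift hl)).mul (hct.mul (c 8))).add ((lift hD).mul hnand)
  have hpk : PolyBd μ fun x => BitCode.len (Dual.PK (n x.1) (m x.1) (ℓ x.1)) :=
    hm1.mul ((lift hn).mul (lift hl))
  have hevk : PolyBd μ fun x => BitCode.len (EVK (n x.1) (m x.1) (ℓ x.1) (L x.1)) :=
    (lift hL).mul (hpk.add ((lift hm).mul hct))
  have hcode : PolyBd μ fun x => Net.codeLen x.2.1 x.2.2 :=
    (hg'.mul ((c 2).mul hlg)).mono fun x => Net.codeLen_le _ _
  have hcost : PolyBd μ fun x => evalCost (m x.1) (ℓ x.1) (L x.1) (D x.1).size x.2.1 x.2.2 :=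
    (hl'.mul (hL1.mul ((lift hL).mul href))).add
      ((hg'.mul (((c 2).mul ((hL1.mul hct).mul (hlg.mul (c 5)))).add
        (hL1.mul (hnand.add href)))).add ((hL1.mul hct).mul (hlg.mul (c 5))))
  obtain ⟨p, hp⟩ := ((((hevk.add (hcode.add hlg)).add (hl'.mul hct')).add hcost).add (c 2)).add hct'
  refine ⟨p + 1, fun lam l w => ?_⟩
  rcases Nat.lt_or_ge w l with h | h
  · -- No circuit with `l` inputs has fewer than `l` wires.
    refine ⟨1, 0, ⟨1, .inputs, Fin.elim0⟩, by simp [Circuit.size], fun _ f _ hf => ?_⟩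
    have := (Net.derives (fun a _ : Bool => a) (fun _ => true) f.net).2
    omega
  · obtain ⟨k, o, U, hU, hrun⟩ :=
      exists_circuit_leveledEval (D lam) (n lam) (L lam) l (w - l)
    refine ⟨k, o, U, ?_, fun evk f c hf _ => hrun evk f c (by omega)⟩
    have h1 := hp (lam, l, w - l)
    have h2 : μ (lam, l, w - l) = lam + w := by simp only [μ, Nat.add_sub_cancel' h]
    rw [h2] at h1
    rw [Polynomial.eval_add]
    exact (hU.trans h1).trans (Nat.le_add_right _ _)

theorem compact_leveled {n m ℓ β : ℕ → ℕ}
    {D : ∀ lam, Circuit (m lam + (m lam + 1) * ℓ lam) 1} (hm : PolyBd id m) (hl : PolyBd id ℓ) :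
    (leveled n m ℓ β D).Compact := by
  have hm1 := hm.add (PolyBd.const 1)
  obtain ⟨s, hs⟩ := (PolyBd.const (μ := id) 1).add (hm1.mul (hm1.mul (hl.mul hl)))
  exact ⟨s, fun lam L l evk f c => (BitCode.length_encode _).trans_le (hs lam)⟩

theorem isPolyTime_dec_leveled {m ℓ : ℕ → ℕ}
    {D : ∀ lam, Circuit (m lam + (m lam + 1) * ℓ lam) 1} (hm : PolyBd id m) (hl : PolyBd id ℓ)
    (hDec : ∀ lam, Dual.IsDecCircuit (D lam)) (hD : PolyBd id fun lam => (D lam).size) :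
    IsPolyTime (α := fun lam => (Dual.SK (m lam) × Dual.SK (m lam)) × Bool × CT (m lam) (ℓ lam))
      (β := fun _ => Bool) fun lam
        (a : (Dual.SK (m lam) × Dual.SK (m lam)) × Bool × CT (m lam) (ℓ lam)) =>
        dec (if a.2.1 then a.1.2 else a.1.1) a.2.2 := by
  have key : ∀ lam, ∃ C : Circuit (BitCode.len ((Dual.SK (m lam) × Dual.SK (m lam)) ×
      Bool × CT (m lam) (ℓ lam)) + 1) 1,
      C.size ≤ BitCode.len ((Dual.SK (m lam) × Dual.SK (m lam)) × Bool × CT (m lam) (ℓ lam)) +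
        (m lam * 1 * 8 + (D lam).size) + 2 + 1 ∧
      ∀ a : (Dual.SK (m lam) × Dual.SK (m lam)) × Bool × CT (m lam) (ℓ lam),
        C.run (encode a) = encode (dec (if a.2.1 then a.1.2 else a.1.1) a.2.2) := by
    intro lam
    refine Computes.exists_circuit (fun a => BitCode.length_encode a)
      (fun a => BitCode.length_encode _) ?_
    let X := (Dual.SK (m lam) × Dual.SK (m lam)) × Bool × CT (m lam) (ℓ lam)
    change Computes (wires fun a : X => a) _
      (wires fun a : X => dec (if a.2.1 then a.1.2 else a.1.1) a.2.2)
    have h0 : Computes (wires fun a : X => a) 0 (wires fun a : X => a) := .wires_self _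
    have h1 := (Computes.bool.mp h0.snd.fst).select h0.fst.snd h0.fst.fst
    rw [Computes.bool]
    refine (h1.cut ((computes_dec (hDec lam)
      (fun a : X => if a.2.1 then a.1.2 else a.1.1) fun a => a.2.2).mono_left ?_)).mono_size ?_
    · exact Set.union_subset Set.subset_union_right (Set.subset_union_of_subset_left
        ((wires_mono_snd fun a : X => a.2).trans (wires_mono_snd fun a : X => a)) _)
    · change 0 + 0 + 0 + m lam * 1 * 8 + _ ≤ _
      omega
  choose C hC hrun using key
  refine ⟨_, _, C, ?_, hrun⟩
  have c := fun k => PolyBd.const (μ := id) k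
  have hm1 := hm.add (c 1)
  have hsk := hm.mul (c 1)
  have hct := hm1.mul (hm1.mul (hl.mul hl))
  exact (((((hsk.add hsk).add ((c 1).add hct)).add ((hsk.mul (c 8)).add hD)).add (c 2)).add
    (c 1)).mono hC

end DualHE

/-! ### Samplable distributions -/

theorem Computes.comp {X Y α β : Type} [BitCode α] [BitCode β] {s : ℕ} {G : X → β} {F : X → α}
    (h : Computes (wires G) s (wires F)) (ψ : Y → X) :
    Computes (wires fun y => G (ψ y)) s (wires fun y => F (ψ y)) := by
  have key : ∀ {γ : Type} [BitCode γ] (H : X → γ),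
      (· ∘ ψ) '' wires H = wires fun y => H (ψ y) := by
    intro γ _ H
    ext g
    constructor
    · rintro ⟨_, ⟨i, hi, rfl⟩, rfl⟩
      exact ⟨i, hi, rfl⟩
    · rintro ⟨i, hi, rfl⟩
      exact ⟨_, ⟨i, hi, rfl⟩, rfl⟩
  have h1 := h.image ψ
  rwa [key, key] at h1

/-- Families of distributions which circuits of polynomial size sample from uniform coins, up to
negligible total variation distance, uniformly in an index `i : I lam`. -/
def Samplable {I α : ℕ → Type} [∀ lam, BitCode (α lam)] (P : ∀ lam, I lam → PMF (α lam)) : Prop :=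
  ∃ (r s : ℕ → ℕ) (ε : ℕ → ℝ), PolyBd id r ∧ PolyBd id s ∧ Negligible ε ∧ ∀ lam i,
    ∃ φ : (Fin (r lam) → Bool) → α lam,
      Computes (wires fun u : Fin (r lam) → Bool => u) (s lam) (wires φ) ∧
      tvDist ((PMF.uniformOfFintype (Fin (r lam) → Bool)).map φ) (P lam i) ≤ ε lam

theorem uniform_append (a b : ℕ) : PMF.uniformOfFintype (Fin (a + b) → Bool) =
    (PMF.uniformOfFintype (Fin a → Bool)).bind fun u =>
      (PMF.uniformOfFintype (Fin b → Bool)).map fun v => Fin.append u v := by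
  rw [← uniform_map_equiv (Fin.appendEquiv (α := Bool) a b), uniform_prod, PMF.map_bind]
  simp only [PMF.map_comp]
  rfl

namespace Samplable

variable {I J α β : ℕ → Type} [∀ lam, BitCode (α lam)] [∀ lam, BitCode (β lam)]
  {P : ∀ lam, I lam → PMF (α lam)} {Q : ∀ lam, I lam → PMF (β lam)}

theorem reindex (hP : Samplable P) (g : ∀ lam, J lam → I lam) :
    Samplable fun lam j => P lam (g lam j) := by
  obtain ⟨r, s, ε, hr, hs, hε, h⟩ := hP
  exact ⟨r, s, ε, hr, hs, hε, fun lam j => h lam (g lam j)⟩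

theorem map [∀ lam, Fintype (α lam)] (hP : Samplable P)
    {F : ∀ lam, I lam → α lam → β lam} {s : ℕ → ℕ} (hs : PolyBd id s)
    (hF : ∀ lam i, Computes (wires fun a : α lam => a) (s lam) (wires (F lam i))) :
    Samplable fun lam i => (P lam i).map (F lam i) := by
  obtain ⟨r, s', ε, hr, hs', hε, h⟩ := hP
  refine ⟨r, _, ε, hr, hs'.add hs, hε, fun lam i => ?_⟩
  obtain ⟨φ, hφ, ht⟩ := h lam i
  refine ⟨fun u => F lam i (φ u), hφ.trans ((hF lam i).comp φ), ?_⟩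
  have := tvDist_map_le ((PMF.uniformOfFintype (Fin (r lam) → Bool)).map φ) (P lam i) (F lam i)
  rw [PMF.map_comp] at this
  exact this.trans ht

theorem prod [∀ lam, Fintype (α lam)] [∀ lam, Fintype (β lam)] (hP : Samplable P)
    (hQ : Samplable Q) :
    Samplable fun lam i => (P lam i).bind fun a => (Q lam i).map fun b => (a, b) := by
  obtain ⟨r, s, ε, hr, hs, hε, h⟩ := hP
  obtain ⟨r', s', ε', hr', hs', hε', h'⟩ := hQ
  refine ⟨_, _, _, hr.add hr', hs.add hs', hε.add hε', fun lam i => ?_⟩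
  obtain ⟨φ, hφ, ht⟩ := h lam i
  obtain ⟨φ', hφ', ht'⟩ := h' lam i
  refine ⟨fun u => (φ fun j => u (Fin.castAdd _ j), φ' fun j => u (Fin.natAdd _ j)), ?_, ?_⟩
  · refine Computes.prod
      ((hφ.comp fun u : Fin (r lam + r' lam) → Bool => fun j => u (Fin.castAdd _ j)).mono_left ?_)
      ((hφ'.comp fun u : Fin (r lam + r' lam) → Bool => fun j => u (Fin.natAdd _ j)).mono_left ?_)
    · rw [wires_pi]
      exact Set.iUnion_subset fun j => wires_mono_pi (fun u : Fin (r lam + r' lam) → Bool => u) _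
    · rw [wires_pi]
      exact Set.iUnion_subset fun j => wires_mono_pi (fun u : Fin (r lam + r' lam) → Bool => u) _
  · have h1 : (PMF.uniformOfFintype (Fin (r lam + r' lam) → Bool)).map
        (fun u => (φ fun j => u (Fin.castAdd _ j), φ' fun j => u (Fin.natAdd _ j))) =
        ((PMF.uniformOfFintype (Fin (r lam) → Bool)).map φ).bind fun a =>
          ((PMF.uniformOfFintype (Fin (r' lam) → Bool)).map φ').map fun b => (a, b) := by
      rw [uniform_append, PMF.map_bind, PMF.bind_map]
      simp only [PMF.map_comp, Function.comp_def, Fin.append_left, Fin.append_right]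
    rw [h1]
    exact (tvDist_triangle _ _ _).trans (add_le_add ((tvDist_bind_le _ _ _).trans ht)
      (tvDist_bind_right_le_of_forall _ _ _ fun a => (tvDist_map_le _ _ _).trans ht'))

theorem pi [∀ lam, Fintype (α lam)] {k : ℕ → ℕ} (hk : PolyBd id k)
    {P : ∀ lam, I lam × Fin (k lam) → PMF (α lam)}
    (hP : Samplable P) : Samplable fun lam i => piPMF fun j => P lam (i, j) := by
  obtain ⟨r, s, ε, hr, hs, hε, h⟩ := hP
  refine ⟨_, _, _, hk.mul hr, hk.mul hs, hε.mul_nat hk, fun lam i => ?_⟩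
  choose φ hφ ht using fun j => h lam (i, j)
  let e : (Fin (k lam * r lam) → Bool) ≃ (Fin (k lam) → Fin (r lam) → Bool) :=
    (Equiv.arrowCongr finProdFinEquiv.symm (Equiv.refl Bool)).trans (Equiv.curry _ _ _)
  refine ⟨fun u j => φ j (e u j), Computes.pi fun j => ?_, ?_⟩
  · refine ((hφ j).comp fun u => e u j).mono_left ?_
    rw [wires_pi]
    exact Set.iUnion_subset fun j' => wires_mono_pi (fun u : Fin (k lam * r lam) → Bool => u)
      (finProdFinEquiv (j, j'))
  · have h1 : (PMF.uniformOfFintype (Fin (k lam * r lam) → Bool)).map (fun u j => φ j (e u j)) =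
        piPMF fun j => (PMF.uniformOfFintype (Fin (r lam) → Bool)).map (φ j) := by
      rw [piPMF_map, ← uniform_pi, ← uniform_map_equiv e, PMF.map_comp]
      rfl
    rw [h1]
    simpa using tvDist_piPMF_const_le _ _ ht

theorem of_tvDist (hP : Samplable P) {P' : ∀ lam, I lam → PMF (α lam)} {δ : ℕ → ℝ}
    (hδ : Negligible δ) (h : ∀ᶠ lam in atTop, ∀ i, tvDist (P lam i) (P' lam i) ≤ δ lam) :
    Samplable P' := by
  classical
  obtain ⟨r, s, ε, hr, hs, hε, h'⟩ := hP
  refine ⟨r, s, fun lam => ε lam + if ∀ i, tvDist (P lam i) (P' lam i) ≤ δ lam then δ lam else 1,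
    hr, hs, hε.add ?_, fun lam i => ?_⟩
  · refine SuperpolynomialDecay.congr' hδ (h.mono fun lam hl => ?_)
    exact (if_pos hl).symm
  · obtain ⟨φ, hφ, ht⟩ := h' lam i
    refine ⟨φ, hφ, (tvDist_triangle _ _ _).trans (add_le_add ht ?_)⟩
    split_ifs with hl
    · exact hl i
    · exact tvDist_le_one _ _

end Samplable

/-- The encoding of `V` by bit strings uses all strings. -/
def FullCode (V : Type) [BitCode V] [Fintype V] : Prop := Fintype.card V = 2 ^ BitCode.len V

namespace FullCode

variable {V W : Type} [Fintype V] [Fintype W]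

theorem bool : FullCode Bool := rfl

theorem zq (ℓ : ℕ) : FullCode (Zq ℓ) := ZMod.card _

theorem prod [BitCode V] [BitCode W] (hV : FullCode V) (hW : FullCode W) : FullCode (V × W) := by
  rw [FullCode, Fintype.card_prod, hV, hW, ← pow_add]
  rfl

theorem pi [BitCode V] {k : ℕ} (hV : FullCode V) : FullCode (Fin k → V) := by
  rw [FullCode, Fintype.card_fun, hV, Fintype.card_fin, ← pow_mul, mul_comm]
  rfl

theorem pi_prod [BitCode V] {k l : ℕ} (hV : FullCode V) : FullCode (Fin k × Fin l → V) := by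
  rw [FullCode, Fintype.card_fun, hV, Fintype.card_prod, Fintype.card_fin, Fintype.card_fin,
    ← pow_mul, mul_comm, mul_assoc]
  rfl

theorem matrix {k : ℕ} {ι : Type} [Fintype ι] [DecidableEq ι] [BitCode (ι → V)]
    (hV : FullCode (ι → V)) : FullCode (Matrix (Fin k) ι V) :=
  pi (V := ι → V) hV

end FullCode

theorem encode_bits {r : ℕ} (u : Fin r → Bool) : encode u = List.ofFn u := by
  change (List.ofFn fun i => [u i]).flatten = _
  induction r with
  | zero => simp
  | succ r ih =>
    rw [List.ofFn_succ, List.flatten_cons, ih fun i => u i.succ, List.ofFn_succ]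
    rfl

theorem Samplable.uniform {I V : ℕ → Type} [∀ lam, BitCode (V lam)] [∀ lam, Fintype (V lam)]
    [∀ lam, Nonempty (V lam)] (hV : ∀ lam, FullCode (V lam))
    (hlen : PolyBd id fun lam => BitCode.len (V lam)) :
    Samplable fun lam (_ : I lam) => PMF.uniformOfFintype (V lam) := by
  refine ⟨_, fun _ => 0, fun _ => 0, hlen, .const 0, .zero, fun lam _ => ?_⟩
  let enc : V lam → Fin (BitCode.len (V lam)) → Bool := fun v i => (encode v).getD i false
  have henc : ∀ v, List.ofFn (enc v) = encode v := by
    intro v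
    apply List.ext_getElem
    · simp [BitCode.length_encode]
    · intro i h1 h2
      simp [enc, h2]
  have hinj : Function.Injective enc := fun v w h =>
    BitCode.encode_injective (by rw [← henc, ← henc, h])
  have hb : Function.Bijective enc :=
    (Fintype.bijective_iff_injective_and_card enc).mpr ⟨hinj, by rw [hV lam]; simp⟩
  let e := Equiv.ofBijective enc hb
  refine ⟨e.symm, ?_, ?_⟩
  · refine Computes.of_subset ?_
    rintro _ ⟨i, hi, rfl⟩
    refine ⟨i, by simpa [BitCode.len] using hi, funext fun u => ?_⟩
    beta_reduce
    rw [encode_bits, ← henc]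
    exact congrArg (fun u => (List.ofFn u).getD i false) (e.apply_symm_apply u)
  · rw [uniform_map_equiv, tvDist_self]

/-! ### Biased coins -/

/-- A coin with bias `p` from `k` fair coins, up to an error of `2 ^ (-k)`: the first fair coin
decides half of the cases, the others continue with the bias of the remaining half. -/
noncomputable def biasedCoin : (k : ℕ) → ℝ → (Fin k → Bool) → Bool
  | 0, _, _ => false
  | k + 1, p, u =>
    open Classical in
    if 1 / 2 ≤ p then (if u 0 then biasedCoin k (2 * p - 1) fun i => u i.succ else true)
    else (if u 0 then false else biasedCoin k (2 * p) fun i => u i.succ)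

theorem abs_prTrue_biasedCoin_sub_le (k : ℕ) {p : ℝ} (h0 : 0 ≤ p) (h1 : p ≤ 1) :
    |((PMF.uniformOfFintype (Fin k → Bool)).map (biasedCoin k p)).prTrue - p| ≤ (1 / 2) ^ k := by
  induction k generalizing p with
  | zero =>
    have : (PMF.uniformOfFintype (Fin 0 → Bool)).map (biasedCoin 0 p) = PMF.pure false := by
      rw [show biasedCoin 0 p = Function.const _ false from rfl, PMF.map_const]
    rw [this, PMF.prTrue, PMF.pure_apply]
    simpa [abs_of_nonneg h0] using h1
  | succ k ih =>
    have h2 : (PMF.uniformOfFintype (Fin (k + 1) → Bool)).map (biasedCoin (k + 1) p) =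
        (PMF.uniformOfFintype Bool).bind fun b =>
          (PMF.uniformOfFintype (Fin k → Bool)).map fun u =>
            biasedCoin (k + 1) p (Fin.cons (α := fun _ => Bool) b u) := by
      rw [uniform_pi, piPMF_cons, PMF.map_bind]
      simp only [PMF.map_comp, ← uniform_pi]
      rfl
    rw [h2, PMF.prTrue, PMF.bind_apply_toReal, Fintype.sum_bool]
    have hu : ∀ b, ((PMF.uniformOfFintype Bool) b).toReal = 1 / 2 := by simp
    have hc : ∀ c : Bool, (PMF.uniformOfFintype (Fin k → Bool)).map (fun _ => c) = PMF.pure c :=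
      fun c => PMF.map_const _ _
    simp only [hu, biasedCoin, Fin.cons_zero, Fin.cons_succ, if_true, Bool.false_eq_true, if_false]
    split_ifs with hp
    · have h3 := ih (p := 2 * p - 1) (by linarith) (by linarith)
      rw [PMF.prTrue] at h3
      rw [hc, PMF.pure_apply, if_pos rfl, ENNReal.toReal_one, pow_succ]
      rw [abs_le] at h3 ⊢
      constructor <;> linarith [h3.1, h3.2]
    · have h3 := ih (p := 2 * p) (by linarith) (by linarith)
      rw [PMF.prTrue] at h3
      rw [hc, PMF.pure_apply, if_neg (by simp), ENNReal.toReal_zero, pow_succ]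
      rw [abs_le] at h3 ⊢
      constructor <;> linarith [h3.1, h3.2]

theorem computes_biasedCoin {X : Type} (k : ℕ) (p : ℝ) (U : X → Fin k → Bool) :
    Computes (wires U) (8 * k) {fun x => biasedCoin k p (U x)} := by
  induction k generalizing p with
  | zero => exact (Computes.const false)
  | succ k ih =>
    have h0 : Computes (wires U) 0 {fun x => U x 0} :=
      Computes.bool.mp ((Computes.wires_self U).proj 0)
    have h1 := fun p => (ih p fun x i => U x i.succ).mono_left (B' := wires U) (by
      rw [wires_pi fun x (i : Fin k) => U x i.succ]
      exact Set.iUnion_subset fun i => wires_mono_pi U i.succ)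
    simp only [biasedCoin]
    split_ifs
    · exact (h0.ite (h1 _) (Computes.const true)).mono_size (by omega)
    · exact (h0.ite (Computes.const false) (h1 _)).mono_size (by omega)

theorem tvDist_bool (p q : PMF Bool) : tvDist p q = |p.prTrue - q.prTrue| := by
  have h := p.sum_toReal
  have h' := q.sum_toReal
  rw [Fintype.sum_bool] at h h'
  rw [tvDist, tsum_fintype, Fintype.sum_bool, PMF.prTrue, PMF.prTrue,
    show (p false).toReal - (q false).toReal = -((p true).toReal - (q true).toReal) by linarith,
    abs_neg]
  ring

theorem PMF.prTrue_le_one (p : PMF Bool) : p.prTrue ≤ 1 := by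
  have h := p.sum_toReal
  rw [Fintype.sum_bool] at h
  have := ENNReal.toReal_nonneg (a := p false)
  rw [PMF.prTrue]
  linarith

theorem samplable_bool : Samplable (I := fun _ => PMF Bool) fun _ b => b := by
  refine ⟨id, fun lam => 8 * lam, fun lam => (1 / 2) ^ lam, .self, (PolyBd.const 8).mul .self,
    .geometric (by norm_num) (by norm_num), fun lam b => ⟨biasedCoin lam b.prTrue, ?_, ?_⟩⟩
  · rw [Computes.bool]
    exact computes_biasedCoin lam _ _
  · rw [tvDist_bool]
    exact abs_prTrue_biasedCoin_sub_le lam b.prTrue_nonneg b.prTrue_le_one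

/-! ### Sampling and probabilistic polynomial time -/

theorem Samplable.isPPT {α β γ : ℕ → Type} [∀ lam, BitCode (α lam)] [∀ lam, BitCode (β lam)]
    [∀ lam, BitCode (γ lam)] [∀ lam, Fintype (β lam)]
    {P : ∀ lam, Unit → PMF (β lam)} (hP : Samplable P) {F : ∀ lam, α lam → β lam → γ lam}
    {s : ℕ → ℕ} (hs : PolyBd id s)
    (hF : ∀ lam, Computes (wires fun x : α lam × β lam => x) (s lam)
      (wires fun x : α lam × β lam => F lam x.1 x.2))
    (hα : PolyBd id fun lam => BitCode.len (α lam))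
    (hγ : PolyBd id fun lam => BitCode.len (γ lam)) :
    IsPPT fun lam a => (P lam ()).map (F lam a) := by
  obtain ⟨r, s', ε, hr, hs', hε, h⟩ := hP
  choose φ hφ ht using fun lam => h lam ()
  have key : ∀ lam, ∃ C : Circuit (BitCode.len (α lam × (Fin (r lam) → Bool)) + 1)
      (BitCode.len (γ lam)),
      C.size ≤ BitCode.len (α lam × (Fin (r lam) → Bool)) + (s' lam + s lam) + 2 +
        BitCode.len (γ lam) ∧
      ∀ x : α lam × (Fin (r lam) → Bool), C.run (encode x) = encode (F lam x.1 (φ lam x.2)) := by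
    intro lam
    refine Computes.exists_circuit (fun x => BitCode.length_encode x)
      (fun x => BitCode.length_encode _) ?_
    change Computes (wires fun x : α lam × (Fin (r lam) → Bool) => x) _
      (wires fun x : α lam × (Fin (r lam) → Bool) => F lam x.1 (φ lam x.2))
    have h1 := ((hφ lam).comp fun x : α lam × (Fin (r lam) → Bool) => x.2).mono_left
      (wires_mono_snd _)
    have h2 := (hF lam).comp fun x : α lam × (Fin (r lam) → Bool) => (x.1, φ lam x.2)
    refine h1.cut (h2.mono_left ?_)
    rw [wires_prod fun x : α lam × (Fin (r lam) → Bool) => (x.1, φ lam x.2)]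
    exact Set.union_subset_union_left _
      (wires_mono_fst fun x : α lam × (Fin (r lam) → Bool) => x)
  choose C hC hrun using key
  refine ⟨_, _, r, C, ε, ?_, hε, fun lam a => ?_⟩
  · have hr' : PolyBd id fun lam => BitCode.len (Fin (r lam) → Bool) := hr.mul (.const 1)
    exact ((((hα.add hr').add (hs'.add hs)).add (.const 2)).add hγ).mono hC
  · have h1 : (fun coins => (C lam).run (encode a ++ List.ofFn coins)) =
        (fun b => encode (F lam a b)) ∘ φ lam := by
      funext u
      rw [← encode_bits]
      exact hrun lam (a, u)
    have h2 : ((P lam ()).map (F lam a)).map encode =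
        (P lam ()).map fun b => encode (F lam a b) := PMF.map_comp _ _ _
    change tvDist _ (((P lam ()).map (F lam a)).map encode) ≤ _
    rw [h1, ← PMF.map_comp, h2]
    exact (tvDist_map_le _ _ _).trans (ht lam)

/-! ### Rejection sampling -/

/-- The first accepted value among independent attempts, and `0` if there is none. -/
def firstAccepted {α : Type} [Zero α] : (T : ℕ) → (Fin T → Bool × α) → α
  | 0, _ => 0
  | T + 1, v => if (v 0).1 then (v 0).2 else firstAccepted T fun i => v i.succ

theorem piPMF_map_firstAccepted_succ {α : Type} [Zero α] [Fintype α] (P : PMF (Bool × α)) (T : ℕ) :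
    (piPMF fun _ : Fin (T + 1) => P).map (firstAccepted (T + 1)) = P.bind fun o =>
      if o.1 then PMF.pure o.2 else (piPMF fun _ : Fin T => P).map (firstAccepted T) := by
  rw [piPMF_cons, PMF.map_bind]
  refine congrArg _ (funext fun o => ?_)
  simp only [PMF.map_comp, Function.comp_def, firstAccepted, Fin.cons_zero, Fin.cons_succ]
  split_ifs
  · exact PMF.map_const _ _
  · rfl

/-- If an attempt accepts `x` with probability `a * g x`, then `T` attempts sample `g` up to an
error of `(1 - a) ^ T`. -/
theorem tvDist_firstAccepted_le {α : Type} [Zero α] [Fintype α] {P : PMF (Bool × α)} {g : PMF α}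
    {a : ℝ} (h : ∀ x, (P (true, x)).toReal = a * (g x).toReal) (T : ℕ) :
    tvDist ((piPMF fun _ : Fin T => P).map (firstAccepted T)) g ≤ (1 - a) ^ T := by
  classical
  have hsum := P.sum_toReal
  rw [Fintype.sum_prod_type, Fintype.sum_bool] at hsum
  simp only [h, ← Finset.mul_sum, g.sum_toReal, mul_one] at hsum
  -- `g` is a fixed point of one more attempt.
  have hfix : g = P.bind fun o => if o.1 then PMF.pure o.2 else g := by
    ext x
    rw [← ENNReal.toReal_eq_toReal_iff' (PMF.apply_ne_top _ _) (PMF.apply_ne_top _ _),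
      PMF.bind_apply_toReal, Fintype.sum_prod_type, Fintype.sum_bool]
    simp only [if_true, Bool.false_eq_true, if_false, ← Finset.sum_mul]
    rw [Finset.sum_eq_single x]
    · rw [h, PMF.pure_apply, if_pos rfl, ENNReal.toReal_one]
      linear_combination (-(g x).toReal) * hsum
    · intro y _ hy
      rw [PMF.pure_apply, if_neg hy.symm, ENNReal.toReal_zero, mul_zero]
    · simp
  induction T with
  | zero => simpa using tvDist_le_one _ _
  | succ T ih =>
    rw [piPMF_map_firstAccepted_succ]
    refine (le_of_eq (congrArg _ hfix)).trans ((tvDist_bind_right_le _ _ _).trans ?_)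
    rw [Fintype.sum_prod_type, Fintype.sum_bool]
    simp only [if_true, Bool.false_eq_true, if_false, tvDist_self, mul_zero,
      Finset.sum_const_zero, zero_add, ← Finset.sum_mul]
    rw [pow_succ', show 1 - a = ∑ x, (P (false, x)).toReal by linarith]
    refine mul_le_mul_of_nonneg_left ?_ (Finset.sum_nonneg fun _ _ => ENNReal.toReal_nonneg)
    rwa [show ∑ x, (P (false, x)).toReal = 1 - a by linarith]

theorem computes_firstAccepted {X : Type} {ℓ : ℕ} (T : ℕ) (V : X → Fin T → Bool × Zq ℓ) :
    Computes (wires V) (T * (ℓ * 8)) (wires fun x => firstAccepted T (V x)) := by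
  induction T with
  | zero => exact Computes.wires_const _
  | succ T ih =>
    have h1 := (ih fun x i => V x i.succ).mono_left (B' := wires V) (by
      rw [wires_pi fun x (i : Fin T) => V x i.succ]
      exact Set.iUnion_subset fun i => wires_mono_pi V i.succ)
    have h0 := (Computes.wires_self V).proj 0
    refine ((Computes.bool.mp h0.fst).select h0.snd h1).mono_size ?_
    rw [Computes.len_Zq, Nat.succ_mul]
    omega

/-! ### Sampling the truncated discrete Gaussian -/

/-- A coin with bias `p`. -/
noncomputable def coin (p : ℝ) (h0 : 0 ≤ p) (h1 : p ≤ 1) : PMF Bool :=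
  PMF.ofFintype (fun b => ENNReal.ofReal (if b then p else 1 - p)) (by
    rw [Fintype.sum_bool, ← ENNReal.ofReal_add (by simpa) (by simpa)]
    simp)

theorem expect_coin {p : ℝ} (h0 : 0 ≤ p) (h1 : p ≤ 1) (f : Bool → ℝ) :
    (coin p h0 h1).expect f = p * f true + (1 - p) * f false := by
  rw [PMF.expect_fintype, Fintype.sum_bool, coin, PMF.ofFintype_apply, PMF.ofFintype_apply]
  simp [ENNReal.toReal_ofReal h0, ENNReal.toReal_ofReal (sub_nonneg.mpr h1)]

theorem expect_piPMF_prod {ι α : Type} [Fintype ι] [DecidableEq ι] [Fintype α] (p : ι → PMF α)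
    (f : ι → α → ℝ) : ((piPMF p).expect fun x => ∏ i, f i (x i)) = ∏ i, (p i).expect (f i) := by
  simp only [PMF.expect_fintype, piPMF_apply, ENNReal.toReal_prod, ← Finset.prod_mul_distrib]
  rw [Finset.prod_univ_sum, Fintype.piFinset_univ]

theorem PMF.toReal_apply_eq_expect {α : Type} [Fintype α] [DecidableEq α] (p : PMF α) (a : α) :
    (p a).toReal = p.expect fun x => if x = a then 1 else 0 := by
  rw [PMF.expect_fintype]
  simp

namespace GaussianSampler

variable {ℓ t : ℕ}

/-- The element of `ℤ_q` with a given sign and binary magnitude. -/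
def value (ℓ : ℕ) (x : Bool × (Fin t → Bool)) : Zq ℓ :=
  if x.1 then -(Nat.ofBits x.2 : Zq ℓ) else (Nat.ofBits x.2 : Zq ℓ)

/-- The acceptance test of an attempt: the magnitude is at most `B`, zero has the sign `+`, and for
any two digits of the magnitude which are one the corresponding coin shows `true`. -/
def accept (ℓ B : ℕ) (x : Bool × (Fin t → Bool)) (z : Fin t → Fin t → Bool) : Bool :=
  !((B : Zq ℓ) - (Nat.ofBits x.2 : Zq ℓ)).val.testBit (ℓ - 1) &&
    (!(x.1 && decide (∀ i ∈ Finset.univ, (!x.2 i) = true)) &&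
      decide (∀ i ∈ Finset.univ,
        decide (∀ j ∈ Finset.univ, (!(x.2 i && x.2 j) || z i j) = true) = true))

/-- The weight that two nonzero digits contribute to the Gaussian. -/
noncomputable def bias (B i j : ℕ) : ℝ := Real.exp (-Real.pi * 2 ^ (i + j) / (B : ℝ) ^ 2)

theorem bias_nonneg (B i j : ℕ) : 0 ≤ bias B i j := (Real.exp_pos _).le

theorem bias_le_one (B i j : ℕ) : bias B i j ≤ 1 := by
  refine Real.exp_le_one_iff.mpr (div_nonpos_of_nonpos_of_nonneg ?_ (by positivity))
  have := Real.pi_pos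
  have : 0 ≤ Real.pi * 2 ^ (i + j) := by positivity
  linarith

/-- One attempt: an acceptance bit and a value. -/
noncomputable def attempt (ℓ t B : ℕ) : PMF (Bool × Zq ℓ) :=
  ((PMF.uniformOfFintype (Bool × (Fin t → Bool))).bind fun x =>
    (piPMF fun i : Fin t => piPMF fun j : Fin t =>
      coin (bias B i j) (bias_nonneg B i j) (bias_le_one B i j)).map fun z => (x, z)).map
    fun xz => (accept ℓ B xz.1 xz.2, value ℓ xz.1)

theorem ofBits_eq_sum (y : Fin t → Bool) :
    Nat.ofBits y = ∑ i : Fin t, if y i then 2 ^ (i : ℕ) else 0 := by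
  have h := Nat.sum_testBit_mod (Nat.ofBits y) t
  rw [Nat.mod_eq_of_lt (Nat.ofBits_lt_two_pow y), Finset.sum_range] at h
  rw [← h]
  refine Finset.sum_congr rfl fun i _ => ?_
  rw [Nat.testBit_ofBits_lt y i i.2]

theorem ofBits_eq_zero_iff (y : Fin t → Bool) : Nat.ofBits y = 0 ↔ ∀ i, y i = false := by
  rw [ofBits_eq_sum]
  simp

/-- The Gaussian weight of `v` is the product of the weights of pairs of digits, since
`v ^ 2 = ∑ i, ∑ j, v_i v_j 2 ^ (i + j)`. -/
theorem prod_bias (B : ℕ) (y : Fin t → Bool) :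
    (∏ i : Fin t, ∏ j : Fin t, if y i && y j then bias B i j else 1) =
      Real.exp (-Real.pi * (Nat.ofBits y : ℝ) ^ 2 / (B : ℝ) ^ 2) := by
  have h : ∀ i j : Fin t, (if y i && y j then bias B i j else 1) =
      Real.exp (-Real.pi * ((if y i then 2 ^ (i : ℕ) else 0) * (if y j then 2 ^ (j : ℕ) else 0)) /
        (B : ℝ) ^ 2) := by
    intro i j
    cases y i <;> cases y j <;> simp [bias, pow_add]
  simp only [h, ← Real.exp_sum]
  congr 1
  rw [ofBits_eq_sum]
  push_cast
  rw [sq (∑ i : Fin t, if y i = true then (2 : ℝ) ^ (i : ℕ) else 0), Finset.sum_mul_sum,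
    Finset.mul_sum, Finset.sum_div]
  refine Finset.sum_congr rfl fun i _ => ?_
  rw [Finset.mul_sum, Finset.sum_div]

/-- The conditions on sign and magnitude in the acceptance test. -/
def Valid (B : ℕ) (x : Bool × (Fin t → Bool)) : Prop :=
  Nat.ofBits x.2 ≤ B ∧ ¬(x.1 = true ∧ Nat.ofBits x.2 = 0)

variable {B : ℕ}

theorem testBit_sub_iff (ht : 2 ^ t ≤ 2 * B) (hB : 4 * B < 2 ^ ℓ) {v : ℕ} (hv : v < 2 ^ t) :
    ((B : Zq ℓ) - (v : Zq ℓ)).val.testBit (ℓ - 1) = false ↔ v ≤ B := by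
  have hl : ℓ ≠ 0 := by
    rintro rfl
    have := Nat.two_pow_pos t
    omega
  have h1 : 2 ^ ℓ = 2 * 2 ^ (ℓ - 1) := by
    rw [← pow_succ']; congr 1; omega
  rw [← Bool.not_eq_true, Zq.testBit_top]
  rcases Nat.lt_or_ge B v with h | h
  · have h2 : ((B : Zq ℓ) - (v : Zq ℓ)) = ((2 ^ ℓ + B - v : ℕ) : Zq ℓ) := by
      have h3 := ZMod.natCast_self (2 ^ ℓ)
      rw [Nat.cast_sub (by omega), Nat.cast_add, h3, zero_add]
    rw [h2, ZMod.val_natCast_of_lt (by omega)]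
    omega
  · rw [← Nat.cast_sub h, ZMod.val_natCast_of_lt (by omega)]
    omega

theorem accept_iff (ht : 2 ^ t ≤ 2 * B) (hB : 4 * B < 2 ^ ℓ) (x : Bool × (Fin t → Bool))
    (z : Fin t → Fin t → Bool) : accept ℓ B x z = true ↔
      Valid B x ∧ ∀ i j, (!(x.2 i && x.2 j) || z i j) = true := by
  have h1 := testBit_sub_iff (ℓ := ℓ) ht hB (Nat.ofBits_lt_two_pow x.2)
  have h2 := ofBits_eq_zero_iff x.2
  rw [accept, Bool.and_eq_true, Bool.and_eq_true, Bool.not_eq_true', h1, Valid, h2]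
  simp only [Finset.mem_univ, true_implies, Bool.not_eq_true', decide_eq_true_eq, and_assoc,
    not_and, ← Bool.not_eq_true]
  refine and_congr_right fun _ => and_congr_left fun _ => ?_
  cases x.1 <;> simp

/-- The sign and the digits of an element of `ℤ_q`. -/
def digits (t : ℕ) (w : Zq ℓ) : Bool × (Fin t → Bool) :=
  (decide (w.valMinAbs < 0), fun i => w.valMinAbs.natAbs.testBit i)

theorem valid_and_value_eq_iff (hBt : B < 2 ^ t) (hB : 4 * B < 2 ^ ℓ) (x : Bool × (Fin t → Bool))
    (w : Zq ℓ) : (Valid B x ∧ value ℓ x = w) ↔ (w.abs ≤ B ∧ x = digits t w) := by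
  have hcast : value ℓ x =
      ((if x.1 then -(Nat.ofBits x.2 : ℤ) else Nat.ofBits x.2 : ℤ) : Zq ℓ) := by
    rw [value]
    split_ifs <;> simp
  constructor
  · rintro ⟨⟨h1, h2⟩, h3⟩
    have h4 : w.valMinAbs = if x.1 then -(Nat.ofBits x.2 : ℤ) else Nat.ofBits x.2 := by
      refine (ZMod.valMinAbs_spec _ _).mpr ⟨by rw [← h3, hcast], ?_⟩
      have h5 : ((2 ^ ℓ : ℕ) : ℤ) = 2 ^ ℓ := by push_cast; rfl
      have h6 : (4 : ℤ) * B < 2 ^ ℓ := by exact_mod_cast hB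
      rw [h5, Set.mem_Ioc]
      split_ifs <;> constructor <;> omega
    have h5 : w.valMinAbs.natAbs = Nat.ofBits x.2 := by
      rw [h4]
      split_ifs <;> simp
    refine ⟨?_, Prod.ext ?_ (funext fun i => ?_)⟩
    · rw [Zq.abs, Int.abs_eq_natAbs, h5]
      exact_mod_cast h1
    · rw [digits, h4]
      cases hx : x.1
      · simp
      · have : Nat.ofBits x.2 ≠ 0 := fun h => h2 ⟨hx, h⟩
        simp only [if_true]
        exact (decide_eq_true (by omega)).symm
    · simp only [digits]
      rw [h5, Nat.testBit_ofBits_lt x.2 i i.2]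
  · rintro ⟨h1, rfl⟩
    rw [Zq.abs, Int.abs_eq_natAbs] at h1
    have h1' : w.valMinAbs.natAbs ≤ B := by exact_mod_cast h1
    have h2 : Nat.ofBits (digits t w).2 = w.valMinAbs.natAbs := by
      rw [digits, Nat.ofBits_testBit, Nat.mod_eq_of_lt (by omega)]
    refine ⟨⟨by rw [h2]; exact h1', ?_⟩, ?_⟩
    · rw [h2]
      simp only [digits, decide_eq_true_eq]
      omega
    · rw [hcast, h2]
      conv_rhs => rw [← ZMod.coe_valMinAbs w]
      congr 1
      simp only [digits, decide_eq_true_eq]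
      split_ifs <;> omega

/-- An attempt accepts `w` with probability proportional to the Gaussian weight of `w`. -/
theorem attempt_apply (hBt : B < 2 ^ t) (ht : 2 ^ t ≤ 2 * B) (hB : 4 * B < 2 ^ ℓ) (w : Zq ℓ) :
    (attempt ℓ t B (true, w)).toReal = (2 ^ (t + 1))⁻¹ * (gaussianWeight ℓ B w).toReal := by
  classical
  rw [PMF.toReal_apply_eq_expect, attempt, PMF.expect_map, PMF.expect_bind]
  simp only [PMF.expect_map, Prod.mk.injEq, accept_iff ht hB]
  have h1 : ∀ x : Bool × (Fin t → Bool), ((piPMF fun i : Fin t => piPMF fun j : Fin t =>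
      coin (bias B i j) (bias_nonneg B i j) (bias_le_one B i j)).expect fun z =>
        if (Valid B x ∧ ∀ i j, (!(x.2 i && x.2 j) || z i j) = true) ∧ value ℓ x = w then 1 else 0) =
      if Valid B x ∧ value ℓ x = w then
        Real.exp (-Real.pi * (Nat.ofBits x.2 : ℝ) ^ 2 / (B : ℝ) ^ 2) else 0 := by
    intro x
    by_cases h : Valid B x ∧ value ℓ x = w
    · have h2 : ∀ z : Fin t → Fin t → Bool,
          (if (Valid B x ∧ ∀ i j, (!(x.2 i && x.2 j) || z i j) = true) ∧ value ℓ x = w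
            then (1 : ℝ) else 0) =
          ∏ i, ∏ j, if (!(x.2 i && x.2 j) || z i j) = true then 1 else 0 := by
        intro z
        simp only [Finset.prod_ite_zero, Finset.prod_const_one, h.1, h.2, true_and, and_true,
          Finset.mem_univ, true_implies]
      simp only [h2]
      rw [expect_piPMF_prod _ fun i (z : Fin t → Bool) =>
        ∏ j, if (!(x.2 i && x.2 j) || z j) = true then 1 else 0, if_pos h, ← prod_bias]
      refine Finset.prod_congr rfl fun i _ => ?_
      rw [expect_piPMF_prod _ fun j (b : Bool) =>
        if (!(x.2 i && x.2 j) || b) = true then 1 else 0]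
      refine Finset.prod_congr rfl fun j _ => ?_
      rw [expect_coin]
      cases x.2 i && x.2 j <;> simp
    · rw [if_neg h]
      have h2 : ∀ z : Fin t → Fin t → Bool,
          (if (Valid B x ∧ ∀ i j, (!(x.2 i && x.2 j) || z i j) = true) ∧ value ℓ x = w
            then (1 : ℝ) else 0) = 0 := fun z => if_neg fun h' => h ⟨h'.1.1, h'.2⟩
      simp only [h2, PMF.expect_const]
  simp only [h1, valid_and_value_eq_iff hBt hB]
  rw [PMF.expect_fintype, Finset.sum_eq_single (digits t w)]
  · rw [gaussianWeight]
    by_cases hw : w.abs ≤ B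
    · have h2 : w.valMinAbs.natAbs ≤ B := by
        rw [Zq.abs, Int.abs_eq_natAbs] at hw
        exact_mod_cast hw
      have h3 : (Nat.ofBits (digits t w).2 : ℝ) = (w.abs : ℝ) := by
        rw [digits, Nat.ofBits_testBit, Nat.mod_eq_of_lt (by omega), Zq.abs, Int.abs_eq_natAbs]
        simp
      rw [if_pos ⟨hw, rfl⟩, if_pos hw, ENNReal.toReal_ofReal (Real.exp_pos _).le, h3]
      simp [PMF.uniformOfFintype_apply, pow_succ, mul_comm]
    · rw [if_neg fun h => hw h.1, if_neg hw]
      simp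
  · intro x _ hx
    rw [if_neg fun h => hx h.2, mul_zero]
  · simp

/-- The total Gaussian weight is large enough for an attempt to be accepted with constant
probability. -/
theorem le_sum_gaussianWeight (hB : 4 * B < 2 ^ ℓ) :
    (B + 1) * Real.exp (-Real.pi) ≤ ∑ w, (gaussianWeight ℓ B w).toReal := by
  classical
  have habs : ∀ v ∈ Finset.range (B + 1), ((v : ℕ) : Zq ℓ).valMinAbs = v := fun v hv => by
    rw [ZMod.valMinAbs_natCast_eq_self]
    rw [Finset.mem_range] at hv
    omega
  have hinj : Set.InjOn (fun v : ℕ => (v : Zq ℓ)) (Finset.range (B + 1)) := by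
    intro v hv v' hv' h
    have h1 := habs v hv
    rw [show ((v : ℕ) : Zq ℓ) = v' from h, habs v' hv'] at h1
    exact_mod_cast h1.symm
  calc (B + 1) * Real.exp (-Real.pi) = ∑ _v ∈ Finset.range (B + 1), Real.exp (-Real.pi) := by simp
    _ ≤ ∑ v ∈ Finset.range (B + 1), (gaussianWeight ℓ B (v : Zq ℓ)).toReal := by
      refine Finset.sum_le_sum fun v hv => ?_
      have h1 : ((v : Zq ℓ)).abs = v := by
        rw [Zq.abs, habs v hv]
        simp
      have h2 : v ≤ B := by rw [Finset.mem_range] at hv; omega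
      rw [gaussianWeight, if_pos (by rw [h1]; exact_mod_cast h2),
        ENNReal.toReal_ofReal (Real.exp_pos _).le, h1]
      refine Real.exp_le_exp.mpr ?_
      have h3 : ((v : ℤ) : ℝ) ^ 2 / (B : ℝ) ^ 2 ≤ 1 := by
        refine div_le_one_of_le₀ ?_ (by positivity)
        push_cast
        gcongr
      have := Real.pi_pos
      rw [mul_div_assoc]
      nlinarith
    _ = ∑ w ∈ (Finset.range (B + 1)).image fun v : ℕ => (v : Zq ℓ),
        (gaussianWeight ℓ B w).toReal := 
      (Finset.sum_image (f := fun w => (gaussianWeight ℓ B w).toReal) hinj).symm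
    _ ≤ _ := Finset.sum_le_sum_of_subset_of_nonneg (Finset.subset_univ _)
      fun _ _ _ => ENNReal.toReal_nonneg

theorem tvDist_gaussian_le (hBt : B < 2 ^ t) (ht : 2 ^ t ≤ 2 * B) (hB : 4 * B < 2 ^ ℓ) (T : ℕ) :
    tvDist ((piPMF fun _ : Fin T => attempt ℓ t B).map (firstAccepted T)) (gaussian ℓ B) ≤
      (1 - Real.exp (-Real.pi) / 4) ^ T := by
  have hne : ∀ w, gaussianWeight ℓ B w ≠ ⊤ := fun w => by
    unfold gaussianWeight
    split_ifs <;> simp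
  have hW := le_sum_gaussianWeight hB
  set W := ∑ w, (gaussianWeight ℓ B w).toReal with hWdef
  have hpos : 0 < W := lt_of_lt_of_le (by positivity) hW
  have hg : ∀ w, (gaussian ℓ B w).toReal = (gaussianWeight ℓ B w).toReal * W⁻¹ := fun w => by
    rw [gaussian, PMF.normalize_apply, ENNReal.toReal_mul, ENNReal.toReal_inv, tsum_fintype,
      ENNReal.toReal_sum fun w _ => hne w]
  have h : ∀ w, (attempt ℓ t B (true, w)).toReal =
      ((2 ^ (t + 1))⁻¹ * W) * (gaussian ℓ B w).toReal := fun w => by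
    rw [attempt_apply hBt ht hB, hg]
    field_simp
  have ha : Real.exp (-Real.pi) / 4 ≤ (2 ^ (t + 1))⁻¹ * W := by
    have h2 : (2 : ℝ) ^ (t + 1) ≤ 4 * B := by
      have : 2 ^ (t + 1) ≤ 4 * B := by rw [pow_succ]; omega
      exact_mod_cast this
    have h3 : (0 : ℝ) < 2 ^ (t + 1) := by positivity
    rw [inv_mul_eq_div, le_div_iff₀ h3]
    have := Real.exp_pos (-Real.pi)
    nlinarith
  refine (tvDist_firstAccepted_le h T).trans (pow_le_pow_left₀ ?_ (by linarith) T)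
  have hle : (2 ^ (t + 1))⁻¹ * W ≤ 1 := by
    have h4 := (attempt ℓ t B).sum_toReal
    rw [Fintype.sum_prod_type, Fintype.sum_bool] at h4
    simp only [h, ← Finset.mul_sum, PMF.sum_toReal, mul_one] at h4
    have : 0 ≤ ∑ w, (attempt ℓ t B (false, w)).toReal :=
      Finset.sum_nonneg fun _ _ => ENNReal.toReal_nonneg
    linarith
  linarith

end GaussianSampler

namespace GaussianSampler

/-- The size of a circuit for the acceptance test and the value of an attempt. -/
def attemptCost (ℓ t : ℕ) : ℕ :=
  (t * (8 * ℓ + 32 * ℓ) + 65 * ℓ + 1 + (t * 5 + 1 + 3 + (t * (t * 10 + 1 + 4) + 1) + 2) + 2) +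
    (t * (8 * ℓ + 32 * ℓ) + 33 * ℓ + t * (8 * ℓ + 32 * ℓ) + ℓ * 8)

theorem computes_attempt (ℓ t B : ℕ) :
    Computes (wires fun xz : (Bool × (Fin t → Bool)) × (Fin t → Fin t → Bool) => xz)
      (attemptCost ℓ t) (wires fun xz => (accept ℓ B xz.1 xz.2, value ℓ xz.1)) := by
  let X := (Bool × (Fin t → Bool)) × (Fin t → Fin t → Bool)
  have h0 : Computes (wires fun xz : X => xz) 0 (wires fun xz : X => xz) := .wires_self _
  have hs : Computes (wires fun xz : X => xz) 0 {fun xz => xz.1.1} := Computes.bool.mp h0.fst.fst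
  have hy := fun i => Computes.bool.mp (h0.fst.snd.proj i)
  have hz := fun i j => Computes.bool.mp ((h0.snd.proj i).proj j)
  have hmag : Computes (wires fun xz : X => xz) (t * (8 * ℓ + 32 * ℓ))
      (wires fun xz : X => (Nat.ofBits xz.1.2 : Zq ℓ)) := by
    have h1 := Computes.sum (Finset.univ : Finset (Fin t)) (a := 8 * ℓ) fun i _ =>
      ((hy i).bitMul (Computes.wires_const (s := 0) ((2 : Zq ℓ) ^ (i : ℕ)))).mono_size (by omega)
    refine (h1.congr fun x => ?_).mono_size (by simp)
    rw [ofBits_eq_sum]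
    push_cast
    rfl
  refine Computes.prod (Computes.bool.mpr ?_) ?_
  · have h1 := (((Computes.wires_const (s := 0) (B : Zq ℓ)).sub hmag).bit (ℓ - 1)).not
    have h2 := Computes.all (Finset.univ : Finset (Fin t)) fun i _ => (hy i).not
    have h3 := Computes.all (Finset.univ : Finset (Fin t)) fun i _ =>
      Computes.all (Finset.univ : Finset (Fin t)) fun j _ => ((hy i).and (hy j)).not.or (hz i j)
    have h4 := h1.and ((hs.and h2).not.and h3)
    simp only [Finset.card_univ, Fintype.card_fin, Nat.zero_add, Nat.reduceAdd] at h4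
    refine (h4.mono_size (by omega)).mono_right ?_
    rw [Set.singleton_subset_iff, Set.mem_singleton_iff]
    funext xz
    unfold accept
    congr!
  · exact (hs.select hmag.neg hmag).mono_size (by rw [Computes.len_Zq]; omega)

/-- The truncated discrete Gaussian is samplable if its parameter is eventually below `q / 4`. -/
theorem samplable_gaussian {ℓ B : ℕ → ℕ} (hℓ : PolyBd id ℓ) (hpos : ∀ lam, 0 < B lam)
    (hB : ∀ᶠ lam in atTop, 4 * B lam < 2 ^ ℓ lam) :
    Samplable fun lam (_ : Unit) => gaussian (ℓ lam) (B lam) := by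
  -- Magnitudes up to `B` have `B.size` binary digits; `lam` attempts are made.
  let t : ℕ → ℕ := fun lam => (B lam).size
  have ht : PolyBd id t := PolyBd.of_eventually hℓ (hB.mono fun lam h => by
    exact Nat.size_le.mpr (by omega))
  have c := fun k => PolyBd.const (μ := id) k
  have hmag := ht.mul (((c 8).mul hℓ).add ((c 32).mul hℓ))
  have hcost : PolyBd id fun lam => attemptCost (ℓ lam) (t lam) :=
    ((((hmag.add ((c 65).mul hℓ)).add (c 1)).add (((((ht.mul (c 5)).add (c 1)).add (c 3)).add
      ((ht.mul (((ht.mul (c 10)).add (c 1)).add (c 4))).add (c 1))).add (c 2))).add (c 2)).add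
      (((hmag.add ((c 33).mul hℓ)).add hmag).add (hℓ.mul (c 8)))
  have h1 : Samplable fun lam (_ : Unit × Fin lam) => attempt (ℓ lam) (t lam) (B lam) := by
    have hu : Samplable fun lam (_ : Unit × Fin lam) =>
        PMF.uniformOfFintype (Bool × (Fin (t lam) → Bool)) :=
      .uniform (fun lam => FullCode.bool.prod FullCode.bool.pi) ((c 1).add (ht.mul (c 1)))
    have hz := Samplable.pi (I := fun lam => Unit × Fin lam) ht
      (Samplable.pi (I := fun lam => (Unit × Fin lam) × Fin (t lam)) ht
        (samplable_bool.reindex (J := fun lam => ((Unit × Fin lam) × Fin (t lam)) × Fin (t lam))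
          fun lam x => coin (bias (B lam) x.1.2 x.2) (bias_nonneg _ _ _) (bias_le_one _ _ _)))
    exact (hu.prod hz).map hcost fun lam _ => computes_attempt _ _ _
  have h2 := (Samplable.pi (I := fun _ => Unit) PolyBd.self h1).map
    (F := fun lam _ => firstAccepted lam) (PolyBd.self.mul (hℓ.mul (c 8)))
    fun lam _ => computes_firstAccepted lam fun v => v
  have he := Real.exp_pos (-Real.pi)
  have he' : Real.exp (-Real.pi) ≤ 1 := Real.exp_le_one_iff.mpr (by linarith [Real.pi_pos])
  refine h2.of_tvDist (Negligible.geometric (r := 1 - Real.exp (-Real.pi) / 4) (by linarith)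
    (by linarith)) (hB.mono fun lam h _ => tvDist_gaussian_le (Nat.lt_size_self _) ?_ h lam)
  have h3 : 0 < (B lam).size := Nat.size_pos.mpr (hpos lam)
  have h4 : 2 ^ ((B lam).size - 1) ≤ B lam := Nat.lt_size.mp (by omega)
  have h5 : 2 ^ (B lam).size = 2 * 2 ^ ((B lam).size - 1) := by
    rw [← pow_succ']; congr 1; omega
  omega

end GaussianSampler

/-! ### Encryption and key generation from explicit coins -/

theorem Samplable.pi_prod {I α : ℕ → Type} [∀ lam, BitCode (α lam)] [∀ lam, Fintype (α lam)]
    {k l : ℕ → ℕ} (hk : PolyBd id k) (hl : PolyBd id l) {P : ∀ lam, I lam → PMF (α lam)}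
    (hP : Samplable P) :
    Samplable fun lam i => piPMF fun _ : Fin (k lam) × Fin (l lam) => P lam i := by
  have h1 := Samplable.pi (I := I) hk (Samplable.pi (I := fun lam => I lam × Fin (k lam)) hl
    (hP.reindex (J := fun lam => (I lam × Fin (k lam)) × Fin (l lam)) fun lam x => x.1.1))
  have h2 := h1.map (F := fun lam _ f (x : Fin (k lam) × Fin (l lam)) => f x.1 x.2)
    (PolyBd.const 0) fun lam _ => Computes.wires_self _
  convert h2 using 3 with lam i
  rw [piPMF_curry, PMF.map_comp]
  exact (PMF.map_id _).symm

namespace DualHE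

variable {n m ℓ : ℕ}

/-- The randomness of an encryption. -/
noncomputable def encCoins (n m ℓ β : ℕ) : PMF (Matrix (Fin n) (Fin (m + 1) × Fin ℓ) (Zq ℓ) ×
    (Fin (m + 1) → Fin (m + 1) × Fin ℓ → Zq ℓ)) :=
  (PMF.uniformOfFintype (Matrix (Fin n) (Fin (m + 1) × Fin ℓ) (Zq ℓ))).bind fun S =>
    (piPMF fun _ : Fin (m + 1) => piPMF fun _ : Fin (m + 1) × Fin ℓ => gaussian ℓ β).map
      fun E => (S, E)

/-- Encryption with explicit randomness. -/
def encWith (pk : Dual.PK n m ℓ) (μ : Bool) (ω : Matrix (Fin n) (Fin (m + 1) × Fin ℓ) (Zq ℓ) ×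
    (Fin (m + 1) → Fin (m + 1) × Fin ℓ → Zq ℓ)) : CT m ℓ :=
  pk * ω.1 + Matrix.of ω.2 + if μ then G m ℓ else 0

theorem enc_eq_encCoins_map (β : ℕ) (pk : Dual.PK n m ℓ) (μ : Bool) :
    enc β pk μ = (encCoins n m ℓ β).map (encWith pk μ) := by
  simp only [enc, encCoins, PMF.monad_bind, PMF.monad_pure, PMF.map_bind, PMF.map_comp]
  rfl

theorem samplable_encCoins {n m ℓ β : ℕ → ℕ} (hn : PolyBd id n) (hm : PolyBd id m)
    (hl : PolyBd id ℓ) (hpos : ∀ lam, 0 < β lam) (hβ : ∀ᶠ lam in atTop, 4 * β lam < 2 ^ ℓ lam) :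
    Samplable fun lam (_ : Unit) => encCoins (n lam) (m lam) (ℓ lam) (β lam) := by
  have hm1 := hm.add (PolyBd.const 1)
  have h1 : Samplable fun lam (_ : Unit) =>
      PMF.uniformOfFintype (Matrix (Fin (n lam)) (Fin (m lam + 1) × Fin (ℓ lam)) (Zq (ℓ lam))) :=
    .uniform (fun lam => (FullCode.zq _).pi_prod.matrix) (hn.mul (hm1.mul (hl.mul hl)))
  have h2 : Samplable fun lam (_ : Unit × Fin (m lam + 1)) =>
      piPMF fun _ : Fin (m lam + 1) × Fin (ℓ lam) => gaussian (ℓ lam) (β lam) :=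
    (Samplable.pi_prod hm1 hl (GaussianSampler.samplable_gaussian hl hpos hβ)).reindex
      fun lam (x : Unit × Fin (m lam + 1)) => x.1
  have h3 : Samplable fun lam (_ : Unit) => piPMF fun _ : Fin (m lam + 1) =>
      piPMF fun _ : Fin (m lam + 1) × Fin (ℓ lam) => gaussian (ℓ lam) (β lam) :=
    Samplable.pi (I := fun _ => Unit) (α := fun lam => Fin (m lam + 1) × Fin (ℓ lam) → Zq (ℓ lam))
      (P := fun lam _ => piPMF fun _ : Fin (m lam + 1) × Fin (ℓ lam) => gaussian (ℓ lam) (β lam))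
      hm1 h2
  exact h1.prod h3

/-- The size of a circuit for encryption with explicit randomness. -/
def encCost (n m ℓ : ℕ) : ℕ :=
  (m + 1) * ((m + 1) * (ℓ * (n * (40 * ℓ * ℓ + 32 * ℓ) + 72 * ℓ + 32 * ℓ)))

variable {X : Type} {B : Set (X → Bool)}

theorem computes_encWith {pk : X → Dual.PK n m ℓ} {μ : X → Bool}
    {ω : X → Matrix (Fin n) (Fin (m + 1) × Fin ℓ) (Zq ℓ) ×
      (Fin (m + 1) → Fin (m + 1) × Fin ℓ → Zq ℓ)}
    (hpk : Computes B 0 (wires pk)) (hμ : Computes B 0 {μ}) (hω : Computes B 0 (wires ω)) :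
    Computes B (encCost n m ℓ) (wires fun x => encWith (pk x) (μ x) (ω x)) := by
  refine Computes.matrix fun i => Computes.pi_prod fun j => ?_
  have h1 := Computes.sum (Finset.univ : Finset (Fin n)) fun a _ =>
    (computes_matrix_entry hpk i a).mul ((hω.fst.row a).proj_prod j)
  have h2 := (h1.add ((hω.snd.proj i).proj_prod j)).add
    (hμ.bitMul (Computes.wires_const (s := 0) (G m ℓ i j)))
  refine (h2.congr fun x => ?_).mono_size ?_
  · rw [encWith]
    cases μ x <;> simp [Matrix.mul_apply]
  · simp only [Finset.card_univ, Fintype.card_fin, Nat.zero_add]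
    omega

/-- The randomness of the key generation of DualHE. -/
abbrev KeyCoins (n m ℓ : ℕ) : Type :=
  Dual.SK m × (Matrix (Fin (m - n * ℓ)) (Fin n) (Zq ℓ) ×
    (Fin (n * ℓ) → Fin (m - n * ℓ) → Bool × Bool))

/-- The trapdoor made from its coins. -/
def trapdoorWith (b : Fin (n * ℓ) → Fin (m - n * ℓ) → Bool × Bool) : Dual.Trapdoor n m ℓ :=
  fun r j => if (b r j).1 then (if (b r j).2 then 1 else -1) else 0

/-- The public key made from the coins of the key generation. -/
def pkWith (κ : KeyCoins n m ℓ) : Dual.PK n m ℓ :=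
  Dual.publicKey (Dual.trapdoorMatrix κ.2.1 (trapdoorWith κ.2.2)) κ.1

theorem piPMF_trapdoorEntry (n m ℓ : ℕ) :
    (piPMF fun _ : Fin (n * ℓ) => piPMF fun _ : Fin (m - n * ℓ) => Dual.trapdoorEntry) =
      (PMF.uniformOfFintype (Fin (n * ℓ) → Fin (m - n * ℓ) → Bool × Bool)).map trapdoorWith := by
  simp only [Dual.trapdoorEntry, piPMF_map, uniform_pi]
  rfl

theorem keyGen_eq_map (n m ℓ : ℕ) : Dual.keyGen n m ℓ =
    (PMF.uniformOfFintype (KeyCoins n m ℓ)).map fun κ => (pkWith κ, κ.1, trapdoorWith κ.2.2) := by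
  have h := piPMF_trapdoorEntry n m ℓ
  simp only [Dual.keyGen, Dual.genTrap, PMF.monad_bind, PMF.monad_pure, PMF.bind_bind,
    PMF.pure_bind]
  erw [h]
  rw [uniform_prod, uniform_prod]
  simp only [PMF.map_bind, PMF.map_comp]
  refine congrArg _ (funext fun e => congrArg _ (funext fun A => ?_))
  exact PMF.bind_map _ _ _

/-- The size of a circuit for an entry of a matrix with a trapdoor. -/
def trapdoorCost (m ℓ : ℕ) : ℕ := m * (49 * ℓ + 32 * ℓ) + 65 * ℓ

theorem computes_trapdoorMatrix {κ : X → KeyCoins n m ℓ} (hκ : Computes B 0 (wires κ)) (i : Fin m)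
    (a : Fin n) : Computes B (trapdoorCost m ℓ) (wires fun x =>
      Dual.trapdoorMatrix (κ x).2.1 (trapdoorWith (κ x).2.2) i a) := by
  simp only [Dual.trapdoorMatrix, Matrix.of_apply]
  by_cases h : (i : ℕ) < m - n * ℓ
  · simp only [h, dite_true]
    exact (computes_matrix_entry hκ.snd.fst _ a).mono_size (Nat.zero_le _)
  · simp only [h, dite_false]
    have h1 := fun (r : Fin (n * ℓ)) (j : Fin (m - n * ℓ)) => ((hκ.snd.snd.proj r).proj j)
    have h2 := fun j => computes_matrix_entry hκ.snd.fst j a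
    have h3 := fun r => (Computes.wires_const (B := B) (s := 0)
      (if (finProdFinEquiv.symm r).1 = a then 2 ^ ((finProdFinEquiv.symm r).2 : ℕ) else 0 :
        Zq ℓ)).sub (Computes.sum (Finset.univ : Finset (Fin (m - n * ℓ))) fun j _ =>
          (Computes.bool.mp (h1 r j).fst).bitMul
            ((Computes.bool.mp (h1 r j).snd).select (h2 j) (h2 j).neg))
    refine ((h3 ⟨i - (m - n * ℓ), by omega⟩).congr fun x => ?_).mono_size ?_
    · congr 1
      refine Finset.sum_congr rfl fun j _ => ?_
      rw [trapdoorWith]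
      split_ifs <;> simp
    · simp only [Finset.card_univ, Fintype.card_fin, Nat.zero_add, Computes.len_Zq, trapdoorCost]
      exact Nat.add_le_add_right (Nat.mul_le_mul (Nat.sub_le _ _) (by omega)) _

/-- The size of a circuit for the public key. -/
def pkCost (n m ℓ : ℕ) : ℕ :=
  (m + 1) * (n * (trapdoorCost m ℓ + m * (trapdoorCost m ℓ + 8 * ℓ + 32 * ℓ)))

theorem computes_pkWith {κ : X → KeyCoins n m ℓ} (hκ : Computes B 0 (wires κ)) :
    Computes B (pkCost n m ℓ) (wires fun x => pkWith (κ x)) := by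
  refine Computes.matrix fun i => Computes.pi fun a => ?_
  refine Fin.lastCases ?_ (fun i => ?_) i
  · have h1 := Computes.sum (Finset.univ : Finset (Fin m)) fun i _ =>
      (Computes.bool.mp (hκ.fst.proj i)).bitMul (computes_trapdoorMatrix hκ i a)
    refine (h1.congr fun x => ?_).mono_size ?_
    · simp only [pkWith, Dual.publicKey, Matrix.of_apply, Fin.snoc_last, Matrix.mulVec, dotProduct,
        Matrix.transpose_apply, Dual.skBits, mul_ite, mul_one, mul_zero]
    · simp only [Finset.card_univ, Fintype.card_fin, Nat.zero_add]
      omega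
  · refine ((computes_trapdoorMatrix hκ i a).congr fun x => ?_).mono_size (Nat.le_add_right _ _)
    simp only [pkWith, Dual.publicKey, Matrix.of_apply, Fin.snoc_castSucc]

/-- The keys of the leveled scheme made from the coins of the key generation. -/
def leveledKeyWith {L : ℕ} (x : (Fin (L + 1) → KeyCoins n m ℓ) ×
    (Fin L → Fin m → Matrix (Fin n) (Fin (m + 1) × Fin ℓ) (Zq ℓ) ×
      (Fin (m + 1) → Fin (m + 1) × Fin ℓ → Zq ℓ))) :
    Dual.PK n m ℓ × EVK n m ℓ L × (Dual.SK m × Dual.SK m) :=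
  (pkWith (x.1 0),
    fun i => (pkWith (x.1 i.succ), fun j =>
      encWith (pkWith (x.1 i.succ)) ((x.1 i.castSucc).1 j) (x.2 i j)),
    ((x.1 0).1, (x.1 (Fin.last L)).1))

theorem leveledKeyGen_eq_map (n m ℓ β L : ℕ) : leveledKeyGen n m ℓ β L =
    ((PMF.uniformOfFintype (Fin (L + 1) → KeyCoins n m ℓ)).bind fun κ =>
      (piPMF fun _ : Fin L => piPMF fun _ : Fin m => encCoins n m ℓ β).map fun ω => (κ, ω)).map
        leveledKeyWith := by
  simp only [leveledKeyGen, keyGen_eq_map, enc_eq_encCoins_map, PMF.monad_bind, PMF.monad_pure,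
    piPMF_map, ← uniform_pi, PMF.map_bind, PMF.bind_map, PMF.map_comp]
  rfl

/-- The size of a circuit for the key generation of the leveled scheme. -/
def leveledKeyCost (n m ℓ L : ℕ) : ℕ :=
  pkCost n m ℓ + (L * (pkCost n m ℓ + m * (pkCost n m ℓ + encCost n m ℓ)) + (0 + 0))

theorem computes_leveledKeyWith {L : ℕ} {x : X → (Fin (L + 1) → KeyCoins n m ℓ) ×
    (Fin L → Fin m → Matrix (Fin n) (Fin (m + 1) × Fin ℓ) (Zq ℓ) ×
      (Fin (m + 1) → Fin (m + 1) × Fin ℓ → Zq ℓ))} (hx : Computes B 0 (wires x)) :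
    Computes B (leveledKeyCost n m ℓ L) (wires fun y => leveledKeyWith (x y)) := by
  have hpk := fun i => computes_pkWith (hx.fst.proj i)
  refine (hpk 0).prod (Computes.prod (Computes.pi fun i => (hpk i.succ).prod
    (Computes.pi fun j => (hpk i.succ).cut ?_)) ((hx.fst.proj 0).fst.prod (hx.fst.proj _).fst))
  have hx' := hx.mono_left (B' := B ∪ wires fun y => pkWith ((x y).1 i.succ))
    Set.subset_union_left
  exact computes_encWith (.of_subset Set.subset_union_right)
    (Computes.bool.mp ((hx'.fst.proj i.castSucc).fst.proj j)) ((hx'.snd.proj i).proj j)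

/-! ### Encryption and key generation are efficient -/

section PPT

variable {n m ℓ β L : ℕ → ℕ}

theorem polyBd_encCost (hn : PolyBd id n) (hm : PolyBd id m) (hl : PolyBd id ℓ) :
    PolyBd id fun lam => encCost (n lam) (m lam) (ℓ lam) := by
  have c := fun k => PolyBd.const (μ := id) k
  have hm1 := hm.add (c 1)
  exact hm1.mul (hm1.mul (hl.mul (((hn.mul ((((c 40).mul hl).mul hl).add ((c 32).mul hl))).add
    ((c 72).mul hl)).add ((c 32).mul hl))))

theorem polyBd_trapdoorCost (hm : PolyBd id m) (hl : PolyBd id ℓ) :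
    PolyBd id fun lam => trapdoorCost (m lam) (ℓ lam) := by
  have c := fun k => PolyBd.const (μ := id) k
  exact (hm.mul (((c 49).mul hl).add ((c 32).mul hl))).add ((c 65).mul hl)

theorem polyBd_pkCost (hn : PolyBd id n) (hm : PolyBd id m) (hl : PolyBd id ℓ) :
    PolyBd id fun lam => pkCost (n lam) (m lam) (ℓ lam) := by
  have c := fun k => PolyBd.const (μ := id) k
  have ht := polyBd_trapdoorCost hm hl
  exact (hm.add (c 1)).mul (hn.mul (ht.add (hm.mul ((ht.add ((c 8).mul hl)).add
    ((c 32).mul hl)))))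

theorem polyBd_leveledKeyCost (hn : PolyBd id n) (hm : PolyBd id m) (hl : PolyBd id ℓ)
    (hL : PolyBd id L) :
    PolyBd id fun lam => leveledKeyCost (n lam) (m lam) (ℓ lam) (L lam) := by
  have hp := polyBd_pkCost hn hm hl
  exact hp.add ((hL.mul (hp.add (hm.mul (hp.add (polyBd_encCost hn hm hl))))).add
    (PolyBd.const 0))

theorem isPPT_enc_leveled (hn : PolyBd id n) (hm : PolyBd id m) (hl : PolyBd id ℓ)
    (hpos : ∀ lam, 0 < β lam) (hβ : ∀ᶠ lam in atTop, 4 * β lam < 2 ^ ℓ lam) :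
    IsPPT (α := fun lam => Dual.PK (n lam) (m lam) (ℓ lam) × Bool)
      (β := fun lam => Bool × CT (m lam) (ℓ lam))
      (fun lam a => (enc (β lam) a.1 a.2).map fun C => (false, C)) := by
  have hm1 := hm.add (PolyBd.const 1)
  have h := (samplable_encCoins hn hm hl hpos hβ).isPPT
    (α := fun lam => Dual.PK (n lam) (m lam) (ℓ lam) × Bool)
    (γ := fun lam => Bool × CT (m lam) (ℓ lam))
    (P := fun lam _ => encCoins (n lam) (m lam) (ℓ lam) (β lam))
    (F := fun lam a ω => (false, encWith a.1 a.2 ω))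
    ((PolyBd.const 0).add (polyBd_encCost hn hm hl))
    (fun lam => by
      have h0 := Computes.wires_self (X := (Dual.PK (n lam) (m lam) (ℓ lam) × Bool) ×
        (Matrix (Fin (n lam)) (Fin (m lam + 1) × Fin (ℓ lam)) (Zq (ℓ lam)) ×
          (Fin (m lam + 1) → Fin (m lam + 1) × Fin (ℓ lam) → Zq (ℓ lam)))) fun x => x
      exact (Computes.bool.mpr (Computes.const false)).prod
        (computes_encWith h0.fst.fst (Computes.bool.mp h0.fst.snd) h0.snd))
    ((hm1.mul (hn.mul hl)).add (PolyBd.const 1))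
    ((PolyBd.const 1).add (hm1.mul (hm1.mul (hl.mul hl))))
  convert h using 3 with lam a
  rw [enc_eq_encCoins_map, PMF.map_comp]
  rfl

set_option synthInstance.maxHeartbeats 400000 in
set_option synthInstance.maxSize 1024 in
theorem isPPT_keyGen_leveled (hn : PolyBd id n) (hm : PolyBd id m) (hl : PolyBd id ℓ)
    (hL : PolyBd id L) (hpos : ∀ lam, 0 < β lam)
    (hβ : ∀ᶠ lam in atTop, 4 * β lam < 2 ^ ℓ lam) :
    IsPPT (α := fun _ => Unit)
      (β := fun lam => Dual.PK (n lam) (m lam) (ℓ lam) ×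
        EVK (n lam) (m lam) (ℓ lam) (L lam) × (Dual.SK (m lam) × Dual.SK (m lam)))
      (fun lam _ => leveledKeyGen (n lam) (m lam) (ℓ lam) (β lam) (L lam)) := by
  have c := fun k => PolyBd.const (μ := id) k
  have hm1 := hm.add (c 1)
  have hnl := hn.mul hl
  have hsk := hm.mul (c 1)
  have hpk := hm1.mul (hn.mul hl)
  have hct := hm1.mul (hm1.mul (hl.mul hl))
  have h1 : Samplable fun lam (_ : Unit) =>
      PMF.uniformOfFintype (Fin (L lam + 1) → KeyCoins (n lam) (m lam) (ℓ lam)) :=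
    .uniform (fun lam => (FullCode.bool.pi.prod
        ((FullCode.zq _).pi.matrix.prod (FullCode.bool.prod .bool).pi.pi)).pi)
      ((hL.add (c 1)).mul (hsk.add ((hm.sub.mul (hn.mul hl)).add
        (hnl.mul (hm.sub.mul ((c 1).add (c 1)))))))
  have h2 : Samplable fun lam (_ : Unit × Fin (L lam)) =>
      piPMF fun _ : Fin (m lam) => encCoins (n lam) (m lam) (ℓ lam) (β lam) :=
    Samplable.pi (I := fun lam => Unit × Fin (L lam))
      (α := fun lam => Matrix (Fin (n lam)) (Fin (m lam + 1) × Fin (ℓ lam)) (Zq (ℓ lam)) ×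
        (Fin (m lam + 1) → Fin (m lam + 1) × Fin (ℓ lam) → Zq (ℓ lam)))
      (P := fun lam _ => encCoins (n lam) (m lam) (ℓ lam) (β lam)) hm
      ((samplable_encCoins hn hm hl hpos hβ).reindex fun _ _ => ())
  have h3 : Samplable fun lam (_ : Unit) => piPMF fun _ : Fin (L lam) =>
      piPMF fun _ : Fin (m lam) => encCoins (n lam) (m lam) (ℓ lam) (β lam) :=
    Samplable.pi (I := fun _ => Unit)
      (α := fun lam => Fin (m lam) →
        Matrix (Fin (n lam)) (Fin (m lam + 1) × Fin (ℓ lam)) (Zq (ℓ lam)) ×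
          (Fin (m lam + 1) → Fin (m lam + 1) × Fin (ℓ lam) → Zq (ℓ lam)))
      (P := fun lam _ => piPMF fun _ : Fin (m lam) =>
        encCoins (n lam) (m lam) (ℓ lam) (β lam)) hL h2
  have h := (h1.prod h3).isPPT (α := fun _ => Unit)
    (γ := fun lam => Dual.PK (n lam) (m lam) (ℓ lam) ×
        EVK (n lam) (m lam) (ℓ lam) (L lam) × (Dual.SK (m lam) × Dual.SK (m lam)))
    (P := fun lam _ =>
      (PMF.uniformOfFintype (Fin (L lam + 1) → KeyCoins (n lam) (m lam) (ℓ lam))).bind fun κ =>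
        (piPMF fun _ : Fin (L lam) => piPMF fun _ : Fin (m lam) =>
          encCoins (n lam) (m lam) (ℓ lam) (β lam)).map fun ω => (κ, ω))
    (F := fun lam _ x => leveledKeyWith x)
    (polyBd_leveledKeyCost hn hm hl hL)
    (fun lam => computes_leveledKeyWith (Computes.wires_self (X := Unit ×
        ((Fin (L lam + 1) → KeyCoins (n lam) (m lam) (ℓ lam)) ×
          (Fin (L lam) → Fin (m lam) →
            Matrix (Fin (n lam)) (Fin (m lam + 1) × Fin (ℓ lam)) (Zq (ℓ lam)) ×
              (Fin (m lam + 1) → Fin (m lam + 1) × Fin (ℓ lam) → Zq (ℓ lam))))) fun x => x).snd)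
    (PolyBd.const 0)
    (hpk.add ((hL.mul (hpk.add (hm.mul hct))).add (hsk.add hsk)))
  convert h using 3 with lam a
  exact leveledKeyGen_eq_map _ _ _ _ _

end PPT

end DualHE

/-! ### Choice of the depth bound -/

theorem isTheta_mul_log_two (k : ℕ) (hk : 1 ≤ k) :
    (fun lam : ℕ => ((k * (Nat.log 2 lam + 1) : ℕ) : ℝ)) =Θ[atTop]
      fun lam : ℕ => Real.log lam := by
  have h2 := Real.log_two_gt_d9
  have h2' := Real.log_two_lt_d9
  have hk' : (1 : ℝ) ≤ k := by exact_mod_cast hk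
  have hlog : ∀ lam : ℕ, 3 ≤ lam → 1 ≤ Real.log lam := fun lam h => by
    rw [Real.le_log_iff_exp_le (by positivity)]
    have h3 : (3 : ℝ) ≤ lam := by exact_mod_cast h
    linarith [Real.exp_one_lt_d9]
  constructor
  · refine IsBigO.of_bound (3 * k) ?_
    filter_upwards [eventually_ge_atTop 3] with lam h
    have h1 := hlog lam h
    rw [Real.norm_of_nonneg (by positivity), Real.norm_of_nonneg (by linarith)]
    have h3 : (Nat.log 2 lam : ℝ) * Real.log 2 ≤ Real.log lam := by
      rw [← Real.log_pow]
      refine Real.log_le_log (by positivity) ?_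
      exact_mod_cast Nat.pow_log_le_self 2 (by omega)
    have h4 : (0 : ℝ) ≤ Nat.log 2 lam := Nat.cast_nonneg _
    have h5 : (Nat.log 2 lam : ℝ) ≤ 2 * Real.log lam := by nlinarith
    push_cast
    nlinarith
  · refine IsBigO.of_bound 1 ?_
    filter_upwards [eventually_ge_atTop 3] with lam h
    have h1 := hlog lam h
    rw [Real.norm_of_nonneg (by positivity), Real.norm_of_nonneg (by linarith), one_mul]
    have h3 : Real.log lam ≤ ((Nat.log 2 lam + 1 : ℕ) : ℝ) * Real.log 2 := by
      rw [← Real.log_pow]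
      refine Real.log_le_log (by positivity) ?_
      exact_mod_cast (Nat.lt_pow_succ_log_self (by norm_num) lam).le
    have h4 : (0 : ℝ) ≤ Nat.log 2 lam := Nat.cast_nonneg _
    push_cast at h3 ⊢
    nlinarith

theorem le_pow_mul_log_two {lam a x : ℕ} (h : x ≤ lam ^ a) :
    x ≤ 2 ^ (a * (Nat.log 2 lam + 1)) := by
  rw [mul_comm, pow_mul]
  exact h.trans (Nat.pow_le_pow_left (Nat.lt_pow_succ_log_self (by norm_num) lam).le a)

/-- If `(N + 1) ^ η < 2 ^ ℓ` where `N + 1 > ℓ` and `η` grows at least like `log λ`, then `2 ^ ℓ` is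
superpolynomial: first `ℓ > η`, so that `N + 1` exceeds every constant `2 ^ c`, and then
`2 ^ ℓ > 2 ^ (c η) ≥ λ ^ c`. -/
theorem Negligible.half_pow_of_pow_lt {ℓ N η : ℕ → ℕ} (hl : ∀ lam, 1 ≤ ℓ lam)
    (hN : ∀ lam, ℓ lam ≤ N lam) (hη : ∀ lam, Nat.log 2 lam + 1 ≤ η lam)
    (h : ∀ᶠ lam in atTop, (N lam + 1) ^ η lam < 2 ^ ℓ lam) :
    Negligible fun lam => (1 / 2 : ℝ) ^ ℓ lam := by
  refine .of_forall_pow (fun lam => by positivity) fun c => ?_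
  filter_upwards [h, eventually_ge_atTop (2 ^ (2 ^ c))] with lam h1 h2
  have h3 : η lam < ℓ lam := by
    refine (Nat.pow_lt_pow_iff_right (a := 2) (by norm_num)).mp (lt_of_le_of_lt ?_ h1)
    exact Nat.pow_le_pow_left (by have := hl lam; have := hN lam; omega) _
  have h4 : 2 ^ c ≤ Nat.log 2 lam := Nat.le_log_of_pow_le (by norm_num) h2
  have h5 : lam ^ c ≤ 2 ^ ℓ lam := calc
    lam ^ c ≤ 2 ^ (c * (Nat.log 2 lam + 1)) := le_pow_mul_log_two le_rfl
    _ ≤ 2 ^ (c * η lam) := Nat.pow_le_pow_right (by norm_num) (Nat.mul_le_mul_left _ (hη lam))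
    _ = (2 ^ c) ^ η lam := pow_mul _ _ _
    _ ≤ (N lam + 1) ^ η lam :=
      Nat.pow_le_pow_left (by have := hN lam; have := hη lam; omega) _
    _ ≤ 2 ^ ℓ lam := h1.le
  rw [one_div, inv_pow, ← div_eq_mul_inv, div_le_one (by positivity)]
  exact_mod_cast h5

/-- Decryption circuits of polynomial size, and of depth `O(log λ)` with a constant depending only
on a polynomial bound for `m`. -/
theorem Dual.exists_decCircuits {m ℓ : ℕ → ℕ} {a : ℕ} (hm : PolyBd id m) (hl : PolyBd id ℓ)
    (hpos : ∀ lam, 1 ≤ ℓ lam) (hma : ∀ᶠ lam in atTop, m lam + 2 ≤ lam ^ a)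
    (hlm : ∀ᶠ lam in atTop, ℓ lam ≤ m lam) :
    ∃ D : ∀ lam, Circuit (m lam + (m lam + 1) * ℓ lam) 1, (∀ lam, IsDecCircuit (D lam)) ∧
      (∀ᶠ lam in atTop, (D lam).depth < (22 * a + 26) * (Nat.log 2 lam + 1)) ∧
      PolyBd id fun lam => (D lam).size := by
  have ht := fun lam => Nat.le_pow_clog (b := 2) (by norm_num) (max (m lam + 2) (ℓ lam))
  choose D hD hdep hsize using fun lam =>
    exists_decCircuit (hpos lam) ((le_max_left _ _).trans (ht lam))
      ((le_max_right _ _).trans (ht lam))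
  refine ⟨D, hD, ?_, ?_⟩
  · filter_upwards [hma, hlm] with lam h1 h2
    have h3 : Nat.clog 2 (max (m lam + 2) (ℓ lam)) ≤ a * (Nat.log 2 lam + 1) := by
      rw [Nat.clog_le_iff_le_pow (by norm_num), max_eq_left (by omega)]
      exact le_pow_mul_log_two h1
    have h4 := hdep lam
    nlinarith
  · have h1 : PolyBd id fun lam => 2 ^ Nat.clog 2 (max (m lam + 2) (ℓ lam)) := by
      refine ((PolyBd.const 2).mul ((hm.add (.const 2)).add hl)).mono fun lam => ?_
      have h2 := Nat.pow_pred_clog_lt_self (b := 2) (by norm_num)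
        (x := max (m lam + 2) (ℓ lam)) (by omega)
      have h3 : 1 ≤ Nat.clog 2 (max (m lam + 2) (ℓ lam)) := Nat.clog_pos (by norm_num) (by omega)
      obtain ⟨k, hk⟩ := Nat.exists_eq_add_of_le' h3
      rw [hk] at h2 ⊢
      rw [Nat.pred_succ] at h2
      rw [pow_succ]
      omega
    refine ((hm.add ((hm.add (.const 1)).mul hl)).add
      ((h1.comp_poly (Polynomial.X ^ 22)).mul (.const (2 ^ 24)))).mono fun lam => ?_
    refine (hsize lam).trans (le_of_eq ?_)
    rw [Polynomial.eval_pow, Polynomial.eval_X, pow_add, mul_comm 22, pow_mul]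

/-- The noise condition without division, in natural numbers. -/
theorem noise_condition_nat {b m M e ℓ : ℕ}
    (h : (b : ℝ) * ((M : ℕ) : ℝ) ^ e < (2 : ℝ) ^ ℓ / (4 * ((m : ℝ) + 1))) :
    4 * ((m + 1) * b * M ^ e) < 2 ^ ℓ := by
  rw [lt_div_iff₀ (by positivity)] at h
  have h' : b * M ^ e * (4 * (m + 1)) < 2 ^ ℓ := by exact_mod_cast h
  rwa [show 4 * ((m + 1) * b * M ^ e) = b * M ^ e * (4 * (m + 1)) by ring]

theorem mainTheorem7 :
    ∃ C : ℕ, ∀ p : Polynomial ℕ, ∃ η : ℕ → ℕ,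
      (fun lam => (η lam : ℝ)) =Θ[atTop] (fun lam : ℕ => Real.log lam) ∧
      ∀ n m ℓ : ℕ → ℕ,
        (∀ lam, 1 ≤ n lam ∧ 1 ≤ m lam ∧ 1 ≤ ℓ lam) →
        (∀ lam, n lam ≤ p.eval lam ∧ m lam ≤ p.eval lam) →
        (∀ᶠ lam in atTop, C * (n lam * ℓ lam) ≤ m lam) →
        (∃ r : Polynomial ℕ, ∀ lam, m lam ≤ r.eval (n lam * ℓ lam)) →
        ∃ D : ∀ lam, Circuit (m lam + (m lam + 1) * ℓ lam) 1,
          (∀ lam, Dual.IsDecCircuit (D lam)) ∧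
          (∀ᶠ lam in atTop, (D lam).depth < η lam) ∧
          ∀ β : ℕ → ℕ,
            (∀ lam, 2 * √(n lam : ℝ) ≤ β lam) →
            (∀ᶠ lam in atTop,
              (β lam : ℝ) * (((m lam + 1) * ℓ lam + 1 : ℕ) : ℝ) ^ η lam <
                (2 : ℝ) ^ ℓ lam / (4 * ((m lam : ℝ) + 1))) →
            LWEHard n ℓ (fun lam => gaussian (ℓ lam) (β lam)) →
            IsINDCPA
              (fun lam => (Dual.keyGen (n lam) (m lam) (ℓ lam)).map fun K => K.1)
              (fun lam pk μ => DualHE.enc (β lam) pk μ) ∧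
            (DualHE.leveled n m ℓ β D).IndCPA ∧
            (DualHE.leveled n m ℓ β D).IsLeveledFHE := by
  refine ⟨4, fun p => ?_⟩
  obtain ⟨a, ha⟩ := Polynomial.eventually_eval_le_pow (p + Polynomial.C 2)
  -- Since `m + 2 ≤ λ ^ a` eventually, `a (log₂ λ + 1)` levels of carry-save adders suffice.
  obtain ⟨η, hη⟩ : ∃ η : ℕ → ℕ, ∀ lam, η lam = (22 * a + 26) * (Nat.log 2 lam + 1) :=
    ⟨_, fun _ => rfl⟩
  have hηlog : ∀ lam, Nat.log 2 lam + 1 ≤ η lam := fun lam => by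
    rw [hη]
    exact Nat.le_mul_of_pos_left _ (by omega)
  refine ⟨η, ?_, fun n m ℓ hpos hp h4 hmr => ?_⟩
  · simp only [hη]
    exact isTheta_mul_log_two _ (by omega)
  have hn : PolyBd id n := ⟨p, fun lam => (hp lam).1⟩
  have hm : PolyBd id m := ⟨p, fun lam => (hp lam).2⟩
  have hlm : ∀ᶠ lam in atTop, ℓ lam ≤ m lam := h4.mono fun lam h => by
    have := (hpos lam).1
    nlinarith
  have hl : PolyBd id ℓ := hm.of_eventually hlm
  have hma : ∀ᶠ lam in atTop, m lam + 2 ≤ lam ^ a := by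
    filter_upwards [eventually_ge_atTop 2] with lam h
    refine le_trans ?_ (ha lam h)
    simpa using (hp lam).2
  obtain ⟨D, hD, hdep, hsize⟩ :=
    Dual.exists_decCircuits hm hl (fun lam => (hpos lam).2.2) hma hlm
  simp only [← hη] at hdep
  refine ⟨D, hD, hdep, fun β hβ hnoise hlwe => ?_⟩
  have hβ0 : ∀ lam, 0 < β lam := fun lam => by
    have h1 : (1 : ℝ) ≤ √(n lam) := Real.one_le_sqrt.mpr (by exact_mod_cast (hpos lam).1)
    have h2 := hβ lam
    exact_mod_cast (by linarith : (0 : ℝ) < β lam)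
  have hnoise' : ∀ᶠ lam in atTop, 4 * ((m lam + 1) * β lam *
      ((m lam + 1) * ℓ lam + 1) ^ η lam) < 2 ^ ℓ lam :=
    hnoise.mono fun lam h => noise_condition_nat h
  have hb : ∀ᶠ lam in atTop, 4 * ((m lam + 1) * β lam *
      ((m lam + 1) * ℓ lam + 1) ^ ((D lam).depth + 1)) < 2 ^ ℓ lam := by
    filter_upwards [hnoise', hdep] with lam h1 h2
    refine lt_of_le_of_lt ?_ h1
    gcongr
    · omega
    · exact h2
  have h4β : ∀ᶠ lam in atTop, 4 * β lam < 2 ^ ℓ lam := hb.mono fun lam h => by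
    refine lt_of_le_of_lt (Nat.mul_le_mul_left 4 ?_) h
    calc β lam ≤ (m lam + 1) * β lam := Nat.le_mul_of_pos_left _ (by omega)
      _ ≤ _ := Nat.le_mul_of_pos_right _ (by positivity)
  have hneg : Negligible fun lam => (1 / 2 : ℝ) ^ ℓ lam := by
    refine .half_pow_of_pow_lt (N := fun lam => (m lam + 1) * ℓ lam) (fun lam => (hpos lam).2.2)
      (fun lam => Nat.le_mul_of_pos_left _ (by omega))
      hηlog (hnoise'.mono fun lam h => ?_)
    refine lt_of_le_of_lt ?_ h
    rw [← mul_assoc]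
    refine Nat.le_mul_of_pos_left _ ?_
    have := hβ0 lam
    positivity
  refine ⟨DualHE.isINDCPA_dualHE hlwe hmr hn hm hl hpos h4 hneg,
    DualHE.indCPA_leveled D hlwe hmr hn hm hl hpos h4 hneg,
    DualHE.compact_leveled hm hl, fun L hL => ⟨?_, ?_, ?_, ?_, ?_⟩⟩
  · exact DualHE.isPPT_keyGen_leveled hn hm hl hL hβ0 h4β
  · exact DualHE.isPPT_enc_leveled hn hm hl hβ0 h4β
  · exact DualHE.isPolyTime_dec_leveled hm hl hD hsize
  · exact DualHE.evalPolyTime_leveled hn hm hl hsize hL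
  · exact DualHE.correct_leveled (fun lam => (hpos lam).2.2) hD hb L
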